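/- (Cartan's Second Main Theorem.) Let $H_i=\{\ell_i=0\}$, $1\le i\le q$, be hyperplanes of the complex projective space $\mathbb{P}^n$ in general position, i.e. $\dim\bigcap_{i\in I}H_i\le n-|I|$ for every $I\subset\{1,\dots,q\}$ (with $\dim\emptyset=-\infty$). Let $f\colon\mathbb{C}\to\mathbb{P}^n$ be a holomorphic curve that is linearly non-degenerate (its image lies in no hyperplane), and let $F=(f_0,\dots,f_n)$ be a reduced representation of $f$ (the $f_i$ are entire without common zeros and $f=[f_0:\dots:f_n]$). Let $W(f)=F\wedge F'\wedge\dots\wedge F^{(n)}=\det\bigl(f_i^{(k)}\bigr)_{0\le i,k\le n}$ be its Wronskian. For each $i$ let $\lambda_{H_i}$ be a Weil function for $H_i$, i.e. a continuous function on $\mathbb{P}^n\setminus H_i$ such that $\lambda_{H_i}(x)+\log\frac{|\ell_i(x)|}{\|x\|}$ is bounded on $\mathbb{P}^n\setminus H_i$. Put $$m_f(r,H_i)=\int_0^{2\pi}\lambda_{H_i}\bigl(f(re^{i\theta})\bigr)\frac{d\theta}{2\pi},\qquad T_f(r,\mathcal{O}(d))=\int_0^r\frac{dt}{t}\int_{|z|<t}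 d\cdot dd^c\log\|F\|^2,\qquad dd^c=\frac{i}{2\pi}\partial\bar\partial,$$ $$\mathcal{N}([Z_{W(f)}],r)=\sum_{0<|a|\le r}\operatorname{ord}_a W(f)\,\log\frac{r}{|a|}+\operatorname{ord}_0W(f)\,\log r .$$ Then $$\sum_{i=1}^q m_f(r,H_i)+\mathcal{N}([Z_{W(f)}],r)\le T_f(r,\mathcal{O}_{\mathbb{P}^n}(n+1))+S_f(r)+O(1)\qquad(r> 0),$$ where $S_f(r)$ is a function $\mathbb{R}_{\ge0}\to\mathbb{R}_{\ge0}$ such that, for some constant $c$, $S_f(r)\le c\log T_f(r,\mathcal{O}(1))$ for all $r\geq 0$ outside a Borel set of finite Lebesgue measure, and such that, if $f$ is algebraic (given by polynomials without common zeros), moreover $S_f(r)$ is bounded for all $r\ge r_0$, for some $r_0$. -/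

import Mathlib

open MeasureTheory Set
open scoped Polynomial LinearAlgebra.Projectivization

namespace CartanSMT

/-- The affine space `ℂ^(n+1)` with its standard Hermitian norm. -/
abbrev AffineCone (n : ℕ) : Type := EuclideanSpace ℂ (Fin (n + 1))

/-- Complex projective space `P^n`. -/
abbrev ProjSpace (n : ℕ) : Type := ℙ ℂ (AffineCone n)

/-- `F = (f_0, …, f_n)` is a reduced representation of the curve `f : ℂ → P^n`: the `f_i` are
entire functions without common zeros and `f = [f_0 : … : f_n]`. -/
structure IsReducedRepresentation {n : ℕ} (F : ℂ → AffineCone n) (f : ℂ → ProjSpace n) : Prop where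
  differentiable : Differentiable ℂ F
  ne_zero : ∀ z, F z ≠ 0
  eq_mk : ∀ z, f z = Projectivization.mk ℂ (F z) (ne_zero z)

/-- The hyperplane of `P^n` cut out by a (non-zero) linear form `ℓ`. -/
def hyperplane {n : ℕ} (ℓ : Module.Dual ℂ (AffineCone n)) : Set (ProjSpace n) :=
  {p | ℓ p.rep = 0}

/-- `f` is linearly non-degenerate: its image lies in no hyperplane. -/
def IsLinearlyNondegenerate {n : ℕ} (f : ℂ → ProjSpace n) : Prop :=
  ∀ ℓ : Module.Dual ℂ (AffineCone n), ℓ ≠ 0 → ¬ range f ⊆ hyperplane ℓ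

/-- The hyperplanes `ℓ_1 = 0, …, ℓ_q = 0` are in general position:
`dim ⋂_{i ∈ I} H_i ≤ n - |I|` for every set `I` of indices, where `dim ∅ = -∞`. The intersection
is the projectivization of the linear subspace `⋂_{i ∈ I} ker ℓ_i`; it is empty iff that subspace
is zero, and otherwise its dimension is one less than that of the subspace. -/
def InGeneralPosition {n q : ℕ} (ℓ : Fin q → Module.Dual ℂ (AffineCone n)) : Prop :=
  ∀ I : Finset (Fin q),
    (⨅ i ∈ I, LinearMap.ker (ℓ i)) = ⊥ ∨
      (Module.finrank ℂ ↥(⨅ i ∈ I, LinearMap.ker (ℓ i)) : ℤ) - 1 ≤ (n : ℤ) - (I.card : ℤ)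

/-- The function `x ↦ - log (|ℓ(x)| / ‖x‖)`, which is `- log ‖σ‖_h` for the canonical section `σ`
of `O(H)` and the Fubini–Study metric `h`. -/
noncomputable def fubiniStudyWeil {n : ℕ} (ℓ : Module.Dual ℂ (AffineCone n)) (p : ProjSpace n) :
    ℝ :=
  -Real.log (‖ℓ p.rep‖ / ‖p.rep‖)

/-- `lam` is a Weil function for the hyperplane `H = {ℓ = 0}`: it is continuous on `P^n ∖ H` (for
the quotient topology of `ℂ^(n+1) ∖ {0} → P^n`) and differs from `- log ‖σ‖_h` by a quantity bounded
on `P^n ∖ H` (`P^n` is compact, so this is the same as being bounded above and below by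
continuous functions on `P^n`). The values on `H` are irrelevant. -/
structure IsWeilFunction {n : ℕ} (ℓ : Module.Dual ℂ (AffineCone n)) (lam : ProjSpace n → ℝ) :
    Prop where
  continuousOn : ContinuousOn (fun v : {v : AffineCone n // v ≠ 0} => lam (Projectivization.mk' ℂ v))
    {v | ℓ v.1 ≠ 0}
  bounded : ∃ C : ℝ, ∀ p : ProjSpace n, p ∉ hyperplane ℓ → |lam p - fubiniStudyWeil ℓ p| ≤ C

/-- The proximity function `m_f(r, H) = ∫_0^{2π} lam (f (r e^{iθ})) dθ / 2π` computed with the Weil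
function `lam` for `H`. -/
noncomputable def proximity {n : ℕ} (f : ℂ → ProjSpace n) (lam : ProjSpace n → ℝ) (r : ℝ) : ℝ :=
  Real.circleAverage (fun z => lam (f z)) 0 r

/-- The characteristic function
`T_f(r, O(d)) = ∫_0^r (dt / t) ∫_{|z| < t} d · dd^c log ‖F‖^2` with respect to the Fubini–Study
metric, where `F` is a reduced representation of `f`. As `dd^c = (i / 2π) ∂∂̄`, one has
`dd^c u = (1 / 4π) Δu dx dy`. -/
noncomputable def characteristic {n : ℕ} (F : ℂ → AffineCone n) (d : ℕ) (r : ℝ) : ℝ :=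
  ∫ t in (0 : ℝ)..r, (1 / t) * ∫ z in Metric.ball (0 : ℂ) t,
    (d : ℝ) * (1 / (4 * Real.pi) * Laplacian.laplacian (fun w => Real.log (‖F w‖ ^ 2)) z)

/-- The Wronskian `F ∧ F' ∧ … ∧ F^(n)`, as an entire function. -/
noncomputable def wronskian {n : ℕ} (F : ℂ → AffineCone n) (z : ℂ) : ℂ :=
  Matrix.det (Matrix.of fun k i : Fin (n + 1) => iteratedDeriv (k : ℕ) (fun w => F w i) z)

/-- The counting function `N([Z_g], r)` of the zeros, with multiplicity, of an entire function
`g ≢ 0`: the sum of `ord_a(g) · log (r / |a|)` over `0 < |a| ≤ r`, plus `ord_0(g) · log r`. -/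
noncomputable def zeroCounting (g : ℂ → ℂ) (r : ℝ) : ℝ :=
  Function.locallyFinsuppWithin.logCounting (MeromorphicOn.divisor g univ) r

/-- `f` is an algebraic curve: a morphism of varieties from the affine line to `P^n`, that is,
given by polynomials without common zeros. -/
def IsAlgebraicCurve {n : ℕ} (f : ℂ → ProjSpace n) : Prop :=
  ∃ P : Fin (n + 1) → ℂ[X],
    IsReducedRepresentation (fun z => WithLp.toLp 2 fun i => (P i).eval z) f

/-- `ψ` is a quantity of the type `S_f(r)`, where `f` has the reduced representation `F`:
a non-negative function on `[0, ∞)` with `ψ(r) ≤ O(log T_f(r, O(1)))` outside a Borel set of finite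
Lebesgue measure and, in case `f` is algebraic, moreover `ψ(r) ≤ O(1)` for all large `r`. -/
structure IsSmallError {n : ℕ} (f : ℂ → ProjSpace n) (F : ℂ → AffineCone n) (ψ : ℝ → ℝ) :
    Prop where
  nonneg : ∀ r, 0 ≤ r → 0 ≤ ψ r
  le_log : ∃ c : ℝ, ∃ E : Set ℝ, MeasurableSet E ∧ volume E < ⊤ ∧
    ∀ r, 0 ≤ r → r ∉ E → ψ r ≤ c * Real.log (characteristic F 1 r)
  le_of_algebraic : IsAlgebraicCurve f → ∃ c r₀ : ℝ, ∀ r, r₀ ≤ r → ψ r ≤ c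

end CartanSMT

namespace CartanSMT

open Filter Topology Laplacian

/-! ### Subharmonicity of `log ‖F‖²` and Green's formula on discs -/

/-! Fix z off the relevant zero sets. Only the forms with |ℓ_i(F)| < c‖F‖ contribute more than a
bounded amount to ∑ λ_{H_i}(f(z)). General position makes these forms linearly independent, so they
extend to a basis b_0, …, b_n of linear forms taken from a finite list. The added members cost only
a constant, and up to O(1) the sum is at most ∑ log(‖F‖/|b_k(F)|) = (n+1) log‖F‖ − log|W(F)| +
log(|W(b_0(F), …, b_n(F))| / ∏|b_k(F)|), because W(b_0(F), …, b_n(F)) is a non-zero constant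
multiple of W(F). On averaging over |z| = r, Green's formula turns the first term into T_f(r,
O(n+1)) (`characteristic_eq_circleAverage`) and Jensen's formula turns the second into −N. The bases
come from `InGeneralPosition.exists_bases`, and the averaged inequality is `exists_proximity_le`.

What remains is the lemma on logarithmic derivatives (`exists_wron_bound`). The normalized Wronskian
is bounded by a polynomial in the derivatives of the logarithmic derivatives of g = b_k(F)/b_0(F).
Blaschke factorization and the Poisson formula on a slightly larger circle bound the circle average
of |(g'/g)^(j)|^(s/(j+1)), and concavity of log passes from this to the average of the logarithm.
The larger radius is r + O(1/T), where Borel's growth lemma keeps the characteristic below 2T(r) for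
r off a set of finite measure. The exponent s = 1 − 1/log r is chosen so that no power of r
survives; the remaining factor log r is absorbed by T, which grows at least like log r for a
non-constant curve. Hence the error is O(log T), with no log r term.

For a polynomial curve, derivatives of a polynomial Q are O(Q) at infinity, so the normalized
Wronskian is bounded there. Finally ψ is the positive part of the excess minus a constant: the
inequality then holds at every r > 0, and only the growth of ψ needs proof. -/

theorem deriv_deriv_nonneg_of_isLocalMin {φ : ℝ → ℝ} {x : ℝ} (h : IsLocalMin φ x)
    (hc : ContinuousAt φ x) : 0 ≤ deriv (deriv φ) x := by
  by_contra! hneg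
  have h1 : deriv (deriv (-φ)) x > 0 := by
    rw [show deriv (-φ) = -deriv φ from funext fun y => deriv.neg]
    rw [deriv.neg]
    linarith
  have h2 : deriv (-φ) x = 0 := by rw [deriv.neg, h.deriv_eq_zero, neg_zero]
  -- If the second derivative were negative, x would also be a local maximum, so φ would be constant
  -- near x and its second derivative would vanish.
  have h3 := isLocalMin_of_deriv_deriv_pos h1 h2 hc.neg
  have h4 : φ =ᶠ[𝓝 x] fun _ => φ x := by
    filter_upwards [h, h3] with y hy hy'
    simp only [Pi.neg_apply, neg_le_neg_iff] at hy'
    exact le_antisymm hy' hy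
  have h5 : deriv φ =ᶠ[𝓝 x] fun _ => 0 := by
    have := h4.deriv
    simpa using this
  rw [h5.deriv_eq] at hneg
  simp at hneg

theorem hasDerivAt_clm_comp {A : ℂ → ℂ →L[ℝ] ℝ} {A' : ℂ →L[ℝ] ℂ →L[ℝ] ℝ} {γ δ : ℝ → ℂ}
    {γ' δ' : ℂ} {t : ℝ} (hA : HasFDerivAt A A' (γ t)) (hγ : HasDerivAt γ γ' t)
    (hδ : HasDerivAt δ δ' t) :
    HasDerivAt (fun s => A (γ s) (δ s)) (A' γ' (δ t) + A (γ t) δ') t :=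
  (hA.comp_hasDerivAt t hγ).clm_apply hδ

theorem fderiv_fderiv_nonneg_of_isLocalMin {φ : ℂ → ℝ} {z : ℂ} (h : IsLocalMin φ z)
    (hc : ContDiffAt ℝ 2 φ z) (e : ℂ) : 0 ≤ fderiv ℝ (fderiv ℝ φ) z e e := by
  have hl : ∀ t : ℝ, HasDerivAt (fun t : ℝ => z + t • e) e t := fun t => by
    simpa using ((hasDerivAt_id t).smul_const e).const_add z
  have hcont : Tendsto (fun t : ℝ => z + t • e) (𝓝 0) (𝓝 z) := by
    have : ContinuousAt (fun t : ℝ => z + t • e) 0 := by fun_prop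
    simpa [ContinuousAt] using this
  have h1 : IsLocalMin (fun t : ℝ => φ (z + t • e)) 0 := by
    have := hcont.eventually h
    simpa [IsLocalMin, IsMinFilter] using this
  have h2 : deriv (fun t : ℝ => φ (z + t • e)) =ᶠ[𝓝 0] fun t => fderiv ℝ φ (z + t • e) e := by
    have : ∀ᶠ y in 𝓝 z, ContDiffAt ℝ 2 φ y := hc.eventually (by simp)
    filter_upwards [hcont.eventually this] with t ht
    exact ((ht.differentiableAt (by simp)).hasFDerivAt.comp_hasDerivAt t (hl t)).deriv
  have h3 : HasDerivAt (fun t : ℝ => fderiv ℝ φ (z + t • e) e) (fderiv ℝ (fderiv ℝ φ) z e e) 0 := by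
    have hd : DifferentiableAt ℝ (fderiv ℝ φ) (z + (0 : ℝ) • e) := by
      simpa using (hc.fderiv_right (m := 1) (by norm_num)).differentiableAt (by simp)
    have := hasDerivAt_clm_comp (γ := fun t : ℝ => z + t • e) (δ := fun _ => e) hd.hasFDerivAt
      (hl 0) (hasDerivAt_const (0 : ℝ) e)
    rw [map_zero, add_zero, zero_smul, add_zero] at this
    exact this
  have h4 := deriv_deriv_nonneg_of_isLocalMin h1 (by
    refine ContinuousAt.comp (g := φ) (f := fun t : ℝ => z + t • e) (x := 0) ?_ (by fun_prop)
    simpa using hc.continuousAt)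
  rwa [h2.deriv_eq, h3.deriv] at h4

theorem laplacian_apply_eq_fderiv (u : ℂ → ℝ) (z : ℂ) :
    laplacian u z = fderiv ℝ (fderiv ℝ u) z 1 1 + fderiv ℝ (fderiv ℝ u) z Complex.I Complex.I := by
  rw [InnerProductSpace.laplacian_eq_iteratedFDeriv_complexPlane]
  simp [iteratedFDeriv_two_apply]

theorem contDiff_log_norm_sq {n : ℕ} {F : ℂ → AffineCone n} (hF : Differentiable ℂ F)
    (h0 : ∀ z, F z ≠ 0) : ContDiff ℝ 2 (fun w => Real.log (‖F w‖ ^ 2)) := by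
  have h1 : ContDiff ℝ 2 F := (hF.contDiff (n := 2)).restrict_scalars ℝ
  exact (h1.norm_sq ℂ).log fun z => by simpa using h0 z

/-- By Cauchy–Schwarz, log‖F w‖² − 2 log|⟨F z, F w⟩| has a minimum at w = z. The subtracted term is
harmonic near z, so the Laplacian at z is that of a function at a local minimum. -/
theorem laplacian_log_norm_sq_nonneg {n : ℕ} {F : ℂ → AffineCone n} (hF : Differentiable ℂ F)
    (h0 : ∀ z, F z ≠ 0) (z : ℂ) : 0 ≤ laplacian (fun w => Real.log (‖F w‖ ^ 2)) z := by
  set u : ℂ → ℝ := fun w => Real.log (‖F w‖ ^ 2) with hu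
  have hus := contDiff_log_norm_sq hF h0
  set g : ℂ → ℂ := fun w => inner ℂ (F z) (F w) with hg
  have hgd : Differentiable ℂ g := fun w => by
    have := ((innerSL ℂ (F z)).differentiable).comp hF
    exact this w
  have hgz : g z ≠ 0 := by
    simp only [hg, inner_self_eq_norm_sq_to_K]
    simpa using h0 z
  have hh : InnerProductSpace.HarmonicAt (fun w => Real.log ‖g w‖) z :=
    (hgd.analyticAt z).harmonicAt_log_norm hgz
  set ψ : ℂ → ℝ := fun w => -(2 * Real.log ‖g w‖) with hψ
  have hψc : ContDiffAt ℝ 2 ψ z := (contDiffAt_const.mul hh.1).neg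
  have hψl : laplacian ψ z = 0 := by
    have h1 : ψ = (-2 : ℝ) • (fun w => Real.log ‖g w‖) := by
      ext w; simp [hψ]
    rw [h1, InnerProductSpace.laplacian_smul]
    · simp [hh.2.eq_of_nhds]
    · exact hh.1
  have hmin : IsLocalMin (u + ψ) z := by
    have hne : ∀ᶠ w in 𝓝 z, g w ≠ 0 := hgd.continuous.continuousAt.eventually_ne hgz
    have hzpos : 0 < ‖F z‖ := norm_pos_iff.2 (h0 z)
    filter_upwards [hne] with w hw
    have hwpos : 0 < ‖F w‖ := norm_pos_iff.2 (h0 w)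
    have h1 : (u + ψ) z = -2 * Real.log ‖F z‖ := by
      simp only [hu, hψ, Pi.add_apply, hg, inner_self_eq_norm_sq_to_K]
      simp [Real.log_pow]
      ring
    rw [h1]
    simp only [hu, hψ, Pi.add_apply]
    have h2 : Real.log ‖g w‖ ≤ Real.log ‖F z‖ + Real.log ‖F w‖ := by
      rw [← Real.log_mul hzpos.ne' hwpos.ne']
      exact Real.log_le_log (norm_pos_iff.2 hw) (norm_inner_le_norm _ _)
    rw [Real.log_pow]
    push_cast
    linarith
  have hsum : ContDiffAt ℝ 2 (u + ψ) z := hus.contDiffAt.add hψc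
  have key : laplacian (u + ψ) z = laplacian u z := by
    rw [hus.contDiffAt.laplacian_add hψc, hψl, add_zero]
  rw [← key, laplacian_apply_eq_fderiv]
  exact add_nonneg (fderiv_fderiv_nonneg_of_isLocalMin hmin hsum _)
    (fderiv_fderiv_nonneg_of_isLocalMin hmin hsum _)

/-- The derivative of `u` in the outward radial direction, at the point `t e^{iθ}`. -/
noncomputable def radialDeriv (u : ℂ → ℝ) (t θ : ℝ) : ℝ :=
  fderiv ℝ u (circleMap 0 t θ) (circleMap 0 1 θ)

theorem hasDerivAt_circleMap_radius (t θ : ℝ) :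
    HasDerivAt (fun t : ℝ => circleMap 0 t θ) (circleMap 0 1 θ) t := by
  simp only [circleMap, zero_add, Complex.ofReal_one, one_mul]
  simpa using (Complex.ofRealCLM.hasDerivAt (x := t)).mul_const (Complex.exp (θ * Complex.I))

theorem continuous_radialDeriv {u : ℂ → ℝ} (hu : ContDiff ℝ 2 u) :
    Continuous (fun p : ℝ × ℝ => radialDeriv u p.1 p.2) := by
  have h1 : Continuous (fderiv ℝ u) := hu.continuous_fderiv (by simp)
  unfold radialDeriv circleMap
  fun_prop

theorem hasDerivAt_comp_circleMap_radius {u : ℂ → ℝ} (hu : ContDiff ℝ 2 u) (t θ : ℝ) :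
    HasDerivAt (fun t : ℝ => u (circleMap 0 t θ)) (radialDeriv u t θ) t :=
  ((hu.differentiable (by simp)) _).hasFDerivAt.comp_hasDerivAt t (hasDerivAt_circleMap_radius t θ)

/-- The circle average of the radial derivative. -/
noncomputable def radialDerivAverage (u : ℂ → ℝ) (t : ℝ) : ℝ :=
  (2 * Real.pi)⁻¹ * ∫ θ in (0 : ℝ)..2 * Real.pi, radialDeriv u t θ

theorem continuous_radialDerivAverage {u : ℂ → ℝ} (hu : ContDiff ℝ 2 u) :
    Continuous (radialDerivAverage u) :=
  continuous_const.mul (intervalIntegral.continuous_parametric_intervalIntegral_of_continuous'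
    (f := radialDeriv u) (continuous_radialDeriv hu) _ _)

theorem intervalIntegral_swap_of_continuous {G : ℝ → ℝ → ℝ}
    (hG : Continuous (fun p : ℝ × ℝ => G p.1 p.2)) (a b c d : ℝ) :
    ∫ x in a..b, ∫ y in c..d, G x y = ∫ y in c..d, ∫ x in a..b, G x y := by
  apply intervalIntegral_intervalIntegral_swap
  have : IntegrableOn (Function.uncurry G) (uIcc a b ×ˢ uIcc c d) volume :=
    ContinuousOn.integrableOn_compact (isCompact_uIcc.prod isCompact_uIcc) hG.continuousOn
  exact this.mono_set (prod_mono uIoc_subset_uIcc uIoc_subset_uIcc)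

theorem circleAverage_sub_circleAverage {u : ℂ → ℝ} (hu : ContDiff ℝ 2 u) (r R : ℝ) :
    Real.circleAverage u 0 R - Real.circleAverage u 0 r =
      ∫ t in r..R, radialDerivAverage u t := by
  have hcr := continuous_radialDeriv hu
  have huc : Continuous u := hu.continuous
  unfold radialDerivAverage
  rw [intervalIntegral.integral_const_mul, intervalIntegral_swap_of_continuous hcr]
  have h1 : ∀ θ : ℝ, ∫ t in r..R, radialDeriv u t θ = u (circleMap 0 R θ) - u (circleMap 0 r θ) :=
    fun θ => intervalIntegral.integral_eq_sub_of_hasDerivAt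
      (fun t _ => hasDerivAt_comp_circleMap_radius hu t θ)
      (Continuous.intervalIntegrable (by fun_prop) _ _)
  simp_rw [h1]
  rw [intervalIntegral.integral_sub]
  · simp [Real.circleAverage, mul_sub]
  · exact Continuous.intervalIntegrable (by fun_prop) _ _
  · exact Continuous.intervalIntegrable (by fun_prop) _ _

theorem laplacian_eq_rotated {u : ℂ → ℝ} (hu : ContDiff ℝ 2 u) (z : ℂ) (θ : ℝ) :
    laplacian u z = fderiv ℝ (fderiv ℝ u) z (circleMap 0 1 θ) (circleMap 0 1 θ) +
      fderiv ℝ (fderiv ℝ u) z (circleMap 0 1 θ * Complex.I) (circleMap 0 1 θ * Complex.I) := by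
  rw [laplacian_apply_eq_fderiv]
  set B := fderiv ℝ (fderiv ℝ u) z
  have e1 : circleMap 0 1 θ = Real.cos θ • (1 : ℂ) + Real.sin θ • Complex.I := by
    simp [circleMap, Complex.exp_mul_I]
  have e2 : circleMap 0 1 θ * Complex.I = (-Real.sin θ) • (1 : ℂ) + Real.cos θ • Complex.I := by
    rw [e1]
    simp only [Complex.real_smul, add_mul, mul_assoc, Complex.I_mul_I]
    push_cast; ring
  have hsymm : B 1 Complex.I = B Complex.I 1 := by
    have := (hu.contDiffAt (x := z)).isSymmSndFDerivAt (by simp)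
    exact this 1 Complex.I
  rw [e2, e1]
  simp only [map_add, map_smul, add_apply, smul_apply, smul_eq_mul]
  have := Real.sin_sq_add_cos_sq θ
  linear_combination (-(B 1 1) - B Complex.I Complex.I) * this

/-- In the frame (radial, tangential) the tangential second derivative, times s, differs from the
radial first derivative by the θ-derivative of a periodic function, which integrates to zero over
the circle. -/
theorem integral_laplacian_circle {u : ℂ → ℝ} (hu : ContDiff ℝ 2 u) (s : ℝ) :
    s * ∫ θ in (0 : ℝ)..2 * Real.pi, laplacian u (circleMap 0 s θ) =
      ∫ θ in (0 : ℝ)..2 * Real.pi, (radialDeriv u s θ +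
        s * fderiv ℝ (fderiv ℝ u) (circleMap 0 s θ) (circleMap 0 1 θ) (circleMap 0 1 θ)) := by
  have h1 : Continuous (fderiv ℝ u) := hu.continuous_fderiv (by simp)
  have hu1 : ContDiff ℝ 1 (fderiv ℝ u) := hu.fderiv_right (by norm_num)
  have h2 : Continuous (fderiv ℝ (fderiv ℝ u)) := hu1.continuous_fderiv (by simp)
  have hc : Continuous (radialDeriv u s) :=
    (continuous_radialDeriv hu).comp (by fun_prop : Continuous fun θ : ℝ => (s, θ))
  have hd : ∀ θ : ℝ, HasDerivAt
      (fun θ : ℝ => fderiv ℝ u (circleMap 0 s θ) (circleMap 0 1 θ * Complex.I))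
      (s * fderiv ℝ (fderiv ℝ u) (circleMap 0 s θ) (circleMap 0 1 θ * Complex.I)
        (circleMap 0 1 θ * Complex.I) - radialDeriv u s θ) θ := fun θ => by
    have hm := hasDerivAt_circleMap (0 : ℂ) s θ
    have hm1 := (hasDerivAt_circleMap (0 : ℂ) 1 θ).mul_const Complex.I
    have := hasDerivAt_clm_comp ((hu1.differentiable (by simp)) (circleMap 0 s θ)).hasFDerivAt hm hm1
    have e1 : circleMap 0 s θ * Complex.I = s • (circleMap 0 1 θ * Complex.I) := by
      simp [circleMap, mul_assoc]
    have e2 : circleMap 0 1 θ * Complex.I * Complex.I = -circleMap 0 1 θ := by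
      rw [mul_assoc, Complex.I_mul_I]; ring
    rw [e1, e2, map_neg, map_smul, smul_apply, smul_eq_mul, ← sub_eq_add_neg] at this
    exact this
  have hzero : ∫ θ in (0 : ℝ)..2 * Real.pi, (s * fderiv ℝ (fderiv ℝ u) (circleMap 0 s θ)
      (circleMap 0 1 θ * Complex.I) (circleMap 0 1 θ * Complex.I) - radialDeriv u s θ) = 0 := by
    rw [intervalIntegral.integral_eq_sub_of_hasDerivAt (fun θ _ => hd θ)
      (Continuous.intervalIntegrable (by fun_prop) _ _)]
    simp [circleMap]
  rw [← intervalIntegral.integral_const_mul, ← sub_eq_zero,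
    ← intervalIntegral.integral_sub (Continuous.intervalIntegrable (by
      simp_rw [laplacian_apply_eq_fderiv]; fun_prop) _ _)
      (Continuous.intervalIntegrable (by fun_prop) _ _)]
  refine Eq.trans (intervalIntegral.integral_congr fun θ _ => ?_) hzero
  simp only [laplacian_eq_rotated hu _ θ]
  ring

/-- The integrand left by `integral_laplacian_circle` is the s-derivative of s · `radialDeriv u s
θ`, so only the boundary term at s = t remains. -/
theorem integral_radius_laplacian {u : ℂ → ℝ} (hu : ContDiff ℝ 2 u) (t : ℝ) :
    ∫ s in (0 : ℝ)..t, s * ∫ θ in (0 : ℝ)..2 * Real.pi, laplacian u (circleMap 0 s θ) =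
      2 * Real.pi * t * radialDerivAverage u t := by
  have h1 : Continuous (fderiv ℝ u) := hu.continuous_fderiv (by simp)
  have hu1 : ContDiff ℝ 1 (fderiv ℝ u) := hu.fderiv_right (by norm_num)
  have h2 : Continuous (fderiv ℝ (fderiv ℝ u)) := hu1.continuous_fderiv (by simp)
  have hcr := continuous_radialDeriv hu
  have hcont : Continuous (fun p : ℝ × ℝ => radialDeriv u p.1 p.2 + p.1 *
      fderiv ℝ (fderiv ℝ u) (circleMap 0 p.1 p.2) (circleMap 0 1 p.2) (circleMap 0 1 p.2)) := by
    unfold circleMap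
    fun_prop
  simp_rw [integral_laplacian_circle hu]
  rw [intervalIntegral_swap_of_continuous hcont]
  have hd : ∀ θ s : ℝ, HasDerivAt (fun s : ℝ => s * radialDeriv u s θ) (radialDeriv u s θ + s *
      fderiv ℝ (fderiv ℝ u) (circleMap 0 s θ) (circleMap 0 1 θ) (circleMap 0 1 θ)) s :=
    fun θ s => by
      have := hasDerivAt_clm_comp (γ := fun t : ℝ => circleMap 0 t θ) (δ := fun _ => circleMap 0 1 θ)
        ((hu1.differentiable (by simp)) (circleMap 0 s θ)).hasFDerivAt
        (hasDerivAt_circleMap_radius s θ) (hasDerivAt_const s (circleMap 0 1 θ))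
      rw [map_zero, add_zero] at this
      have h3 := (hasDerivAt_id s).mul this
      rw [one_mul] at h3
      exact h3
  have h3 : ∀ θ : ℝ, ∫ s in (0 : ℝ)..t, (radialDeriv u s θ + s *
      fderiv ℝ (fderiv ℝ u) (circleMap 0 s θ) (circleMap 0 1 θ) (circleMap 0 1 θ)) =
      t * radialDeriv u t θ := fun θ => by
    rw [intervalIntegral.integral_eq_sub_of_hasDerivAt (fun s _ => hd θ s)]
    · simp
    · exact (hcont.comp (by fun_prop : Continuous fun s : ℝ => (s, θ))).intervalIntegrable _ _
  simp_rw [h3]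
  rw [intervalIntegral.integral_const_mul, radialDerivAverage]
  field_simp

theorem integral_ball_eq_polar {G : ℂ → ℝ} (hG : Continuous G) {t : ℝ} (ht : 0 ≤ t) :
    ∫ z in Metric.ball (0 : ℂ) t, G z =
      ∫ s in (0 : ℝ)..t, s * ∫ θ in (0 : ℝ)..2 * Real.pi, G (circleMap 0 s θ) := by
  have hper : ∀ s : ℝ, ∫ θ in (0 : ℝ)..2 * Real.pi, G (circleMap 0 s θ) =
      ∫ θ in (-Real.pi)..Real.pi, G (circleMap 0 s θ) := fun s => by
    have hp : Function.Periodic (fun θ => G (circleMap 0 s θ)) (2 * Real.pi) := fun θ => by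
      simp [periodic_circleMap 0 s θ]
    have := hp.intervalIntegral_add_eq 0 (-Real.pi)
    rw [zero_add, show -Real.pi + 2 * Real.pi = Real.pi by ring] at this
    exact this
  simp_rw [hper]
  rw [← integral_indicator measurableSet_ball, ← Complex.integral_comp_polarCoord_symm]
  have hsymm : ∀ p : ℝ × ℝ, Complex.polarCoord.symm p = circleMap 0 p.1 p.2 := fun p => by
    simp [Complex.polarCoord_symm_apply, circleMap, Complex.exp_mul_I]
  have h1 : ∀ p ∈ polarCoord.target, p.1 • (Metric.ball (0 : ℂ) t).indicator G
      (Complex.polarCoord.symm p) =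
      (Ioo 0 t ×ˢ Ioo (-Real.pi) Real.pi).indicator
        (fun p : ℝ × ℝ => p.1 * G (circleMap 0 p.1 p.2)) p := by
    rintro ⟨s, θ⟩ hp
    simp only [polarCoord_target, mem_prod, mem_Ioi] at hp
    rw [hsymm]
    by_cases hs : s < t
    · rw [indicator_of_mem, indicator_of_mem]
      · rfl
      · exact ⟨⟨hp.1, hs⟩, hp.2⟩
      · simpa [abs_of_pos hp.1] using hs
    · rw [indicator_of_notMem, indicator_of_notMem]
      · simp
      · exact fun h => hs h.1.2
      · simpa [abs_of_pos hp.1] using hs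
  rw [setIntegral_congr_fun polarCoord.open_target.measurableSet h1,
    setIntegral_indicator (measurableSet_Ioo.prod measurableSet_Ioo)]
  have h2 : polarCoord.target ∩ Ioo 0 t ×ˢ Ioo (-Real.pi) Real.pi =
      Ioo 0 t ×ˢ Ioo (-Real.pi) Real.pi := by
    refine inter_eq_right.2 fun p hp => ?_
    simp only [polarCoord_target, mem_prod]
    exact ⟨hp.1.1, hp.2⟩
  rw [h2, Measure.volume_eq_prod, setIntegral_prod]
  · rw [intervalIntegral.integral_of_le ht, integral_Ioc_eq_integral_Ioo]
    refine setIntegral_congr_fun measurableSet_Ioo fun s _ => ?_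
    simp only
    rw [intervalIntegral.integral_of_le (by linarith [Real.pi_pos]), integral_Ioc_eq_integral_Ioo,
      integral_const_mul]
  · have hc : Continuous (fun p : ℝ × ℝ => p.1 * G (circleMap 0 p.1 p.2)) := by
      unfold circleMap
      fun_prop
    have : IntegrableOn (fun p : ℝ × ℝ => p.1 * G (circleMap 0 p.1 p.2))
        (Icc 0 t ×ˢ Icc (-Real.pi) Real.pi) (volume.prod volume) :=
      ContinuousOn.integrableOn_compact (isCompact_Icc.prod isCompact_Icc) hc.continuousOn
    exact this.mono_set (prod_mono Ioo_subset_Icc_self Ioo_subset_Icc_self)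

theorem continuous_laplacian {u : ℂ → ℝ} (hu : ContDiff ℝ 2 u) : Continuous (laplacian u) := by
  have hu1 : ContDiff ℝ 1 (fderiv ℝ u) := hu.fderiv_right (by norm_num)
  have h2 : Continuous (fderiv ℝ (fderiv ℝ u)) := hu1.continuous_fderiv (by simp)
  rw [show laplacian u = _ from funext (laplacian_apply_eq_fderiv u)]
  fun_prop

/-- Green's formula on a disc. -/
theorem integral_ball_laplacian {u : ℂ → ℝ} (hu : ContDiff ℝ 2 u) {t : ℝ} (ht : 0 ≤ t) :
    ∫ z in Metric.ball (0 : ℂ) t, laplacian u z = 2 * Real.pi * t * radialDerivAverage u t := by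
  rw [integral_ball_eq_polar (continuous_laplacian hu) ht, integral_radius_laplacian hu]

theorem characteristic_eq_integral {n : ℕ} {F : ℂ → AffineCone n} (hF : Differentiable ℂ F)
    (h0 : ∀ z, F z ≠ 0) (d : ℕ) {r : ℝ} (hr : 0 ≤ r) :
    characteristic F d r =
      ∫ t in (0 : ℝ)..r, (d / 2 : ℝ) * radialDerivAverage (fun w => Real.log (‖F w‖ ^ 2)) t := by
  have hus := contDiff_log_norm_sq hF h0
  unfold characteristic
  rw [intervalIntegral.integral_of_le hr, intervalIntegral.integral_of_le hr]
  refine setIntegral_congr_fun measurableSet_Ioc fun t ht => ?_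
  have ht0 : t ≠ 0 := ht.1.ne'
  rw [integral_const_mul, integral_const_mul, integral_ball_laplacian hus ht.1.le]
  have := Real.pi_ne_zero
  field_simp
  ring

/-- Green's formula makes the integrand of the characteristic equal to d/2 times the radial
derivative of the circle average of log‖F‖². Every later estimate uses the characteristic in this
form or through its monotonicity. -/
theorem characteristic_eq_circleAverage {n : ℕ} {F : ℂ → AffineCone n} (hF : Differentiable ℂ F)
    (h0 : ∀ z, F z ≠ 0) (d : ℕ) {r : ℝ} (hr : 0 ≤ r) :
    characteristic F d r =
      d * (Real.circleAverage (fun w => Real.log ‖F w‖) 0 r - Real.log ‖F 0‖) := by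
  have hus := contDiff_log_norm_sq hF h0
  rw [characteristic_eq_integral hF h0 d hr, intervalIntegral.integral_const_mul,
    ← circleAverage_sub_circleAverage hus]
  have h2 : (fun w => Real.log (‖F w‖ ^ 2)) = fun w => (2 : ℝ) • Real.log ‖F w‖ := by
    ext w; simp [Real.log_pow]
  rw [h2, Real.circleAverage_fun_smul, Real.circleAverage_zero]
  simp only [smul_eq_mul]
  ring

theorem characteristic_mono {n : ℕ} {F : ℂ → AffineCone n} (hF : Differentiable ℂ F)
    (h0 : ∀ z, F z ≠ 0) {r R : ℝ} (hr : 0 ≤ r) (hrR : r ≤ R) :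
    characteristic F 1 r ≤ characteristic F 1 R := by
  have hus := contDiff_log_norm_sq hF h0
  have hc := continuous_radialDerivAverage hus
  rw [characteristic_eq_integral hF h0 1 hr, characteristic_eq_integral hF h0 1 (hr.trans hrR),
    ← sub_nonneg, intervalIntegral.integral_interval_sub_left
      (Continuous.intervalIntegrable (by fun_prop) _ _)
      (Continuous.intervalIntegrable (by fun_prop) _ _)]
  refine intervalIntegral.integral_nonneg hrR fun t ht => ?_
  have ht0 : 0 ≤ t := hr.trans ht.1
  rcases ht0.eq_or_lt with rfl | htp
  -- At t = 0 Green's formula reads 0 = 0 and gives no sign; the sign is obtained as a limit from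
  -- the right.
  · have hV : Tendsto (radialDerivAverage fun w => Real.log (‖F w‖ ^ 2)) (𝓝[>] 0)
        (𝓝 (radialDerivAverage (fun w => Real.log (‖F w‖ ^ 2)) 0)) :=
      hc.continuousAt.mono_left nhdsWithin_le_nhds
    have : 0 ≤ radialDerivAverage (fun w => Real.log (‖F w‖ ^ 2)) 0 := by
      refine ge_of_tendsto hV ?_
      filter_upwards [self_mem_nhdsWithin] with s hs
      have h1 := integral_ball_laplacian hus (le_of_lt hs : (0 : ℝ) ≤ s)
      have h2 : 0 ≤ 2 * Real.pi * s * radialDerivAverage (fun w => Real.log (‖F w‖ ^ 2)) s := by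
        rw [← h1]
        exact setIntegral_nonneg measurableSet_ball fun z _ =>
          laplacian_log_norm_sq_nonneg hF h0 z
      have : 0 < 2 * Real.pi * s := mul_pos Real.two_pi_pos hs
      exact nonneg_of_mul_nonneg_right h2 this
    positivity
  · have h1 := integral_ball_laplacian hus ht0
    have h2 : 0 ≤ 2 * Real.pi * t * radialDerivAverage (fun w => Real.log (‖F w‖ ^ 2)) t := by
      rw [← h1]
      exact setIntegral_nonneg measurableSet_ball fun z _ => laplacian_log_norm_sq_nonneg hF h0 z
    have h3 : 0 < 2 * Real.pi * t := mul_pos Real.two_pi_pos htp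
    have := nonneg_of_mul_nonneg_right h2 h3
    positivity

end CartanSMT

namespace CartanSMT

open Filter Topology

/-! ### Wronskians -/

/-- The Wronskian of a finite family of functions. -/
noncomputable def wron {m : ℕ} (u : Fin m → ℂ → ℂ) (z : ℂ) : ℂ :=
  Matrix.det (Matrix.of fun k i : Fin m => iteratedDeriv (k : ℕ) (u i) z)

theorem wronskian_eq_wron {n : ℕ} (F : ℂ → AffineCone n) (z : ℂ) :
    wronskian F z = wron (fun i w => F w i) z := rfl

theorem wron_congr {m : ℕ} {u v : Fin m → ℂ → ℂ} {z : ℂ} (h : ∀ i, u i =ᶠ[𝓝 z] v i) :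
    wron u z = wron v z := by
  unfold wron
  congr 1
  ext k i
  exact ((h i).iteratedDeriv k).eq_of_nhds

/-- By the Leibniz rule the matrix for v·u_i is a lower triangular matrix, with v on the diagonal,
times the matrix for the u_i. -/
theorem wron_mul {m : ℕ} {u : Fin m → ℂ → ℂ} {v : ℂ → ℂ} {z : ℂ} (hu : ∀ i, AnalyticAt ℂ (u i) z)
    (hv : AnalyticAt ℂ v z) : wron (fun i w => v w * u i w) z = v z ^ m * wron u z := by
  -- For j > k the subtraction `k - j` is truncated, but the binomial coefficient already vanishes.
  set B : Matrix (Fin m) (Fin m) ℂ :=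
    Matrix.of fun k j => ((k : ℕ).choose j : ℂ) * iteratedDeriv (k - j : ℕ) v z with hB
  have hdet : B.det = v z ^ m := by
    rw [Matrix.det_of_isLowerTriangular]
    · simp [hB]
    · intro i j hij
      have : (i : ℕ) < j := hij
      simp [hB, Nat.choose_eq_zero_of_lt this]
  rw [wron, wron, ← hdet, ← Matrix.det_mul]
  congr 1
  ext k i
  have h1 : (fun w => v w * u i w) = u i * v := by ext w; simp [mul_comm]
  simp only [Matrix.of_apply, Matrix.mul_apply, hB]
  rw [h1, iteratedDeriv_mul ((hu i).contDiffAt) hv.contDiffAt, Fin.sum_univ_eq_sum_range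
    (fun j => ((k : ℕ).choose j : ℂ) * iteratedDeriv (k - j : ℕ) v z * iteratedDeriv j (u i) z) m]
  have hk : (k : ℕ) + 1 ≤ m := k.2
  rw [← Finset.sum_subset (Finset.range_mono hk)]
  · exact Finset.sum_congr rfl fun j _ => by ring
  · intro j _ hj
    have : (k : ℕ) < j := by simpa using hj
    simp [Nat.choose_eq_zero_of_lt this]

theorem wron_linear {m : ℕ} {u : Fin m → ℂ → ℂ} {z : ℂ} (hu : ∀ i, AnalyticAt ℂ (u i) z)
    (A : Matrix (Fin m) (Fin m) ℂ) :
    wron (fun k w => ∑ i, A i k * u i w) z = wron u z * A.det := by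
  rw [wron, wron, ← Matrix.det_mul]
  congr 1
  ext k i
  simp only [Matrix.of_apply, Matrix.mul_apply]
  rw [iteratedDeriv_fun_sum fun i _ => (contDiffAt_const.mul (hu i).contDiffAt)]
  exact Finset.sum_congr rfl fun j _ => by rw [iteratedDeriv_const_mul_field, mul_comm]

theorem wron_cons_one {m : ℕ} (v : Fin m → ℂ → ℂ) (z : ℂ) :
    wron (Fin.cons (fun _ => 1) v : Fin (m + 1) → ℂ → ℂ) z = wron (fun i => deriv (v i)) z := by
  rw [wron, Matrix.det_succ_column_zero, Fin.sum_univ_succ, Finset.sum_eq_zero]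
  · simp only [Fin.val_zero, pow_zero, Matrix.of_apply, Fin.cons_zero, iteratedDeriv_zero, one_mul,
      add_zero]
    unfold wron
    congr 1
    ext k i
    simp [iteratedDeriv_succ']
  · intro k _
    simp [iteratedDeriv_const]

/-- Induction on m: where u_0 ≠ 0, dividing by u_0 gives W(1, v) = W(v'), so the v_i' satisfy a
relation on a smaller open set. On a ball it integrates to a relation among 1 and the v_i, the
constant of integration becoming the coefficient of u_0. The open set shrinks at each step; the
identity theorem restores a global relation where this is used. -/
theorem exists_linear_relation_of_wron_eq_zero {m : ℕ} : ∀ {u : Fin m → ℂ → ℂ} {U : Set ℂ},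
    IsOpen U → U.Nonempty → (∀ i, DifferentiableOn ℂ (u i) U) → (∀ z ∈ U, wron u z = 0) →
    ∃ V ⊆ U, IsOpen V ∧ V.Nonempty ∧ ∃ c : Fin m → ℂ, c ≠ 0 ∧ ∀ z ∈ V, ∑ i, c i * u i z = 0 := by
  induction m with
  | zero =>
    intro u U _ ⟨z, hz⟩ _ h
    have := h z hz
    simp [wron] at this
  | succ m ih =>
    intro u U hU hne hd h
    by_cases h0 : ∀ z ∈ U, u 0 z = 0
    · refine ⟨U, Subset.rfl, hU, hne, Pi.single 0 1, by simp, fun z hz => ?_⟩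
      simp [Pi.single_apply, h0 z hz]
    push Not at h0
    obtain ⟨z₁, hz₁, hu1⟩ := h0
    set U' : Set ℂ := U ∩ (u 0) ⁻¹' {0}ᶜ with hU'
    have hU'o : IsOpen U' := (hd 0).continuousOn.isOpen_inter_preimage hU isOpen_compl_singleton
    have hU'n : U'.Nonempty := ⟨z₁, hz₁, hu1⟩
    set v : Fin m → ℂ → ℂ := fun i w => u i.succ w / u 0 w with hv
    have hvd : ∀ i, DifferentiableOn ℂ (v i) U' := fun i =>
      ((hd _).mono inter_subset_left).div ((hd _).mono inter_subset_left) fun z hz => hz.2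
    have hw : ∀ z ∈ U', wron (fun i => deriv (v i)) z = 0 := fun z hz => by
      rw [← wron_cons_one]
      have hnhds : U' ∈ 𝓝 z := hU'o.mem_nhds hz
      have e : wron u z = u 0 z ^ (m + 1) *
          wron (Fin.cons (fun _ => 1) v : Fin (m + 1) → ℂ → ℂ) z := by
        rw [← wron_mul]
        · refine wron_congr fun i => ?_
          filter_upwards [hnhds] with w hw
          have hw2 : u 0 w ≠ 0 := hw.2
          refine Fin.cases ?_ (fun i => ?_) i
          · simp
          · simp [hv, mul_div_cancel₀ _ hw2]
        · refine Fin.cases ?_ (fun i => ?_)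
          · simpa using analyticAt_const
          · simpa using (hvd i).analyticAt hnhds
        · exact ((hd 0).mono inter_subset_left).analyticAt hnhds
      rw [h z hz.1] at e
      exact (mul_eq_zero.1 e.symm).resolve_left (pow_ne_zero _ hz.2)
    obtain ⟨V, hVU, hVo, ⟨z₂, hz₂⟩, c, hc, hrel⟩ :=
      ih hU'o hU'n (fun i => (hvd i).deriv hU'o) hw
    obtain ⟨ε, hε, hball⟩ := Metric.isOpen_iff.1 hVo z₂ hz₂
    set s : ℂ → ℂ := fun w => ∑ i, c i * v i w with hs
    have hsd : ∀ z ∈ Metric.ball z₂ ε, HasDerivAt s 0 z := fun z hz => by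
      have hz' := hball hz
      rw [← hrel z hz']
      refine HasDerivAt.fun_sum fun i _ => HasDerivAt.const_mul _ ?_
      exact ((hvd i).differentiableAt (hU'o.mem_nhds (hVU hz'))).hasDerivAt
    have hconst : ∀ z ∈ Metric.ball z₂ ε, s z = s z₂ := fun z hz =>
      (convex_ball z₂ ε).is_const_of_fderivWithin_eq_zero (𝕜 := ℂ)
        (fun w hw => (hsd w hw).differentiableAt.differentiableWithinAt)
        (fun w hw => by
          rw [fderivWithin_of_isOpen Metric.isOpen_ball hw]
          ext
          simp [(hsd w hw).hasFDerivAt.fderiv]) hz (Metric.mem_ball_self hε)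
    refine ⟨Metric.ball z₂ ε, fun z hz => (hVU (hball hz)).1, Metric.isOpen_ball,
      ⟨z₂, Metric.mem_ball_self hε⟩, Fin.cons (-s z₂) c, fun hcons => hc ?_, fun z hz => ?_⟩
    · funext i
      have := congrFun hcons i.succ
      simpa using this
    · have hz0 : u 0 z ≠ 0 := (hVU (hball hz)).2
      have h1 := hconst z hz
      rw [Fin.sum_univ_succ]
      simp only [Fin.cons_zero, Fin.cons_succ]
      rw [← h1]
      simp only [hs, hv, neg_mul, Finset.sum_mul]
      rw [← Finset.sum_neg_distrib, ← Finset.sum_add_distrib]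
      refine Finset.sum_eq_zero fun i _ => ?_
      field_simp
      ring

/-- Dividing column i by u_i(z) leaves a determinant with entries of modulus at most X. -/
theorem norm_wron_le {m : ℕ} {u : Fin m → ℂ → ℂ} {z : ℂ} {X : ℝ} (hz : ∀ i, u i z ≠ 0)
    (h : ∀ i (k : Fin m), ‖iteratedDeriv k (u i) z‖ ≤ X * ‖u i z‖) :
    ‖wron u z‖ ≤ m.factorial * X ^ m * ∏ i, ‖u i z‖ := by
  set A : Matrix (Fin m) (Fin m) ℂ := Matrix.of fun k i => (u i z)⁻¹ * iteratedDeriv (k : ℕ) (u i) z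
  have hA : wron u z = (∏ i, u i z) * A.det := by
    rw [← Matrix.det_mul_row]
    unfold wron
    congr 1
    ext k i
    simp only [Matrix.of_apply, A]
    rw [← mul_assoc, mul_inv_cancel₀ (hz i), one_mul]
  have hdet := Matrix.det_le (A := A) (abv := (NormedField.toAbsoluteValue ℂ)) (x := X) (by
    intro k i
    have := h i k
    have hpos : 0 < ‖u i z‖ := norm_pos_iff.2 (hz i)
    change ‖(u i z)⁻¹ * iteratedDeriv (k : ℕ) (u i) z‖ ≤ X
    rw [norm_mul, norm_inv]
    rw [inv_mul_le_iff₀ hpos, mul_comm]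
    exact this)
  simp only [Fintype.card_fin, nsmul_eq_mul] at hdet
  change ‖A.det‖ ≤ _ at hdet
  rw [hA, norm_mul, norm_prod, mul_comm]
  exact mul_le_mul_of_nonneg_right hdet (Finset.prod_nonneg fun i _ => norm_nonneg _)

/-- Apply the Leibniz rule to g' = g · (g'/g). The j-th derivative of g'/g has weight j + 1, so
every term of g^(k+1) has weight k + 1; each of the k + 1 terms has coefficient at most k!, which
gives (k+1)!. -/
theorem norm_iteratedDeriv_le_of_logDeriv {g : ℂ → ℂ} {z : ℂ} {M : ℝ} {m : ℕ}
    (hg : AnalyticAt ℂ g z) (hz : g z ≠ 0) (hM : 0 ≤ M)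
    (h : ∀ j < m, ‖iteratedDeriv j (logDeriv g) z‖ ≤ M ^ (j + 1)) :
    ∀ k ≤ m, ‖iteratedDeriv k g z‖ ≤ k.factorial * M ^ k * ‖g z‖ := by
  have hL : AnalyticAt ℂ (logDeriv g) z := hg.deriv.div hg hz
  have heq : deriv g =ᶠ[𝓝 z] g * logDeriv g := by
    filter_upwards [hg.continuousAt.eventually_ne hz] with w hw
    simp [logDeriv_apply, mul_div_cancel₀ _ hw]
  intro k
  induction k using Nat.strong_induction_on with
  | _ k ih =>
    intro hk
    rcases k with _ | k
    · simp
    rw [iteratedDeriv_succ', (heq.iteratedDeriv k).eq_of_nhds,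
      iteratedDeriv_mul hg.contDiffAt hL.contDiffAt]
    have hterm : ∀ j ∈ Finset.range (k + 1),
        ‖((k.choose j : ℕ) : ℂ) * iteratedDeriv j g z * iteratedDeriv (k - j) (logDeriv g) z‖ ≤
          k.factorial * M ^ (k + 1) * ‖g z‖ := fun j hj => by
      have hjk : j ≤ k := by simpa [Nat.lt_succ_iff] using hj
      have h1 := ih j (by omega) (by omega)
      have h2 := h (k - j) (by omega)
      rw [norm_mul, norm_mul, Complex.norm_natCast]
      have hfac : (k.choose j : ℝ) * j.factorial ≤ k.factorial := by
        have := Nat.choose_mul_factorial_mul_factorial hjk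
        have h3 : k.choose j * j.factorial ≤ k.factorial := by
          rw [← this]
          exact Nat.le_mul_of_pos_right _ (Nat.factorial_pos _)
        exact_mod_cast h3
      calc (k.choose j : ℝ) * ‖iteratedDeriv j g z‖ * ‖iteratedDeriv (k - j) (logDeriv g) z‖
          ≤ (k.choose j : ℝ) * (j.factorial * M ^ j * ‖g z‖) * M ^ (k - j + 1) := by gcongr
        _ = (k.choose j * j.factorial) * (M ^ (j + (k - j + 1))) * ‖g z‖ := by rw [pow_add]; ring
        _ ≤ k.factorial * M ^ (k + 1) * ‖g z‖ := by
          rw [show j + (k - j + 1) = k + 1 by omega]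
          gcongr
    refine (norm_sum_le_of_le _ hterm).trans (le_of_eq ?_)
    rw [Finset.sum_const, Finset.card_range, nsmul_eq_mul, Nat.factorial_succ]
    push_cast
    ring

/-- Dividing by u_0 first makes only quotients u_i/u_0 appear. These depend on the curve alone, and
log|u_i/u_0| is controlled by the characteristic, whereas log|u_i| changes with the reduced
representation. -/
theorem norm_wron_le_of_logDeriv {m : ℕ} {u : Fin (m + 1) → ℂ → ℂ} {z : ℂ} {M : ℝ}
    (hu : ∀ i, AnalyticAt ℂ (u i) z) (hz : ∀ i, u i z ≠ 0) (hM : 1 ≤ M)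
    (h : ∀ (i : Fin m), ∀ j < m,
      ‖iteratedDeriv j (logDeriv (fun w => u i.succ w / u 0 w)) z‖ ≤ M ^ (j + 1)) :
    ‖wron u z‖ ≤
      (m + 1).factorial * (m.factorial * M ^ m) ^ (m + 1) * ∏ i, ‖u i z‖ := by
  set g : Fin (m + 1) → ℂ → ℂ := Fin.cons (fun _ => 1) (fun i w => u i.succ w / u 0 w) with hg
  have hga : ∀ i, AnalyticAt ℂ (g i) z := by
    refine Fin.cases ?_ (fun i => ?_)
    · simpa [hg] using analyticAt_const
    · simpa [hg] using (hu i.succ).fun_div (hu 0) (hz 0)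
  have hgz : ∀ i, g i z ≠ 0 := by
    refine Fin.cases ?_ (fun i => ?_)
    · simp [hg]
    · simpa [hg] using ⟨hz i.succ, hz 0⟩
  have hug : ∀ i, u i =ᶠ[𝓝 z] fun w => u 0 w * g i w := by
    intro i
    filter_upwards [(hu 0).continuousAt.eventually_ne (hz 0)] with w hw
    refine Fin.cases ?_ (fun i => ?_) i
    · simp [hg]
    · simp [hg, mul_div_cancel₀ _ hw]
  have hfm : ∀ k ≤ m, (k.factorial : ℝ) * M ^ k ≤ m.factorial * M ^ m := fun k hk => by
    have : (k.factorial : ℝ) ≤ m.factorial := by exact_mod_cast Nat.factorial_le hk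
    gcongr
  have hw := norm_wron_le (u := g) (z := z) (X := m.factorial * M ^ m) hgz (by
    intro i k
    have hkm : (k : ℕ) ≤ m := Nat.lt_succ_iff.1 k.2
    revert i
    refine Fin.cases ?_ (fun i => ?_)
    · simp only [hg, Fin.cons_zero, iteratedDeriv_const]
      have h1 := hfm 0 (Nat.zero_le _)
      simp only [Nat.factorial_zero, Nat.cast_one, pow_zero, mul_one] at h1
      split_ifs <;> simp <;> linarith
    · have h1 := norm_iteratedDeriv_le_of_logDeriv (hga i.succ) (hgz i.succ) (by linarith)
        (m := m) (by simpa [hg] using h i) k hkm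
      exact h1.trans (mul_le_mul_of_nonneg_right (hfm k hkm) (norm_nonneg _)))
  rw [wron_congr hug, wron_mul hga (hu 0), norm_mul, norm_pow]
  have hprod : ∏ i, ‖u i z‖ = ‖u 0 z‖ ^ (m + 1) * ∏ i, ‖g i z‖ := by
    rw [← Fin.prod_const, ← Finset.prod_mul_distrib]
    exact Finset.prod_congr rfl fun i _ => by rw [(hug i).eq_of_nhds, norm_mul]
  rw [hprod]
  calc ‖u 0 z‖ ^ (m + 1) * ‖wron g z‖ ≤ ‖u 0 z‖ ^ (m + 1) *
        ((m + 1).factorial * (m.factorial * M ^ m) ^ (m + 1) * ∏ i, ‖g i z‖) := by gcongr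
    _ = _ := by ring

end CartanSMT

namespace CartanSMT

open Filter Topology Metric ComplexConjugate

/-! ### Blaschke factorization of entire functions on a disc -/

theorem analyticOrderAt_ne_top_of_entire {u : ℂ → ℂ} (hu : Differentiable ℂ u) (h0 : ∃ z, u z ≠ 0)
    (a : ℂ) : analyticOrderAt u a ≠ ⊤ := by
  intro h
  obtain ⟨z, hz⟩ := h0
  have := AnalyticOnNhd.eq_of_eventuallyEq (f := u) (g := fun _ => 0)
    (fun w _ => hu.analyticAt w) (fun w _ => analyticAt_const) (analyticOrderAt_eq_top.1 h)
  exact hz (congrFun this z)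

theorem exists_eq_pow_mul_of_entire {u : ℂ → ℂ} (hu : Differentiable ℂ u) (h0 : ∃ z, u z ≠ 0)
    (a : ℂ) : ∃ h : ℂ → ℂ, Differentiable ℂ h ∧ h a ≠ 0 ∧
      ∀ z, u z = (z - a) ^ analyticOrderNatAt u a * h z := by
  obtain ⟨h, hh, hha, heq⟩ := ((hu.analyticAt a).analyticOrderNatAt_eq_iff
    (analyticOrderAt_ne_top_of_entire hu h0 a)).1 rfl
  classical
  set n := analyticOrderNatAt u a
  set H : ℂ → ℂ := fun z => if z = a then h a else u z / (z - a) ^ n with hH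
  have hev : H =ᶠ[𝓝 a] h := by
    filter_upwards [heq] with z hz
    by_cases hza : z = a
    · simp [hH, hza]
    · have : (z - a) ^ n ≠ 0 := pow_ne_zero _ (sub_ne_zero.2 hza)
      simp only [hH, hza, if_false, hz, smul_eq_mul]
      field_simp
  refine ⟨H, fun z => ?_, by simpa [hH] using hha, fun z => ?_⟩
  · by_cases hza : z = a
    · rw [hza]
      exact hev.differentiableAt_iff.2 hh.differentiableAt
    · have h1 : H =ᶠ[𝓝 z] fun z => u z / (z - a) ^ n := by
        filter_upwards [isOpen_ne.mem_nhds hza] with w hw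
        have : w ≠ a := hw
        simp [hH, this]
      refine h1.differentiableAt_iff.2 ((hu z).fun_div (by fun_prop) ?_)
      exact pow_ne_zero _ (sub_ne_zero.2 hza)
  · by_cases hza : z = a
    · have := heq.self_of_nhds
      rw [hza, this]
      simp [hH]
    · have : (z - a) ^ n ≠ 0 := pow_ne_zero _ (sub_ne_zero.2 hza)
      simp only [hH, hza, if_false]
      field_simp

theorem exists_eq_prod_mul_of_entire {u : ℂ → ℂ} (hu : Differentiable ℂ u) (h0 : ∃ z, u z ≠ 0)
    (S : Finset ℂ) : ∃ h : ℂ → ℂ, Differentiable ℂ h ∧ (∀ a ∈ S, h a ≠ 0) ∧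
      ∀ z, u z = (∏ a ∈ S, (z - a) ^ analyticOrderNatAt u a) * h z := by
  induction S using Finset.induction_on with
  | empty => exact ⟨u, hu, by simp, by simp⟩
  | insert a S ha ih =>
    obtain ⟨h, hh, hS, heq⟩ := ih
    have h0' : ∃ z, h z ≠ 0 := by
      obtain ⟨z, hz⟩ := h0
      exact ⟨z, right_ne_zero_of_mul (heq z ▸ hz)⟩
    obtain ⟨h', hh', ha', heq'⟩ := exists_eq_pow_mul_of_entire hh h0' a
    have hord : analyticOrderNatAt u a = analyticOrderNatAt h a := by
      have hp : AnalyticAt ℂ (fun z => ∏ b ∈ S, (z - b) ^ analyticOrderNatAt u b) a := by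
        fun_prop
      have hpa : analyticOrderAt (fun z => ∏ b ∈ S, (z - b) ^ analyticOrderNatAt u b) a = 0 := by
        rw [hp.analyticOrderAt_eq_zero]
        refine Finset.prod_ne_zero_iff.2 fun b hb => pow_ne_zero _ (sub_ne_zero.2 ?_)
        rintro rfl
        exact ha hb
      have h1 : u = (fun z => ∏ b ∈ S, (z - b) ^ analyticOrderNatAt u b) * h := funext heq
      conv_lhs => rw [h1]
      rw [analyticOrderNatAt_mul hp (hh.analyticAt a) (by rw [hpa]; simp)
        (analyticOrderAt_ne_top_of_entire hh h0' a)]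
      have h2 : analyticOrderNatAt (fun z => ∏ b ∈ S, (z - b) ^ analyticOrderNatAt u b) a = 0 := by
        change (analyticOrderAt (fun z => ∏ b ∈ S, (z - b) ^ analyticOrderNatAt u b) a).toNat = 0
        rw [hpa]
        rfl
      rw [h2, zero_add]
    refine ⟨h', hh', fun b hb => ?_, fun z => ?_⟩
    · rcases Finset.mem_insert.1 hb with rfl | hb
      · exact ha'
      · exact right_ne_zero_of_mul (heq' b ▸ hS b hb)
    · rw [Finset.prod_insert ha, heq, heq', hord]
      ring

theorem finite_zeros_closedBall {u : ℂ → ℂ} (hu : Differentiable ℂ u) (h0 : ∃ z, u z ≠ 0)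
    (R : ℝ) : {z | u z = 0 ∧ ‖z‖ ≤ R}.Finite := by
  obtain ⟨z, hz⟩ := h0
  have h1 := AnalyticOnNhd.preimage_zero_mem_codiscrete (f := u) (fun w _ => hu.analyticAt w) hz
  have h2 := (isCompact_closedBall (0 : ℂ) R).finite_sdiff_of_mem_codiscreteWithin
    (Filter.codiscreteWithin_mono (subset_univ _) h1)
  refine h2.subset fun w hw => ⟨by simpa using hw.2, by simp [hw.1]⟩

theorem countable_zeros {u : ℂ → ℂ} (hu : Differentiable ℂ u) (h0 : ∃ z, u z ≠ 0) :
    {z | u z = 0}.Countable := by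
  have : {z | u z = 0} = ⋃ n : ℕ, {z | u z = 0 ∧ ‖z‖ ≤ n} := by
    ext z
    simp only [Set.mem_ofPred_eq, mem_iUnion, exists_and_left, iff_self_and]
    exact fun _ => exists_nat_ge _
  rw [this]
  exact countable_iUnion fun n => (finite_zeros_closedBall hu h0 n).countable

/-- The zeros of an entire function in a closed disc. -/
noncomputable def zerosIn (u : ℂ → ℂ) (R : ℝ) : Finset ℂ :=
  haveI := Classical.dec ({z | u z = 0 ∧ ‖z‖ ≤ R}.Finite)
  if h : {z | u z = 0 ∧ ‖z‖ ≤ R}.Finite then h.toFinset else ∅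

theorem mem_zerosIn {u : ℂ → ℂ} (hu : Differentiable ℂ u) (h0 : ∃ z, u z ≠ 0) {R : ℝ} {z : ℂ} :
    z ∈ zerosIn u R ↔ u z = 0 ∧ ‖z‖ ≤ R := by
  simp [zerosIn, finite_zeros_closedBall hu h0 R]

theorem norm_sub_eq_blaschke {R : ℝ} (hR : 0 < R) {z : ℂ} (hz : ‖z‖ = R) (a : ℂ) :
    ‖((R : ℂ) ^ 2 - conj a * z) / R‖ = ‖z - a‖ := by
  have h1 : (R : ℂ) ^ 2 = conj z * z := by
    rw [← Complex.normSq_eq_conj_mul_self, Complex.normSq_eq_norm_sq, hz]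
    push_cast; rfl
  rw [h1, ← sub_mul, norm_div, norm_mul, ← map_sub, Complex.norm_conj, hz, Complex.norm_real,
    Real.norm_of_nonneg hR.le, mul_div_cancel_right₀ _ hR.ne']

theorem blaschke_ne_zero {R : ℝ} (hR : 0 < R) {a z : ℂ} (ha : ‖a‖ < R) (hz : ‖z‖ ≤ R) :
    (R : ℂ) ^ 2 - conj a * z ≠ 0 := by
  intro h
  have h1 : ‖(R : ℂ) ^ 2‖ = ‖conj a * z‖ := by rw [sub_eq_zero.1 h]
  rw [norm_pow, Complex.norm_real, Real.norm_of_nonneg hR.le, norm_mul, Complex.norm_conj] at h1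
  nlinarith [norm_nonneg a, norm_nonneg z]

/-- Each factor z − a is replaced by (R² − āz)/R, which has the same modulus on |z| = R and no zero
in the closed disc. The resulting g is zero-free there, so the Poisson formula applies to log|g|,
and the boundary values are still those of u. -/
theorem exists_blaschke {u : ℂ → ℂ} (hu : Differentiable ℂ u) (h0 : ∃ z, u z ≠ 0) {R : ℝ}
    (hR : 0 < R) (hsphere : ∀ z, ‖z‖ = R → u z ≠ 0) :
    ∃ g : ℂ → ℂ, Differentiable ℂ g ∧ (∀ z, ‖z‖ ≤ R → g z ≠ 0) ∧ (∀ z, ‖z‖ = R → ‖g z‖ = ‖u z‖) ∧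
      ∀ z, ‖z‖ < R → u z ≠ 0 → logDeriv u z = logDeriv g z +
        ∑ a ∈ zerosIn u R, (analyticOrderNatAt u a : ℂ) *
          (1 / (z - a) + conj a / ((R : ℂ) ^ 2 - conj a * z)) := by
  obtain ⟨h, hh, hS, heq⟩ := exists_eq_prod_mul_of_entire hu h0 (zerosIn u R)
  set S := zerosIn u R with hSdef
  have hmem : ∀ a ∈ S, u a = 0 ∧ ‖a‖ < R := fun a ha => by
    have := (mem_zerosIn hu h0).1 ha
    exact ⟨this.1, this.2.lt_of_ne fun h => hsphere a h this.1⟩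
  have hh0 : ∀ z, ‖z‖ ≤ R → h z ≠ 0 := fun z hz hhz => by
    have huz : u z = 0 := by rw [heq, hhz, mul_zero]
    exact hS z ((mem_zerosIn hu h0).2 ⟨huz, hz⟩) hhz
  set B : ℂ → ℂ → ℂ := fun a z => ((R : ℂ) ^ 2 - conj a * z) / R with hB
  have hRC : (R : ℂ) ≠ 0 := by exact_mod_cast hR.ne'
  have hBd : ∀ a, Differentiable ℂ (B a) := fun a => by
    simp only [hB]
    fun_prop
  have hB0 : ∀ a ∈ S, ∀ z, ‖z‖ ≤ R → B a z ≠ 0 := fun a ha z hz =>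
    div_ne_zero (blaschke_ne_zero hR (hmem a ha).2 hz) hRC
  refine ⟨fun z => (∏ a ∈ S, B a z ^ analyticOrderNatAt u a) * h z, ?_, fun z hz => ?_,
    fun z hz => ?_, fun z hz huz => ?_⟩
  · refine Differentiable.fun_mul ?_ hh
    exact Differentiable.fun_finsetProd fun a _ => (hBd a).pow _
  · exact mul_ne_zero (Finset.prod_ne_zero_iff.2 fun a ha => pow_ne_zero _ (hB0 a ha z hz)) (hh0 z hz)
  · rw [heq z, norm_mul, norm_mul, norm_prod, norm_prod]
    congr 1
    refine Finset.prod_congr rfl fun a _ => ?_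
    rw [norm_pow, norm_pow, norm_sub_eq_blaschke hR hz]
  · have hza : ∀ a ∈ S, z - a ≠ 0 := fun a ha h => huz (by
      rw [sub_eq_zero.1 h]; exact (hmem a ha).1)
    have hu1 : u = fun z => (∏ a ∈ S, (z - a) ^ analyticOrderNatAt u a) * h z := funext heq
    have e1 : logDeriv u z = ∑ a ∈ S, (analyticOrderNatAt u a : ℂ) * (1 / (z - a)) + logDeriv h z := by
      conv_lhs => rw [hu1]
      rw [logDeriv_mul (f := fun z => ∏ a ∈ S, (z - a) ^ analyticOrderNatAt u a) z
        (Finset.prod_ne_zero_iff.2 fun a ha => pow_ne_zero _ (hza a ha))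
        (hh0 z hz.le) (by fun_prop) (hh z)]
      rw [logDeriv_prod (f := fun a z => (z - a) ^ analyticOrderNatAt u a)
        (fun a ha => pow_ne_zero _ (hza a ha)) (fun a _ => by fun_prop)]
      congr 1
      refine Finset.sum_congr rfl fun a ha => ?_
      rw [logDeriv_fun_pow (by fun_prop)]
      simp [logDeriv_apply]
    have e2 : logDeriv (fun z => (∏ a ∈ S, B a z ^ analyticOrderNatAt u a) * h z) z =
        ∑ a ∈ S, (analyticOrderNatAt u a : ℂ) * (-conj a / ((R : ℂ) ^ 2 - conj a * z)) +
          logDeriv h z := by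
      rw [logDeriv_mul (f := fun z => ∏ a ∈ S, B a z ^ analyticOrderNatAt u a) z
        (Finset.prod_ne_zero_iff.2 fun a ha => pow_ne_zero _ (hB0 a ha z hz.le))
        (hh0 z hz.le) (DifferentiableAt.fun_finsetProd fun a _ => ((hBd a) z).pow _) (hh z)]
      rw [logDeriv_prod (f := fun a z => B a z ^ analyticOrderNatAt u a)
        (fun a ha => pow_ne_zero _ (hB0 a ha z hz.le))
        (fun a _ => ((hBd a) z).pow _)]
      congr 1
      refine Finset.sum_congr rfl fun a ha => ?_
      rw [logDeriv_fun_pow ((hBd a) z)]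
      congr 1
      have hd : HasDerivAt (B a) (-conj a / R) z := by
        have := (((hasDerivAt_id z).const_mul (conj a)).const_sub ((R : ℂ) ^ 2)).div_const (R : ℂ)
        simpa [hB] using this
      rw [logDeriv_apply, hd.deriv]
      have := blaschke_ne_zero hR (hmem a ha).2 hz.le
      simp only [hB]
      field_simp
    rw [e1, e2]
    simp only [mul_add, Finset.sum_add_distrib, neg_div, mul_neg, Finset.sum_neg_distrib]
    ring

/-! ### Counting functions of entire functions and Jensen's formula. -/

theorem divisor_univ_apply {u : ℂ → ℂ} (hu : Differentiable ℂ u) (h0 : ∃ z, u z ≠ 0) (a : ℂ) :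
    MeromorphicOn.divisor u univ a = (analyticOrderNatAt u a : ℤ) := by
  rw [MeromorphicOn.AnalyticOnNhd.divisor_apply (fun w _ => hu.analyticAt w) (mem_univ a),
    ← Nat.cast_analyticOrderNatAt (analyticOrderAt_ne_top_of_entire hu h0 a)]
  rfl

/-- Every zero with 0 < |a| ≤ R has weight log(R'/|a|) ≥ log(R'/R). A zero at the origin has weight
log R', which is large enough because R ≥ 1. -/
theorem sum_order_mul_log_le_zeroCounting {u : ℂ → ℂ} (hu : Differentiable ℂ u)
    (h0 : ∃ z, u z ≠ 0) {R R' : ℝ} (hR : 1 ≤ R) (hRR' : R ≤ R') :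
    (∑ a ∈ zerosIn u R, (analyticOrderNatAt u a : ℝ)) * Real.log (R' / R) ≤ zeroCounting u R' := by
  have hR0 : 0 < R := by linarith
  have hR'0 : 0 < R' := by linarith
  set D := MeromorphicOn.divisor u univ with hD
  have hDa : ∀ a, D a = (analyticOrderNatAt u a : ℤ) := divisor_univ_apply hu h0
  have hlog : 0 ≤ Real.log (R' / R) := Real.log_nonneg ((one_le_div hR0).2 hRR')
  set T := zerosIn u R' with hT
  have htb : ∀ a : ℂ, ‖a‖ ≤ R' →
      (Function.locallyFinsuppWithin.toClosedBall R' D) a = (analyticOrderNatAt u a : ℤ) :=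
    fun a ha => by
      rw [Function.locallyFinsuppWithin.toClosedBall_eval_within _
        (by simpa [abs_of_pos hR'0] using ha), hDa]
  have hval : zeroCounting u R' =
      ∑ a ∈ T, (analyticOrderNatAt u a : ℝ) * Real.log (R' * ‖a‖⁻¹) +
        (analyticOrderNatAt u 0 : ℝ) * Real.log R' := by
    change Function.locallyFinsuppWithin.logCounting D R' = _
    simp only [Function.locallyFinsuppWithin.logCounting, AddMonoidHom.coe_mk, ZeroHom.coe_mk]
    rw [hDa 0]
    congr 1
    rw [finsum_eq_sum_of_support_subset (s := T)]
    · refine Finset.sum_congr rfl fun a ha => ?_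
      rw [htb a ((mem_zerosIn hu h0).1 ha).2]
      simp
    · intro a ha
      have h1 : (Function.locallyFinsuppWithin.toClosedBall R' D) a ≠ 0 := by
        intro h; simp [h] at ha
      have h2 : ‖a‖ ≤ R' := by
        have := Function.locallyFinsuppWithin.toClosedBall_support_subset_closedBall D
          (show a ∈ Function.support _ from h1)
        simpa [abs_of_pos hR'0] using this
      rw [htb a h2] at h1
      exact (mem_zerosIn hu h0).2
        ⟨apply_eq_zero_of_analyticOrderNatAt_ne_zero (by exact_mod_cast h1), h2⟩
  rw [hval, Finset.sum_mul]
  have hsub : zerosIn u R ⊆ T := fun a ha =>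
    (mem_zerosIn hu h0).2 ⟨((mem_zerosIn hu h0).1 ha).1, ((mem_zerosIn hu h0).1 ha).2.trans hRR'⟩
  have hpt : ∀ a : ℂ, ‖a‖ ≤ R' → 0 ≤ Real.log (R' * ‖a‖⁻¹) := fun a ha => by
    rcases eq_or_ne a 0 with rfl | ha0
    · simp
    · refine Real.log_nonneg ?_
      rw [← div_eq_mul_inv]
      exact (one_le_div (norm_pos_iff.2 ha0)).2 ha
  have hlogR : Real.log (R' / R) ≤ Real.log R' :=
    Real.log_le_log (div_pos hR'0 hR0) (div_le_self hR'0.le hR)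
  -- At a = 0 the term log(R' · ‖a‖⁻¹) is log 0 = 0 by convention, so the origin is accounted for by
  -- the separate summand.
  have hstep : ∑ a ∈ zerosIn u R, (analyticOrderNatAt u a : ℝ) * Real.log (R' / R) ≤
      ∑ a ∈ zerosIn u R, ((analyticOrderNatAt u a : ℝ) * Real.log (R' * ‖a‖⁻¹) +
        if a = 0 then (analyticOrderNatAt u 0 : ℝ) * Real.log R' else 0) := by
    refine Finset.sum_le_sum fun a ha => ?_
    have haR := ((mem_zerosIn hu h0).1 ha).2
    split_ifs with ha0
    · subst ha0
      simp only [norm_zero, inv_zero, mul_zero, Real.log_zero, zero_add]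
      gcongr
    · rw [add_zero]
      have hpos := norm_pos_iff.2 ha0
      rw [div_eq_mul_inv]
      gcongr
  refine hstep.trans ?_
  rw [Finset.sum_add_distrib]
  refine add_le_add (Finset.sum_le_sum_of_subset_of_nonneg hsub fun a ha _ => ?_) ?_
  · exact mul_nonneg (Nat.cast_nonneg _) (hpt a ((mem_zerosIn hu h0).1 ha).2)
  · rw [Finset.sum_ite_eq']
    have : 0 ≤ (analyticOrderNatAt u 0 : ℝ) * Real.log R' :=
      mul_nonneg (Nat.cast_nonneg _) (Real.log_nonneg (by linarith))
    split_ifs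
    · exact le_rfl
    · exact this

theorem zeroCounting_eq_circleAverage {u : ℂ → ℂ} (hu : Differentiable ℂ u) {R : ℝ} (hR : R ≠ 0) :
    zeroCounting u R = Real.circleAverage (fun z => Real.log ‖u z‖) 0 R -
      Real.log ‖meromorphicTrailingCoeffAt u 0‖ :=
  Function.locallyFinsuppWithin.logCounting_divisor_eq_circleAverage_sub_const
    (fun z => (hu.analyticAt z).meromorphicAt) hR

/-! ### The Poisson–Jensen estimate for logarithmic derivatives -/

/-- The Herglotz integral h of the boundary values of log|G| is holomorphic with real part log|G|.
Thus G·e^(−h) has modulus 1, hence is constant, and G'/G = h'. -/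
theorem logDeriv_eq_circleAverage {G : ℂ → ℂ} {R : ℝ}
    (hG : ∀ w ∈ closedBall (0 : ℂ) R, AnalyticAt ℂ G w) (h0 : ∀ w ∈ closedBall (0 : ℂ) R, G w ≠ 0)
    {z : ℂ} (hz : z ∈ ball (0 : ℂ) R) :
    logDeriv G z = Real.circleAverage
      (fun ζ => (2 * ζ / (ζ - z) ^ 2) • ((Real.log ‖G ζ‖ : ℝ) : ℂ)) 0 R := by
  have hR : 0 < R := pos_of_mem_ball hz
  set g : ℂ → ℝ := fun ζ => Real.log ‖G ζ‖ with hg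
  have hgc : ContinuousOn g (closedBall 0 R) := fun w hw =>
    ((hG w hw).continuousAt.norm.log (norm_ne_zero_iff.2 (h0 w hw))).continuousWithinAt
  have hgs : ContinuousOn g (sphere 0 |R|) := hgc.mono (by
    rw [abs_of_pos hR]; exact sphere_subset_closedBall)
  have hgi : CircleIntegrable g 0 R := hgs.circleIntegrable'
  have hgi' : CircleIntegrable (fun ζ => (g ζ : ℂ)) 0 R :=
    (Complex.continuous_ofReal.comp_continuousOn hgs).circleIntegrable'
  set h : ℂ → ℂ := fun w => Real.circleAverage
    (fun ζ => herglotzRieszKernel 0 w ζ • (g ζ : ℂ)) 0 R with hh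
  have hd : ∀ w ∈ ball (0 : ℂ) R, HasDerivAt h (Real.circleAverage
      (fun ζ => (2 * ζ / (ζ - w) ^ 2) • (g ζ : ℂ)) 0 R) w := fun w hw =>
    hasDerivAt_circleAverage_herglotzRieszKernel_smul hgi' hw
  have hre : ∀ w ∈ ball (0 : ℂ) R, (h w).re = g w := fun w hw => by
    rw [hh, re_circleAverage_herglotzRieszKernel_smul hgi hw]
    exact InnerProductSpace.HarmonicOnNhd.circleAverage_re_herglotzRieszKernel_smul
      (fun x hx => (hG x hx).harmonicAt_log_norm (h0 x hx)) hw
  set D : ℂ → ℂ := fun w => G w * Complex.exp (-h w) with hD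
  have hDd : ∀ w ∈ ball (0 : ℂ) R, HasDerivAt D (deriv G w * Complex.exp (-h w) +
      G w * (Complex.exp (-h w) * -Real.circleAverage
      (fun ζ => (2 * ζ / (ζ - w) ^ 2) • (g ζ : ℂ)) 0 R)) w := fun w hw =>
    ((hG w (ball_subset_closedBall hw)).differentiableAt.hasDerivAt).mul ((hd w hw).neg.cexp)
  have hD1 : ∀ w ∈ ball (0 : ℂ) R, ‖D w‖ = 1 := fun w hw => by
    have hw0 := norm_pos_iff.2 (h0 w (ball_subset_closedBall hw))
    rw [hD, norm_mul, Complex.norm_exp, Complex.neg_re, hre w hw, Real.exp_neg, hg,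
      Real.exp_log hw0, mul_inv_cancel₀ hw0.ne']
  have hconst : ∀ w ∈ ball (0 : ℂ) R, D w = D z := by
    intro w hw
    refine Complex.eqOn_of_isPreconnected_of_isMaxOn_norm (convex_ball (0 : ℂ) R).isPreconnected
      isOpen_ball (fun x hx => (hDd x hx).differentiableAt.differentiableWithinAt) hz ?_ hw
    intro x hx
    simp [hD1 x hx, hD1 z hz]
  have hz' : HasDerivAt D 0 z := by
    refine (hasDerivAt_const z (D z)).congr_of_eventuallyEq ?_
    filter_upwards [isOpen_ball.mem_nhds hz] with w hw using hconst w hw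
  have := (hDd z hz).unique hz'
  rw [logDeriv_apply, div_eq_iff (h0 z (ball_subset_closedBall hz))]
  have he := Complex.exp_ne_zero (-h z)
  have h2 : Complex.exp (-h z) * (deriv G z - Real.circleAverage
      (fun ζ => (2 * ζ / (ζ - z) ^ 2) • (g ζ : ℂ)) 0 R * G z) = 0 := by
    linear_combination this
  exact sub_eq_zero.1 ((mul_eq_zero.1 h2).resolve_left he)

theorem norm_circleAverage_le (φ : ℂ → ℂ) (R : ℝ) :
    ‖Real.circleAverage φ 0 R‖ ≤ Real.circleAverage (fun z => ‖φ z‖) 0 R := by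
  have h := Real.two_pi_pos
  rw [Real.circleAverage_def, Real.circleAverage_def, norm_smul, smul_eq_mul, norm_inv,
    Real.norm_of_nonneg h.le]
  gcongr
  exact intervalIntegral.norm_integral_le_integral_norm h.le

/-- Cauchy's estimate on the circle of radius (R − |z|)/2 about z. For x on it, |ζ − x| ≥ |ζ − z|/2
for |ζ| = R, so 2R/|ζ − x|² ≤ 8R/|ζ − z|². Keeping the kernel centred at z allows it to be averaged
exactly over |z| = r. -/
theorem norm_iteratedDeriv_logDeriv_le {G : ℂ → ℂ} {R : ℝ}
    (hG : ∀ w ∈ closedBall (0 : ℂ) R, AnalyticAt ℂ G w) (h0 : ∀ w ∈ closedBall (0 : ℂ) R, G w ≠ 0)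
    {z : ℂ} (hz : ‖z‖ < R) (j : ℕ) :
    ‖iteratedDeriv j (logDeriv G) z‖ ≤ j.factorial * (2 / (R - ‖z‖)) ^ j *
      (8 * R * Real.circleAverage (fun w => |Real.log ‖G w‖| * (1 / ‖w - z‖ ^ 2)) 0 R) := by
  have hR : 0 < R := (norm_nonneg z).trans_lt hz
  set δ : ℝ := (R - ‖z‖) / 2 with hδ
  have hδ0 : 0 < δ := by rw [hδ]; linarith
  have hgc : ContinuousOn (fun ζ => Real.log ‖G ζ‖) (closedBall 0 R) := fun w hw =>
    ((hG w hw).continuousAt.norm.log (norm_ne_zero_iff.2 (h0 w hw))).continuousWithinAt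
  have hgs : ContinuousOn (fun ζ => Real.log ‖G ζ‖) (sphere 0 |R|) := hgc.mono (by
    rw [abs_of_pos hR]; exact sphere_subset_closedBall)
  have hsub : closedBall z δ ⊆ ball 0 R := fun w hw => by
    rw [mem_closedBall, dist_eq_norm] at hw
    rw [mem_ball_zero_iff]
    have := norm_add_le (w - z) z
    rw [sub_add_cancel] at this
    linarith
  have hdiff : ∀ w ∈ ball (0 : ℂ) R, DifferentiableAt ℂ (logDeriv G) w := fun w hw => by
    have h1 := hG w (ball_subset_closedBall hw)
    exact (h1.deriv.div h1 (h0 w (ball_subset_closedBall hw))).differentiableAt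
  have hne : ∀ ζ ∈ sphere (0 : ℂ) |R|, ∀ x ∈ ball (0 : ℂ) R, ζ - x ≠ 0 := fun ζ hζ x hx h => by
    rw [sub_eq_zero] at h
    rw [mem_sphere_zero_iff_norm, abs_of_pos hR] at hζ
    rw [mem_ball_zero_iff] at hx
    rw [h] at hζ
    linarith
  have hbound : ∀ x ∈ sphere z δ, ‖logDeriv G x‖ ≤
      8 * R * Real.circleAverage (fun w => |Real.log ‖G w‖| * (1 / ‖w - z‖ ^ 2)) 0 R := by
    intro x hx
    have hxb := hsub (sphere_subset_closedBall hx)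
    rw [logDeriv_eq_circleAverage hG h0 hxb, ← smul_eq_mul (8 * R), ← Real.circleAverage_fun_smul]
    refine (norm_circleAverage_le _ _).trans ?_
    have hxz : ‖x - z‖ = δ := by rw [← dist_eq_norm]; exact hx
    refine Real.circleAverage_mono ?_ ?_ ?_
    · refine ContinuousOn.circleIntegrable' ?_
      have h1 : ContinuousOn (fun ζ : ℂ => 2 * ζ / (ζ - x) ^ 2) (sphere 0 |R|) :=
        ContinuousOn.div (by fun_prop) (by fun_prop) fun ζ hζ => pow_ne_zero _ (hne ζ hζ x hxb)
      exact (h1.smul (Complex.continuous_ofReal.comp_continuousOn hgs)).norm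
    · refine ContinuousOn.circleIntegrable' ?_
      have h1 : ContinuousOn (fun ζ : ℂ => 1 / ‖ζ - z‖ ^ 2) (sphere 0 |R|) :=
        ContinuousOn.div (by fun_prop) (by fun_prop)
          fun ζ hζ => pow_ne_zero _ (norm_ne_zero_iff.2 (hne ζ hζ z (by simpa using hz)))
      exact (hgs.abs.mul h1).const_smul (8 * R)
    · intro ζ hζ
      rw [mem_sphere_zero_iff_norm, abs_of_pos hR] at hζ
      have h1 : 2 * δ ≤ ‖ζ - z‖ := by
        have := norm_add_le (ζ - z) z
        rw [sub_add_cancel, hζ] at this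
        rw [hδ]; linarith
      have h2 : ‖ζ - z‖ / 2 ≤ ‖ζ - x‖ := by
        have := norm_add_le (ζ - x) (x - z)
        rw [sub_add_sub_cancel, hxz] at this
        linarith
      have h3 : 0 < ‖ζ - z‖ := by linarith
      simp only [norm_div, norm_mul, norm_pow, Complex.norm_real, Real.norm_eq_abs,
        Complex.norm_ofNat, hζ, smul_eq_mul]
      calc 2 * R / ‖ζ - x‖ ^ 2 * |Real.log ‖G ζ‖|
          ≤ 2 * R / (‖ζ - z‖ / 2) ^ 2 * |Real.log ‖G ζ‖| := by gcongr
        _ = _ := by field_simp; ring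
  have := Complex.norm_iteratedDeriv_le_of_forall_mem_sphere_norm_le j hδ0
    (f := logDeriv G) (c := z) ((DifferentiableOn.diffContOnCl (fun w hw => by
      rw [closure_ball z hδ0.ne'] at hw
      exact (hdiff w (hsub hw)).differentiableWithinAt))) hbound
  refine this.trans (le_of_eq ?_)
  rw [hδ, div_pow, div_pow]
  field_simp

/-- With a = r²/w̄ the reflection of w in the circle |z| = r, one has r|w − z| = R|z − a| on that
circle. The kernel becomes a constant times the Poisson kernel at a, whose average is 1. -/
theorem circleAverage_inv_norm_sub_sq {r R : ℝ} (hr : 0 < r) (hrR : r < R) {w : ℂ} (hw : ‖w‖ = R) :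
    Real.circleAverage (fun z => 1 / ‖w - z‖ ^ 2) 0 r = 1 / (R ^ 2 - r ^ 2) := by
  have hR : 0 < R := hr.trans hrR
  have hr2 : r ^ 2 < R ^ 2 := by gcongr
  set a : ℂ := r ^ 2 / conj w with ha
  have hw0 : conj w ≠ 0 := by
    rw [← norm_ne_zero_iff, Complex.norm_conj, hw]; exact hR.ne'
  have hna : ‖a‖ = r ^ 2 / R := by
    rw [ha, norm_div, Complex.norm_conj, hw, norm_pow, Complex.norm_real, Real.norm_of_nonneg hr.le]
  have har : ‖a‖ < r := by
    rw [hna, div_lt_iff₀ hR, sq]; gcongr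
  have hP := InnerProductSpace.HarmonicOnNhd.circleAverage_poissonKernel_smul (c := (0 : ℂ)) (R := r)
    (f := fun _ => (1 : ℝ)) (w := a) (fun x _ => InnerProductSpace.harmonicAt_const _) (by simpa using har)
  have hsymm : ∀ z ∈ sphere (0 : ℂ) |r|, 1 / ‖w - z‖ ^ 2 =
      (1 / (R ^ 2 - r ^ 2)) • (poissonKernel 0 a • fun _ => (1 : ℝ)) z := by
    intro z hz
    rw [mem_sphere_zero_iff_norm, abs_of_pos hr] at hz
    have h1 : ‖w - z‖ * r = ‖z - a‖ * R := by
      have h2 : conj (w - z) * z = (z - a) * conj w := by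
        have : conj z * z = (r : ℂ) ^ 2 := by
          rw [← Complex.normSq_eq_conj_mul_self, Complex.normSq_eq_norm_sq, hz]
          push_cast; rfl
        rw [map_sub, sub_mul, this, sub_mul, ha, div_mul_cancel₀ _ hw0]
        ring
      have := congrArg norm h2
      rwa [norm_mul, norm_mul, Complex.norm_conj, Complex.norm_conj, hz, hw] at this
    have h3 : 0 < ‖z - a‖ := by
      have := norm_sub_norm_le z a
      linarith
    have h4 : ‖w - z‖ = ‖z - a‖ * R / r := by
      rw [eq_div_iff hr.ne', h1]
    have h5 : R ^ 2 - r ^ 2 ≠ 0 := by linarith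
    simp only [Pi.smul_apply', poissonKernel_def, sub_zero, hz, hna, smul_eq_mul, mul_one, h4]
    field_simp
  rw [Real.circleAverage_congr_sphere hsymm, Real.circleAverage_fun_smul, hP]
  simp

/-! ### Averages of fractional powers of derivatives of logarithmic derivatives -/

theorem circleAverage_circleAverage_div_norm_sub_sq {φ : ℂ → ℝ} {r R : ℝ} (hr : 0 < r) (hrR : r < R)
    (hφ : ContinuousOn φ (sphere 0 R)) :
    Real.circleAverage (fun z => Real.circleAverage (fun w => φ w * (1 / ‖w - z‖ ^ 2)) 0 R) 0 r =
      Real.circleAverage φ 0 R / (R ^ 2 - r ^ 2) := by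
  have hR : 0 < R := hr.trans hrR
  have hcont : Continuous fun p : ℝ × ℝ => φ (circleMap 0 R p.2) *
      (1 / ‖circleMap 0 R p.2 - circleMap 0 r p.1‖ ^ 2) := by
    have h1 : Continuous fun p : ℝ × ℝ => φ (circleMap 0 R p.2) :=
      (hφ.comp_continuous (by fun_prop) fun θ => circleMap_mem_sphere 0 hR.le θ).comp continuous_snd
    refine h1.mul (Continuous.div (by fun_prop) (by fun_prop) fun p => ?_)
    refine pow_ne_zero _ (norm_ne_zero_iff.2 (sub_ne_zero.2 fun h => ?_))
    have := congrArg norm h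
    simp only [norm_circleMap_zero, abs_of_pos hr, abs_of_pos hR] at this
    linarith
  have hinner : ∀ θ : ℝ, Real.circleAverage (fun z => 1 / ‖circleMap 0 R θ - z‖ ^ 2) 0 r =
      1 / (R ^ 2 - r ^ 2) := fun θ => circleAverage_inv_norm_sub_sq hr hrR (by
        rw [norm_circleMap_zero, abs_of_pos hR])
  simp only [Real.circleAverage_def, smul_eq_mul] at hinner ⊢
  rw [intervalIntegral.integral_const_mul, intervalIntegral_swap_of_continuous hcont]
  simp only [intervalIntegral.integral_const_mul]
  have : ∀ θ : ℝ, ∫ θ' in (0 : ℝ)..2 * Real.pi, 1 / ‖circleMap 0 R θ - circleMap 0 r θ'‖ ^ 2 =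
      2 * Real.pi * (1 / (R ^ 2 - r ^ 2)) := fun θ => by
    rw [← hinner θ]
    have := Real.two_pi_pos.ne'
    field_simp
  simp only [this, intervalIntegral.integral_mul_const]
  have := Real.two_pi_pos.ne'
  field_simp

/-- Rotate a onto the positive real axis: then |z − a| ≥ |Im z| = r|sin θ|. On each quarter circle
|sin| is at least 2/π times the angle to the axis, and θ^(−s) is integrable since s < 1. -/
theorem circleAverage_norm_sub_rpow_neg_le {r s : ℝ} (hr : 0 < r) (hs : 0 < s) (hs1 : s < 1) {a : ℂ}
    (ha : ‖a‖ ≠ r) :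
    Real.circleAverage (fun z => ‖z - a‖ ^ (-s)) 0 r ≤ r ^ (-s) / (1 - s) := by
  set η := Complex.arg a with hη
  set g : ℝ → ℝ := fun θ => ‖circleMap 0 r (θ + η) - a‖ ^ (-s) with hg
  have hgc : Continuous g := by
    refine Continuous.rpow_const (by fun_prop) fun θ => Or.inl (norm_ne_zero_iff.2 fun h => ha ?_)
    rw [← sub_eq_zero.1 h, norm_circleMap_zero, abs_of_pos hr]
  have hgb : ∀ θ, |Real.sin θ| ≠ 0 → g θ ≤ r ^ (-s) * |Real.sin θ| ^ (-s) := fun θ hθ => by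
    have h1 : r * |Real.sin θ| ≤ ‖circleMap 0 r (θ + η) - a‖ := by
      have h2 : circleMap 0 r (θ + η) - a =
          Complex.exp (η * Complex.I) * (r * Complex.exp (θ * Complex.I) - ‖a‖) := by
        conv_lhs => rw [← Complex.norm_mul_exp_arg_mul_I a]
        rw [circleMap_zero]
        push_cast
        rw [add_mul, Complex.exp_add]
        ring
      rw [h2, norm_mul, Complex.norm_exp_ofReal_mul_I, one_mul]
      refine le_trans (le_of_eq ?_) (Complex.abs_im_le_norm _)
      rw [Complex.sub_im, Complex.im_ofReal_mul, Complex.exp_ofReal_mul_I_im, Complex.ofReal_im,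
        sub_zero, abs_mul, abs_of_pos hr]
    have h0 : 0 < |Real.sin θ| := (abs_nonneg _).lt_of_ne' hθ
    calc g θ ≤ (r * |Real.sin θ|) ^ (-s) :=
          Real.rpow_le_rpow_of_nonpos (by positivity) h1 (by linarith)
      _ = _ := Real.mul_rpow hr.le h0.le
  have hpi := Real.pi_pos
  -- each quarter of the circle
  have hquarter : ∀ γ : ℝ → ℝ, Continuous γ → (∀ θ, |Real.sin (γ θ)| = |Real.sin θ|) →
      ∫ θ in (0 : ℝ)..Real.pi / 2, g (γ θ) ≤ r ^ (-s) * (Real.pi / 2) / (1 - s) := by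
    intro γ hγ hsin
    have hint : ∫ θ in (0 : ℝ)..Real.pi / 2, (r ^ (-s) * (2 / Real.pi) ^ (-s)) * θ ^ (-s) =
        r ^ (-s) * (Real.pi / 2) / (1 - s) := by
      rw [intervalIntegral.integral_const_mul, integral_rpow (Or.inl (by linarith)),
        Real.zero_rpow (by linarith), sub_zero, show -s + 1 = 1 - s by ring]
      have h1 : (2 / Real.pi) ^ (-s) * (Real.pi / 2) ^ (1 - s) = Real.pi / 2 := by
        rw [show 2 / Real.pi = (Real.pi / 2)⁻¹ by rw [inv_div], Real.inv_rpow (by positivity),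
          ← Real.rpow_neg (by positivity), neg_neg, ← Real.rpow_add (by positivity)]
        simp
      rw [mul_assoc, ← mul_div_assoc, h1, mul_div_assoc]
    rw [← hint]
    refine intervalIntegral.integral_mono_on_of_le_Ioo (by positivity)
      ((hgc.comp hγ).intervalIntegrable _ _)
      ((intervalIntegral.intervalIntegrable_rpow' (by linarith)).const_mul _) fun θ hθ => ?_
    have hsinθ : 2 / Real.pi * θ ≤ |Real.sin θ| :=
      (Real.mul_le_sin hθ.1.le hθ.2.le).trans (le_abs_self _)
    have hpos : 0 < 2 / Real.pi * θ := mul_pos (by positivity) hθ.1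
    calc g (γ θ) ≤ r ^ (-s) * |Real.sin θ| ^ (-s) := by
          have := hgb (γ θ) (by rw [hsin]; exact (hpos.trans_le hsinθ).ne')
          rwa [hsin] at this
      _ ≤ r ^ (-s) * (2 / Real.pi * θ) ^ (-s) := by
          gcongr ?_ * ?_
          exact Real.rpow_le_rpow_of_nonpos hpos hsinθ (by linarith)
      _ = _ := by rw [Real.mul_rpow (by positivity) hθ.1.le, mul_assoc]
  have hI : ∀ a b : ℝ, IntervalIntegrable g volume a b := fun a b => hgc.intervalIntegrable _ _
  have e1 := hquarter (fun θ => θ) continuous_id fun θ => rfl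
  have e2 := hquarter (fun θ => Real.pi - θ) (by fun_prop) fun θ => by rw [Real.sin_pi_sub]
  have e3 := hquarter (fun θ => Real.pi + θ) (by fun_prop) fun θ => by
    rw [add_comm, Real.sin_add_pi, abs_neg]
  have e4 := hquarter (fun θ => 2 * Real.pi - θ) (by fun_prop) fun θ => by
    rw [Real.sin_two_pi_sub, abs_neg]
  rw [intervalIntegral.integral_comp_sub_left (fun x => g x)] at e2 e4
  rw [intervalIntegral.integral_comp_add_left (fun x => g x)] at e3
  have hsum : ∫ θ in (0 : ℝ)..2 * Real.pi, g θ ≤ 4 * (r ^ (-s) * (Real.pi / 2) / (1 - s)) := by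
    rw [← intervalIntegral.integral_add_adjacent_intervals (hI 0 Real.pi) (hI _ _),
      ← intervalIntegral.integral_add_adjacent_intervals (hI 0 (Real.pi / 2)) (hI _ Real.pi),
      ← intervalIntegral.integral_add_adjacent_intervals (hI Real.pi (Real.pi + Real.pi / 2)) (hI _ _)]
    have q2 : Real.pi - Real.pi / 2 = Real.pi / 2 := by ring
    have q4 : 2 * Real.pi - Real.pi / 2 = Real.pi + Real.pi / 2 := by ring
    rw [q2, sub_zero] at e2
    rw [q4, sub_zero] at e4
    rw [add_zero] at e3
    linarith
  rw [Real.circleAverage_eq_integral_add η, smul_eq_mul]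
  calc (2 * Real.pi)⁻¹ * ∫ θ in (0 : ℝ)..2 * Real.pi, g θ
      ≤ (2 * Real.pi)⁻¹ * (4 * (r ^ (-s) * (Real.pi / 2) / (1 - s))) := by gcongr
    _ = _ := by field_simp; ring

theorem rpow_sum_le_sum_rpow {ι : Type*} (S : Finset ι) (x : ι → ℝ) (hx : ∀ i ∈ S, 0 ≤ x i) {t : ℝ}
    (ht : 0 < t) (ht1 : t ≤ 1) : (∑ i ∈ S, x i) ^ t ≤ ∑ i ∈ S, x i ^ t := by
  classical
  induction S using Finset.induction_on with
  | empty => simp [Real.zero_rpow ht.ne']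
  | insert i S hi ih =>
    rw [Finset.sum_insert hi, Finset.sum_insert hi]
    have h1 : ∀ k ∈ S, 0 ≤ x k := fun k hk => hx k (Finset.mem_insert_of_mem hk)
    refine (Real.rpow_add_le_add_rpow (hx i (Finset.mem_insert_self _ _))
      (Finset.sum_nonneg h1) ht.le ht1).trans ?_
    gcongr
    exact ih h1

theorem natCast_rpow_le {t : ℝ} (ht : 0 < t) (ht1 : t ≤ 1) (N : ℕ) : (N : ℝ) ^ t ≤ N := by
  rcases Nat.eq_zero_or_pos N with rfl | hN
  · simp [Real.zero_rpow ht.ne']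
  · have h1 : (1 : ℝ) ≤ N := by exact_mod_cast hN
    calc (N : ℝ) ^ t ≤ (N : ℝ) ^ (1 : ℝ) := Real.rpow_le_rpow_of_exponent_le h1 ht1
      _ = N := Real.rpow_one _

theorem rpow_le_one_add {x t : ℝ} (hx : 0 ≤ x) (ht : 0 ≤ t) (ht1 : t ≤ 1) : x ^ t ≤ 1 + x := by
  rcases le_total x 1 with h | h
  · exact (Real.rpow_le_one hx h ht).trans (by linarith)
  · calc x ^ t ≤ x ^ (1 : ℝ) := Real.rpow_le_rpow_of_exponent_le h ht1
      _ ≤ 1 + x := by rw [Real.rpow_one]; linarith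

theorem norm_iteratedDeriv_one_div_sub (j : ℕ) (p z : ℂ) :
    ‖iteratedDeriv j (fun w => 1 / (w - p)) z‖ = j.factorial * (‖z - p‖⁻¹) ^ (j + 1) := by
  have h1 : (fun w : ℂ => 1 / (w - p)) = fun w => Inv.inv (w - p) := by
    funext w; rw [one_div]
  rw [h1, iteratedDeriv_comp_sub_const, iteratedDeriv_eq_iterate]
  simp only
  rw [iter_deriv_inv]
  have h2 : (-1 - j : ℤ) = -((j + 1 : ℕ) : ℤ) := by push_cast; ring
  rw [h2, zpow_neg, zpow_natCast]
  simp

/-- The poles contributed by the zeros of `u` in the disc of radius `R`, and by their reflections. -/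
noncomputable def blaschkePoles (u : ℂ → ℂ) (R : ℝ) (z : ℂ) : ℂ :=
  ∑ a ∈ zerosIn u R, (analyticOrderNatAt u a : ℂ) *
    (1 / (z - a) + conj a / ((R : ℂ) ^ 2 - conj a * z))

/-- The second part of a Blaschke term is a simple pole at the reflected point, so zeros and
reflections obey the same estimate. For a = 0 there is no reflection: division by zero places it at
0, and the coefficient 0 removes it. -/
theorem conj_div_eq_ite {R : ℝ} (a z : ℂ) :
    conj a / ((R : ℂ) ^ 2 - conj a * z) =
      (if a = 0 then 0 else -1) * (1 / (z - (R : ℂ) ^ 2 / conj a)) := by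
  split_ifs with h
  · simp [h]
  · have h' : conj a ≠ 0 := by simpa using h
    have h3 : z - (R : ℂ) ^ 2 / conj a = -(((R : ℂ) ^ 2 - conj a * z) / conj a) := by
      field_simp; ring
    rw [h3, one_div, inv_neg, inv_div]
    ring

/-- The condition z ≠ 0 serves only a = 0, whose reflection is 0 by convention. -/
theorem sub_reflection_ne_zero {R : ℝ} {a z : ℂ} (haR : ‖a‖ < R) (hz : ‖z‖ < R) (hz0 : z ≠ 0) :
    z - (R : ℂ) ^ 2 / conj a ≠ 0 := by
  intro h
  have hR : 0 < R := (norm_nonneg a).trans_lt haR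
  rcases eq_or_ne a 0 with rfl | ha
  · apply hz0
    simpa using h
  · have h' : conj a ≠ 0 := by simpa using ha
    rw [sub_eq_zero, eq_div_iff h'] at h
    exact blaschke_ne_zero hR haR hz.le (by rw [← h]; ring)

theorem analyticAt_blaschkePoles {u : ℂ → ℂ} {R : ℝ} {z : ℂ}
    (hS : ∀ a ∈ zerosIn u R, z - a ≠ 0 ∧ (R : ℂ) ^ 2 - conj a * z ≠ 0) :
    AnalyticAt ℂ (blaschkePoles u R) z := by
  unfold blaschkePoles
  refine Finset.analyticAt_fun_sum _ fun a ha => analyticAt_const.mul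
    (AnalyticAt.add (analyticAt_const.div (by fun_prop) (hS a ha).1)
      (analyticAt_const.div (by fun_prop) (hS a ha).2))

/-- The exponent s/(j+1) turns the pole |z − p|^(−(j+1)) of the j-th derivative into |z − p|^(−s),
which has a bounded mean on circles. As the exponent is at most 1, the power is subadditive, and
integer coefficients do not grow under it. -/
theorem norm_iteratedDeriv_blaschkePoles_rpow_le {u : ℂ → ℂ} {R : ℝ} {z : ℂ}
    (hS : ∀ a ∈ zerosIn u R, z - a ≠ 0 ∧ z - (R : ℂ) ^ 2 / conj a ≠ 0)
    {s : ℝ} (hs : 0 < s) (hs1 : s < 1) (j : ℕ) :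
    ‖iteratedDeriv j (blaschkePoles u R) z‖ ^ (s / (j + 1 : ℝ)) ≤
      ∑ a ∈ zerosIn u R, (j.factorial * analyticOrderNatAt u a : ℝ) *
        (‖z - a‖ ^ (-s) + ‖z - (R : ℂ) ^ 2 / conj a‖ ^ (-s)) := by
  have hj : (0 : ℝ) < j + 1 := by positivity
  have ht : 0 < s / (j + 1 : ℝ) := by positivity
  have ht1 : s / (j + 1 : ℝ) ≤ 1 := by
    rw [div_le_one hj]; linarith [(Nat.cast_nonneg j : (0 : ℝ) ≤ j)]
  have hfun : blaschkePoles u R = fun z => ∑ a ∈ zerosIn u R, ((analyticOrderNatAt u a : ℂ) *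
      (1 / (z - a)) + ((analyticOrderNatAt u a : ℂ) * (if a = 0 then 0 else -1)) *
        (1 / (z - (R : ℂ) ^ 2 / conj a))) := by
    funext w
    unfold blaschkePoles
    refine Finset.sum_congr rfl fun a _ => ?_
    rw [conj_div_eq_ite, mul_add, mul_assoc]
  have hc1 : ∀ p : ℂ, z - p ≠ 0 → ContDiffAt ℂ j (fun w => 1 / (w - p)) z := fun p hp =>
    (contDiffAt_const.div (contDiffAt_id.sub contDiffAt_const) hp)
  have hnorm : ‖iteratedDeriv j (blaschkePoles u R) z‖ ≤ ∑ a ∈ zerosIn u R,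
      ((j.factorial * analyticOrderNatAt u a : ℕ) : ℝ) *
        ((‖z - a‖⁻¹) ^ (j + 1) + (‖z - (R : ℂ) ^ 2 / conj a‖⁻¹) ^ (j + 1)) := by
    rw [hfun, iteratedDeriv_fun_sum fun a ha =>
      (contDiffAt_const.mul (hc1 _ (hS a ha).1)).add (contDiffAt_const.mul (hc1 _ (hS a ha).2))]
    refine (norm_sum_le _ _).trans (Finset.sum_le_sum fun a ha => ?_)
    rw [iteratedDeriv_fun_add (contDiffAt_const.mul (hc1 _ (hS a ha).1))
      (contDiffAt_const.mul (hc1 _ (hS a ha).2)), iteratedDeriv_const_mul_field,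
      iteratedDeriv_const_mul_field]
    refine (norm_add_le _ _).trans ?_
    rw [norm_mul, norm_mul, norm_mul, norm_iteratedDeriv_one_div_sub, norm_iteratedDeriv_one_div_sub,
      Complex.norm_natCast]
    have h1 : ‖(if a = 0 then 0 else -1 : ℂ)‖ ≤ 1 := by split_ifs <;> simp
    push_cast
    have h2 : (analyticOrderNatAt u a : ℝ) * ‖(if a = 0 then 0 else -1 : ℂ)‖ *
        (j.factorial * (‖z - (R : ℂ) ^ 2 / conj a‖⁻¹) ^ (j + 1)) ≤ (analyticOrderNatAt u a : ℝ) * 1 *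
        (j.factorial * (‖z - (R : ℂ) ^ 2 / conj a‖⁻¹) ^ (j + 1)) := by gcongr
    linarith
  have hpow : ∀ x : ℝ, 0 ≤ x → ((x⁻¹) ^ (j + 1)) ^ (s / (j + 1 : ℝ)) = x ^ (-s) := fun x hx => by
    rw [← Real.rpow_natCast, ← Real.rpow_mul (inv_nonneg.2 hx)]
    have : ((j + 1 : ℕ) : ℝ) * (s / (j + 1 : ℝ)) = s := by
      push_cast; field_simp
    rw [this, Real.inv_rpow hx, Real.rpow_neg hx]
  refine (Real.rpow_le_rpow (norm_nonneg _) hnorm ht.le).trans ?_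
  refine (rpow_sum_le_sum_rpow _ _ (fun a _ => by positivity) ht ht1).trans ?_
  refine Finset.sum_le_sum fun a _ => ?_
  rw [Real.mul_rpow (by positivity) (by positivity)]
  refine mul_le_mul ((natCast_rpow_le ht ht1 _).trans (by push_cast; exact le_rfl)) ?_ (by positivity)
    (by positivity)
  refine (Real.rpow_add_le_add_rpow (by positivity) (by positivity) ht.le ht1).trans ?_
  rw [hpow _ (norm_nonneg _), hpow _ (norm_nonneg _)]

/-- The number of zeros of `u`, with multiplicity, in the closed disc of radius `R`. -/
noncomputable def zeroCard (u : ℂ → ℂ) (R : ℝ) : ℝ :=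
  ∑ a ∈ zerosIn u R, (analyticOrderNatAt u a : ℝ)

theorem continuousOn_norm_sub_rpow {r s : ℝ} (hr : 0 < r) {a : ℂ} (ha : ‖a‖ ≠ r) :
    ContinuousOn (fun z : ℂ => ‖z - a‖ ^ (-s)) (sphere 0 |r|) := by
  refine ContinuousOn.rpow_const (by fun_prop) fun z hz => Or.inl (norm_ne_zero_iff.2 fun h => ha ?_)
  rw [← sub_eq_zero.1 h]
  simpa [abs_of_pos hr] using hz

theorem norm_reflection_ne {r R : ℝ} (hr : 0 < r) (hrR : r < R) {a : ℂ} (haR : ‖a‖ < R) :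
    ‖(R : ℂ) ^ 2 / conj a‖ ≠ r := by
  intro h
  have hz0 : (R : ℂ) ^ 2 / conj a ≠ 0 := norm_pos_iff.1 (h ▸ hr)
  exact sub_reflection_ne_zero haR (by rw [h]; exact hrR) hz0 (sub_self _)

theorem circleIntegrable_and_circleAverage_poles_le {u : ℂ → ℂ} {r R s : ℝ} (hr : 0 < r)
    (hrR : r < R) (hs : 0 < s) (hs1 : s < 1)
    (hS : ∀ a ∈ zerosIn u R, ‖a‖ ≠ r ∧ ‖a‖ < R) (j : ℕ) :
    ContinuousOn (fun z => ∑ a ∈ zerosIn u R, (j.factorial * analyticOrderNatAt u a : ℝ) *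
        (‖z - a‖ ^ (-s) + ‖z - (R : ℂ) ^ 2 / conj a‖ ^ (-s))) (sphere 0 |r|) ∧
    Real.circleAverage (fun z => ∑ a ∈ zerosIn u R, (j.factorial * analyticOrderNatAt u a : ℝ) *
        (‖z - a‖ ^ (-s) + ‖z - (R : ℂ) ^ 2 / conj a‖ ^ (-s))) 0 r ≤
      j.factorial * (2 * zeroCard u R) * (r ^ (-s) / (1 - s)) := by
  have hterm : ∀ a ∈ zerosIn u R, ContinuousOn (fun z =>
      (j.factorial * analyticOrderNatAt u a : ℝ) *
        (‖z - a‖ ^ (-s) + ‖z - (R : ℂ) ^ 2 / conj a‖ ^ (-s))) (sphere 0 |r|) := fun a ha =>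
    continuousOn_const.mul ((continuousOn_norm_sub_rpow hr (hS a ha).1).add
      (continuousOn_norm_sub_rpow hr (norm_reflection_ne hr hrR (hS a ha).2)))
  refine ⟨continuousOn_finsetSum _ hterm, ?_⟩
  rw [Real.circleAverage_fun_sum fun a ha => (hterm a ha).circleIntegrable']
  rw [zeroCard, Finset.mul_sum, Finset.mul_sum, Finset.sum_mul]
  refine Finset.sum_le_sum fun a ha => ?_
  have h1 := circleAverage_norm_sub_rpow_neg_le hr hs hs1 (hS a ha).1
  have h2 := circleAverage_norm_sub_rpow_neg_le hr hs hs1 (norm_reflection_ne hr hrR (hS a ha).2)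
  have h3 := Real.circleAverage_fun_add (continuousOn_norm_sub_rpow (s := s) hr
    (hS a ha).1).circleIntegrable' (continuousOn_norm_sub_rpow (s := s) hr
      (norm_reflection_ne hr hrR (hS a ha).2)).circleIntegrable'
  simp only [← smul_eq_mul (_ * _ : ℝ)]
  rw [Real.circleAverage_fun_smul, h3, smul_eq_mul]
  calc (j.factorial * analyticOrderNatAt u a : ℝ) * (_ + _) ≤
      (j.factorial * analyticOrderNatAt u a : ℝ) * (r ^ (-s) / (1 - s) + r ^ (-s) / (1 - s)) := by
        gcongr
    _ = _ := by simp only [smul_eq_mul]; ring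

theorem continuousOn_iteratedDeriv_logDeriv {u v : ℂ → ℂ} (hu : Differentiable ℂ u)
    (hv : Differentiable ℂ v) {S : Set ℂ} (huS : ∀ z ∈ S, u z ≠ 0) (hvS : ∀ z ∈ S, v z ≠ 0) (j : ℕ) :
    ContinuousOn (iteratedDeriv j (logDeriv fun w => u w / v w)) S := fun z hz => by
  have h1 : AnalyticAt ℂ (fun w => u w / v w) z :=
    (hu.analyticAt z).div (hv.analyticAt z) (hvS z hz)
  have h2 : AnalyticAt ℂ (logDeriv fun w => u w / v w) z :=
    h1.deriv.div h1 (div_ne_zero (huS z hz) (hvS z hz))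
  rw [iteratedDeriv_eq_iterate]
  exact (h2.iterated_deriv j).continuousAt.continuousWithinAt

/-- Write (u/v)'/(u/v) as G'/G plus the poles of u minus those of v, with G zero-free in the disc.
The poles are averaged with their fractional power, twice per zero because of the reflections. For
the regular part x^t ≤ 1 + x restores the first power, so that Fubini and the exact mean of the
kernel apply. -/
theorem circleAverage_iteratedDeriv_logDeriv_rpow_le {u v : ℂ → ℂ} (hu : Differentiable ℂ u)
    (hv : Differentiable ℂ v) {r R s : ℝ} (hr : 0 < r)
    (hrR : r < R) (hs : 0 < s) (hs1 : s < 1) (hur : ∀ z, ‖z‖ = r → u z ≠ 0)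
    (hvr : ∀ z, ‖z‖ = r → v z ≠ 0) (huR : ∀ z, ‖z‖ = R → u z ≠ 0) (hvR : ∀ z, ‖z‖ = R → v z ≠ 0)
    (j : ℕ) :
    Real.circleAverage
      (fun z => ‖iteratedDeriv j (logDeriv fun w => u w / v w) z‖ ^ (s / (j + 1 : ℝ))) 0 r ≤
      j.factorial * (2 * (zeroCard u R + zeroCard v R)) * (r ^ (-s) / (1 - s)) +
        (1 + j.factorial * (2 / (R - r)) ^ j * (8 / (R - r)) *
          Real.circleAverage (fun w => |Real.log ‖u w‖ - Real.log ‖v w‖|) 0 R) := by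
  have hR : 0 < R := hr.trans hrR
  have hj : (0 : ℝ) < j + 1 := by positivity
  have ht : 0 < s / (j + 1 : ℝ) := by positivity
  have ht1 : s / (j + 1 : ℝ) ≤ 1 := by
    rw [div_le_one hj]; linarith [(Nat.cast_nonneg j : (0 : ℝ) ≤ j)]
  have hu0 : ∃ z, u z ≠ 0 := ⟨r, hur _ (by simp [abs_of_pos hr])⟩
  have hv0 : ∃ z, v z ≠ 0 := ⟨r, hvr _ (by simp [abs_of_pos hr])⟩
  obtain ⟨g, hg, hg0, hgn, hgl⟩ := exists_blaschke hu hu0 hR huR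
  obtain ⟨k, hk, hk0, hkn, hkl⟩ := exists_blaschke hv hv0 hR hvR
  set G : ℂ → ℂ := fun w => g w / k w with hG
  have hGa : ∀ w ∈ closedBall (0 : ℂ) R, AnalyticAt ℂ G w := fun w hw =>
    (hg.analyticAt w).div (hk.analyticAt w) (hk0 w (by simpa using hw))
  have hG0 : ∀ w ∈ closedBall (0 : ℂ) R, G w ≠ 0 := fun w hw =>
    div_ne_zero (hg0 w (by simpa using hw)) (hk0 w (by simpa using hw))
  set φ : ℂ → ℝ := fun w => |Real.log ‖u w‖ - Real.log ‖v w‖| with hφ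
  have hφc : ContinuousOn φ (sphere 0 R) := by
    refine ContinuousOn.abs (ContinuousOn.sub ?_ ?_)
    · exact ContinuousOn.log hu.continuous.norm.continuousOn fun z hz =>
        norm_ne_zero_iff.2 (huR z (by simpa using hz))
    · exact ContinuousOn.log hv.continuous.norm.continuousOn fun z hz =>
        norm_ne_zero_iff.2 (hvR z (by simpa using hz))
  have hφG : ∀ w ∈ sphere (0 : ℂ) |R|, |Real.log ‖G w‖| = φ w := fun w hw => by
    have hw' : ‖w‖ = R := by simpa [abs_of_pos hR] using hw
    rw [hG, norm_div, hgn w hw', hkn w hw', Real.log_div (norm_ne_zero_iff.2 (huR w hw'))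
      (norm_ne_zero_iff.2 (hvR w hw'))]
  have hSu : ∀ a ∈ zerosIn u R, ‖a‖ ≠ r ∧ ‖a‖ < R := fun a ha => by
    have := (mem_zerosIn hu hu0).1 ha
    exact ⟨fun h => hur a h this.1, this.2.lt_of_ne fun h => huR a h this.1⟩
  have hSv : ∀ a ∈ zerosIn v R, ‖a‖ ≠ r ∧ ‖a‖ < R := fun a ha => by
    have := (mem_zerosIn hv hv0).1 ha
    exact ⟨fun h => hvr a h this.1, this.2.lt_of_ne fun h => hvR a h this.1⟩
  obtain ⟨cu, iu⟩ := circleIntegrable_and_circleAverage_poles_le hr hrR hs hs1 hSu j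
  obtain ⟨cv, iv⟩ := circleIntegrable_and_circleAverage_poles_le hr hrR hs hs1 hSv j
  set Bu : ℂ → ℝ := fun z => ∑ a ∈ zerosIn u R, (j.factorial * analyticOrderNatAt u a : ℝ) *
        (‖z - a‖ ^ (-s) + ‖z - (R : ℂ) ^ 2 / conj a‖ ^ (-s)) with hBu
  set Bv : ℂ → ℝ := fun z => ∑ a ∈ zerosIn v R, (j.factorial * analyticOrderNatAt v a : ℝ) *
        (‖z - a‖ ^ (-s) + ‖z - (R : ℂ) ^ 2 / conj a‖ ^ (-s)) with hBv
  set P : ℂ → ℝ := fun z => Real.circleAverage (fun w => φ w * (1 / ‖w - z‖ ^ 2)) 0 R with hP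
  set K : ℝ := j.factorial * (2 / (R - r)) ^ j * (8 * R) with hK
  have hRr : 0 < R - r := by linarith
  -- the pointwise bound
  have hpt : ∀ z ∈ sphere (0 : ℂ) |r|,
      ‖iteratedDeriv j (logDeriv fun w => u w / v w) z‖ ^ (s / (j + 1 : ℝ)) ≤
        Bu z + Bv z + (1 + K * P z) := by
    intro z hz
    have hzr : ‖z‖ = r := by simpa [abs_of_pos hr] using hz
    have hzR : ‖z‖ < R := hzr ▸ hrR
    have hz0 : z ≠ 0 := norm_pos_iff.1 (hzr ▸ hr)
    have hpole : ∀ a : ℂ, ‖a‖ ≠ r ∧ ‖a‖ < R → z - a ≠ 0 ∧ z - (R : ℂ) ^ 2 / conj a ≠ 0 :=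
      fun a ha => ⟨fun h => ha.1 (by rw [← sub_eq_zero.1 h, hzr]), sub_reflection_ne_zero ha.2 hzR hz0⟩
    have hpole' : ∀ a : ℂ, ‖a‖ ≠ r ∧ ‖a‖ < R → z - a ≠ 0 ∧ (R : ℂ) ^ 2 - conj a * z ≠ 0 :=
      fun a ha => ⟨(hpole a ha).1, blaschke_ne_zero hR ha.2 hzR.le⟩
    have hev : (logDeriv fun w => u w / v w) =ᶠ[𝓝 z]
        (logDeriv G + blaschkePoles u R) - blaschkePoles v R := by
      filter_upwards [hu.continuous.continuousAt.eventually_ne (hur z hzr),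
        hv.continuous.continuousAt.eventually_ne (hvr z hzr),
        isOpen_ball.mem_nhds (show z ∈ ball (0 : ℂ) R by simpa using hzR)] with w huw hvw hw
      have hwR : ‖w‖ < R := by simpa using hw
      rw [Pi.sub_apply, Pi.add_apply, hG, logDeriv_div w huw hvw (hu w) (hv w),
        logDeriv_div w (hg0 w hwR.le) (hk0 w hwR.le) (hg w) (hk w), hgl w hwR huw, hkl w hwR hvw]
      simp only [blaschkePoles]
      ring
    have hzc : z ∈ closedBall (0 : ℂ) R := by simpa using hzR.le
    have d1 : ContDiffAt ℂ j (logDeriv G) z :=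
      (((hGa z hzc).deriv.div (hGa z hzc) (hG0 z hzc))).contDiffAt
    have d2 : ContDiffAt ℂ j (blaschkePoles u R) z :=
      (analyticAt_blaschkePoles fun a ha => hpole' a (hSu a ha)).contDiffAt
    have d3 : ContDiffAt ℂ j (blaschkePoles v R) z :=
      (analyticAt_blaschkePoles fun a ha => hpole' a (hSv a ha)).contDiffAt
    have d12 : ContDiffAt ℂ j (logDeriv G + blaschkePoles u R) z := d1.add d2
    rw [hev.iteratedDeriv_eq j, iteratedDeriv_sub d12 d3, iteratedDeriv_add d1 d2]
    have b1 := norm_iteratedDeriv_blaschkePoles_rpow_le (fun a ha => hpole a (hSu a ha)) hs hs1 j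
    have b2 := norm_iteratedDeriv_blaschkePoles_rpow_le (fun a ha => hpole a (hSv a ha)) hs hs1 j
    have b3 : ‖iteratedDeriv j (logDeriv G) z‖ ≤ K * P z := by
      refine (norm_iteratedDeriv_logDeriv_le hGa hG0 hzR j).trans (le_of_eq ?_)
      rw [hzr, ← mul_assoc, hP, hK]
      congr 1
      refine Real.circleAverage_congr_sphere fun w hw => ?_
      simp only [hφG w hw]
    calc _ ≤ (‖iteratedDeriv j (logDeriv G) z‖ + ‖iteratedDeriv j (blaschkePoles u R) z‖ +
          ‖iteratedDeriv j (blaschkePoles v R) z‖) ^ (s / (j + 1 : ℝ)) :=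
          Real.rpow_le_rpow (norm_nonneg _) ((norm_sub_le _ _).trans
            (by gcongr; exact norm_add_le _ _)) ht.le
      _ ≤ ‖iteratedDeriv j (logDeriv G) z‖ ^ (s / (j + 1 : ℝ)) +
          ‖iteratedDeriv j (blaschkePoles u R) z‖ ^ (s / (j + 1 : ℝ)) +
          ‖iteratedDeriv j (blaschkePoles v R) z‖ ^ (s / (j + 1 : ℝ)) :=
          (Real.rpow_add_le_add_rpow (by positivity) (by positivity) ht.le ht1).trans
            (by gcongr; exact Real.rpow_add_le_add_rpow (by positivity) (by positivity) ht.le ht1)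
      _ ≤ (1 + K * P z) + Bu z + Bv z := by
          gcongr
          exact (rpow_le_one_add (norm_nonneg _) ht.le ht1).trans (by linarith)
      _ = _ := by ring
  -- integrability
  have hPc : ContinuousOn P (sphere 0 |r|) := by
    have h1 : ∀ z ∈ sphere (0 : ℂ) |r|, ∀ θ : ℝ, circleMap 0 R θ - z ≠ 0 := fun z hz θ h => by
      have := congrArg norm (sub_eq_zero.1 h)
      rw [norm_circleMap_zero, abs_of_pos hR, mem_sphere_zero_iff_norm.1 hz, abs_of_pos hr] at this
      linarith
    have h2 : ContinuousOn (Function.uncurry fun (z : ℂ) (θ : ℝ) =>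
        φ (circleMap 0 R θ) * (1 / ‖circleMap 0 R θ - z‖ ^ 2)) (sphere (0 : ℂ) |r| ×ˢ univ) := by
      have h3 : Continuous fun θ : ℝ => φ (circleMap 0 R θ) :=
        hφc.comp_continuous (by fun_prop) fun θ => circleMap_mem_sphere 0 hR.le θ
      refine ContinuousOn.mul (h3.comp continuous_snd).continuousOn ?_
      refine ContinuousOn.div (by fun_prop) (by fun_prop) fun p hp => ?_
      exact pow_ne_zero _ (norm_ne_zero_iff.2 (h1 p.1 hp.1 p.2))
    simp only [hP, Real.circleAverage_def]
    refine ContinuousOn.fun_const_smul ?_ _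
    rw [continuousOn_iff_continuous_domRestrict]
    refine intervalIntegral.continuous_parametric_intervalIntegral_of_continuous' (f := fun
      (z : sphere (0 : ℂ) |r|) θ => φ (circleMap 0 R θ) * (1 / ‖circleMap 0 R θ - z‖ ^ 2)) ?_ _ _
    exact h2.comp_continuous (f := fun p : sphere (0 : ℂ) |r| × ℝ => ((p.1 : ℂ), p.2))
      (by fun_prop) fun p => ⟨p.1.2, mem_univ _⟩
  have hLc : ContinuousOn (fun z => ‖iteratedDeriv j (logDeriv fun w => u w / v w) z‖ ^
      (s / (j + 1 : ℝ))) (sphere 0 |r|) :=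
    ContinuousOn.rpow_const (continuousOn_iteratedDeriv_logDeriv hu hv
      (fun z hz => hur z (by simpa [abs_of_pos hr] using hz))
      (fun z hz => hvr z (by simpa [abs_of_pos hr] using hz)) j).norm fun z _ => Or.inr ht.le
  have cK : ContinuousOn (fun z => K * P z) (sphere 0 |r|) := continuousOn_const.mul hPc
  have c1 : ContinuousOn (fun z => 1 + K * P z) (sphere 0 |r|) := continuousOn_const.add cK
  refine (Real.circleAverage_mono hLc.circleIntegrable'
    ((cu.add cv).add c1).circleIntegrable' hpt).trans ?_
  have e1 := Real.circleAverage_add (cu.add cv).circleIntegrable' c1.circleIntegrable'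
  have e2 := Real.circleAverage_add cu.circleIntegrable' cv.circleIntegrable'
  have e3 := Real.circleAverage_fun_add (f₁ := fun _ : ℂ => (1 : ℝ))
    (continuousOn_const (s := sphere (0 : ℂ) |r|)).circleIntegrable' cK.circleIntegrable'
  have e4 : Real.circleAverage (fun z => K * P z) 0 r = K * Real.circleAverage P 0 r := by
    simp only [← smul_eq_mul K]
    exact Real.circleAverage_fun_smul
  have e5 := circleAverage_circleAverage_div_norm_sub_sq hr hrR hφc
  rw [e1, e2, e3, e4, Real.circleAverage_const, hP, e5]
  have hφ0 : 0 ≤ Real.circleAverage φ 0 R := Real.circleAverage_nonneg_of_nonneg fun z _ => abs_nonneg _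
  have hfin : K * (Real.circleAverage φ 0 R / (R ^ 2 - r ^ 2)) ≤
      j.factorial * (2 / (R - r)) ^ j * (8 / (R - r)) * Real.circleAverage φ 0 R := by
    rw [hK]
    have h1 : R / (R ^ 2 - r ^ 2) ≤ 1 / (R - r) := by
      rw [div_le_div_iff₀ (by nlinarith) hRr]
      nlinarith
    calc _ = j.factorial * (2 / (R - r)) ^ j * 8 * Real.circleAverage φ 0 R *
          (R / (R ^ 2 - r ^ 2)) := by ring
      _ ≤ j.factorial * (2 / (R - r)) ^ j * 8 * Real.circleAverage φ 0 R * (1 / (R - r)) := by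
          gcongr
      _ = _ := by ring
  have hZ : (j.factorial : ℝ) * (2 * (zeroCard u R + zeroCard v R)) * (r ^ (-s) / (1 - s)) =
      j.factorial * (2 * zeroCard u R) * (r ^ (-s) / (1 - s)) +
      j.factorial * (2 * zeroCard v R) * (r ^ (-s) / (1 - s)) := by ring
  rw [hZ]
  linarith

/-! ### Borel's growth lemma -/

/-- Let ρ_k be the last radius where T ≤ 2^k, and discard an interval of length 2^(−k) before
ρ_(k+1). If 2^k ≤ T(r) < 2^(k+1) and r is kept, then r + 1/T(r) ≤ r + 2^(−k) < ρ_(k+1), where T is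
still at most 2^(k+1) ≤ 2T(r). The discarded lengths are summable; continuity of T plays no role. -/
theorem exists_borel_growth {T : ℝ → ℝ} (hT : MonotoneOn T (Ici 0)) (h0 : T 0 ≤ 1)
    (hunb : ∀ M, ∃ t, 0 ≤ t ∧ M < T t) :
    ∃ E : Set ℝ, MeasurableSet E ∧ volume E < ⊤ ∧
      ∀ r, 0 ≤ r → r ∉ E → 1 < T r ∧ T (r + 1 / T r) ≤ 2 * T r := by
  set ρ : ℕ → ℝ := fun k => sSup {t | 0 ≤ t ∧ T t ≤ 2 ^ k} with hρ
  have hbdd : ∀ k : ℕ, BddAbove {t | 0 ≤ t ∧ T t ≤ 2 ^ k} := fun k => by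
    obtain ⟨t, ht0, ht⟩ := hunb (2 ^ k)
    refine ⟨t, fun x hx => ?_⟩
    by_contra h
    exact absurd ((hT ht0 hx.1 (not_le.1 h).le).trans hx.2) (not_le.2 ht)
  have hne : ∀ k : ℕ, {t | 0 ≤ t ∧ T t ≤ 2 ^ k}.Nonempty := fun k =>
    ⟨0, le_rfl, h0.trans (one_le_pow₀ one_le_two)⟩
  refine ⟨Icc 0 (ρ 0) ∪ ⋃ k : ℕ, Icc (ρ (k + 1) - (1 / 2) ^ k) (ρ (k + 1)),
    measurableSet_Icc.union (MeasurableSet.iUnion fun k => measurableSet_Icc), ?_, ?_⟩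
  · refine (measure_union_le _ _).trans_lt (ENNReal.add_lt_top.2 ⟨?_, ?_⟩)
    · simp
    · refine (measure_iUnion_le _).trans_lt ?_
      have h1 : ∀ k : ℕ, volume (Icc (ρ (k + 1) - (1 / 2) ^ k) (ρ (k + 1))) =
          ENNReal.ofReal ((1 / 2 : ℝ) ^ k) := fun k => by
        rw [Real.volume_Icc]; congr 1; ring
      simp only [h1]
      rw [← ENNReal.ofReal_tsum_of_nonneg (fun k => by positivity) summable_geometric_two]
      exact ENNReal.ofReal_lt_top
  · intro r hr hrE
    have h1 : 1 < T r := by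
      by_contra h
      refine hrE (Or.inl ⟨hr, le_csSup (hbdd 0) ⟨hr, ?_⟩⟩)
      simpa using h
    refine ⟨h1, ?_⟩
    obtain ⟨k, hk1, hk2⟩ := exists_nat_pow_near h1.le one_lt_two
    have h2 : r ≤ ρ (k + 1) := le_csSup (hbdd _) ⟨hr, hk2.le⟩
    have h3 : r < ρ (k + 1) - (1 / 2) ^ k := by
      by_contra h
      exact hrE (Or.inr (mem_iUnion.2 ⟨k, not_lt.1 h, h2⟩))
    have h4 : 1 / T r ≤ (1 / 2) ^ k := by
      rw [one_div_pow]
      exact one_div_le_one_div_of_le (by positivity) hk1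
    obtain ⟨t, ht, htr⟩ := exists_lt_of_lt_csSup (hne (k + 1)) (show r + 1 / T r < ρ (k + 1) by linarith)
    have h5 : 0 ≤ r + 1 / T r := add_nonneg hr (by positivity)
    calc T (r + 1 / T r) ≤ T t := hT h5 ht.1 htr.le
      _ ≤ 2 ^ (k + 1) := ht.2
      _ ≤ 2 * T r := by rw [pow_succ]; linarith

theorem exists_notMem_countable {B : Set ℝ} (hB : B.Countable) {a b : ℝ} (hab : a < b) :
    ∃ x, a < x ∧ x < b ∧ x ∉ B := by
  obtain ⟨x, hx, hab⟩ := (hB.dense_compl ℝ).exists_between hab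
  exact ⟨x, hab.1, hab.2, hx⟩

/-! ### Growth of linear forms along a curve -/

section Growth

variable {n : ℕ} {F : ℂ → AffineCone n}

theorem continuousOn_log_norm_comp (hF : Differentiable ℂ F) (h0 : ∀ z, F z ≠ 0) (S : Set ℂ) :
    ContinuousOn (fun z => Real.log ‖F z‖) S :=
  ContinuousOn.log hF.continuous.norm.continuousOn fun z _ => norm_ne_zero_iff.2 (h0 z)

theorem continuousOn_log_norm {u : ℂ → ℂ} (hu : Differentiable ℂ u) {S : Set ℂ}
    (hS : ∀ z ∈ S, u z ≠ 0) : ContinuousOn (fun z => Real.log ‖u z‖) S :=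
  ContinuousOn.log hu.continuous.norm.continuousOn fun z hz => norm_ne_zero_iff.2 (hS z hz)

theorem differentiable_linearForm_comp (hF : Differentiable ℂ F) (b : Module.Dual ℂ (AffineCone n)) :
    Differentiable ℂ fun z => b (F z) :=
  (LinearMap.toContinuousLinearMap b).differentiable.comp hF

/-- Bounds on the growth of an entire function dominated by a curve in terms of its characteristic. -/
theorem exists_growth_bounds (hF : Differentiable ℂ F) (h0 : ∀ z, F z ≠ 0)
    (b : Module.Dual ℂ (AffineCone n)) (hb : ∃ z, b (F z) ≠ 0) :
    ∃ C : ℝ, 0 ≤ C ∧ ∀ R, 1 ≤ R → (∀ z, ‖z‖ = R → b (F z) ≠ 0) →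
      zeroCounting (fun z => b (F z)) R ≤ characteristic F 1 R + C ∧
      Real.circleAverage (fun z => |Real.log ‖b (F z)‖ - Real.log ‖F z‖|) 0 R ≤
        characteristic F 1 R + C := by
  set β := ‖LinearMap.toContinuousLinearMap b‖ with hβ
  have hle : ∀ x, ‖b x‖ ≤ β * ‖x‖ := fun x => (LinearMap.toContinuousLinearMap b).le_opNorm x
  have hβ0 : 0 < β := by
    obtain ⟨z, hz⟩ := hb
    have h1 := (norm_pos_iff.2 hz).trans_le (hle (F z))
    exact pos_of_mul_pos_left h1 (norm_nonneg _)
  set u : ℂ → ℂ := fun z => b (F z) with hu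
  have hud : Differentiable ℂ u := differentiable_linearForm_comp hF b
  set κ := Real.log ‖meromorphicTrailingCoeffAt u 0‖ with hκ
  set ν := Real.log ‖F 0‖ with hν
  refine ⟨2 * |Real.log β| + |ν| + |κ|, by positivity, fun R hR hne => ?_⟩
  have hR0 : 0 < R := by linarith
  have hS : ∀ z ∈ sphere (0 : ℂ) |R|, u z ≠ 0 := fun z hz => hne z (by simpa [abs_of_pos hR0] using hz)
  have cu := continuousOn_log_norm hud hS
  have cF := continuousOn_log_norm_comp hF h0 (sphere (0 : ℂ) |R|)
  have hchar : characteristic F 1 R = Real.circleAverage (fun w => Real.log ‖F w‖) 0 R - ν := by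
    rw [characteristic_eq_circleAverage hF h0 1 hR0.le]; simp [hν]
  have hzc : zeroCounting u R = Real.circleAverage (fun z => Real.log ‖u z‖) 0 R - κ :=
    zeroCounting_eq_circleAverage hud hR0.ne'
  -- By Jensen's formula this bounds the average of log|u| from below, and so bounds the proximity
  -- term.
  have hzc0 : 0 ≤ zeroCounting u R := by
    have := sum_order_mul_log_le_zeroCounting hud hb le_rfl hR
    refine le_trans (mul_nonneg (Finset.sum_nonneg fun _ _ => Nat.cast_nonneg _) ?_) this
    exact Real.log_nonneg (by simpa using hR)
  have hptw : ∀ z ∈ sphere (0 : ℂ) |R|, Real.log ‖u z‖ ≤ Real.log β + Real.log ‖F z‖ := fun z hz => by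
    rw [← Real.log_mul hβ0.ne' (norm_ne_zero_iff.2 (h0 z))]
    exact Real.log_le_log (norm_pos_iff.2 (hS z hz)) (hle _)
  have hadd : Real.circleAverage (fun z => Real.log β + Real.log ‖F z‖) 0 R =
      Real.log β + Real.circleAverage (fun z => Real.log ‖F z‖) 0 R := by
    rw [Real.circleAverage_fun_add (f₁ := fun _ : ℂ => Real.log β)
      (continuousOn_const (s := sphere (0 : ℂ) |R|)).circleIntegrable' cF.circleIntegrable',
      Real.circleAverage_const]
  have h1 : Real.circleAverage (fun z => Real.log ‖u z‖) 0 R ≤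
      Real.log β + Real.circleAverage (fun z => Real.log ‖F z‖) 0 R := by
    rw [← hadd]
    exact Real.circleAverage_mono cu.circleIntegrable' (continuousOn_const.add cF).circleIntegrable'
      hptw
  -- Since y = log‖F‖ − log|u| satisfies log β + y ≥ 0, its absolute value is at most |log β| + (log
  -- β + y), which is linear in y and can be averaged.
  have h2 : Real.circleAverage (fun z => |Real.log ‖u z‖ - Real.log ‖F z‖|) 0 R ≤
      |Real.log β| + (Real.log β + Real.circleAverage (fun z => Real.log ‖F z‖) 0 R -
        Real.circleAverage (fun z => Real.log ‖u z‖) 0 R) := by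
    have c2 : ContinuousOn (fun z => Real.log β + Real.log ‖F z‖) (sphere (0 : ℂ) |R|) :=
      continuousOn_const.add cF
    have e1 := Real.circleAverage_fun_sub c2.circleIntegrable' cu.circleIntegrable'
    have c3 : ContinuousOn (fun z => (Real.log β + Real.log ‖F z‖) - Real.log ‖u z‖)
      (sphere (0 : ℂ) |R|) := (continuousOn_const.add cF).sub cu
    have e2 := Real.circleAverage_fun_add (f₁ := fun _ : ℂ => |Real.log β|)
      (continuousOn_const (s := sphere (0 : ℂ) |R|)).circleIntegrable' c3.circleIntegrable'
    rw [← hadd, ← e1]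
    rw [Real.circleAverage_const] at e2
    rw [← e2]
    refine Real.circleAverage_mono (cu.sub cF).abs.circleIntegrable'
      (continuousOn_const.add c3).circleIntegrable' fun z hz => ?_
    have h3 := hptw z hz
    have h4 := le_abs_self (Real.log β)
    have h5 := neg_abs_le (Real.log β)
    rw [abs_le]
    constructor <;> linarith
  have a1 := le_abs_self (Real.log β)
  have a2 := le_abs_self ν
  have a3 := neg_abs_le κ
  have a4 := abs_nonneg (Real.log β)
  have a5 := abs_nonneg κ
  constructor <;> linarith

/-- The bound must be a power of T alone. The zero count on a disc of radius just above r is O(r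
T²), and the exponent s = 1 − 1/log r makes the pole average cost e·log r / r, so r cancels and log
r ≤ T + C₀ remains: T³ in all. A fixed s < 1 would leave r^(1−s), whose logarithm need not be O(log
T). The regular part gives (R − r)^(−(j+1)) · T, that is T^(j+2). -/
theorem exists_circleAverage_iteratedDeriv_logDeriv_le (hF : Differentiable ℂ F)
    (h0 : ∀ z, F z ≠ 0) (a b : Module.Dual ℂ (AffineCone n)) {B : Set ℝ} (hB : B.Countable)
    (ha : ∀ z, a (F z) = 0 → ‖z‖ ∈ B) (hb : ∀ z, b (F z) = 0 → ‖z‖ ∈ B) {C₀ : ℝ} (hC₀ : 0 ≤ C₀)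
    (j : ℕ) :
    ∃ C : ℝ, 0 ≤ C ∧ ∀ r, Real.exp 2 ≤ r → r ∉ B → 1 ≤ characteristic F 1 r →
      Real.log r ≤ characteristic F 1 r + C₀ →
      characteristic F 1 (r + 1 / characteristic F 1 r) ≤ 2 * characteristic F 1 r →
      Real.circleAverage (fun z => ‖iteratedDeriv j (logDeriv fun w => a (F w) / b (F w)) z‖ ^
        ((1 - 1 / Real.log r) / (j + 1 : ℝ))) 0 r ≤ C * characteristic F 1 r ^ (j + 3) := by
  obtain ⟨x₀, hx₀, -, hx₀B⟩ := exists_notMem_countable hB zero_lt_one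
  have hx₀n : ‖(x₀ : ℂ)‖ ∉ B := by
    rwa [Complex.norm_real, Real.norm_of_nonneg hx₀.le]
  have hae : ∃ z, a (F z) ≠ 0 := ⟨x₀, fun h => hx₀n (ha _ h)⟩
  have hbe : ∃ z, b (F z) ≠ 0 := ⟨x₀, fun h => hx₀n (hb _ h)⟩
  obtain ⟨Ca, hCa, hga⟩ := exists_growth_bounds hF h0 a hae
  obtain ⟨Cb, hCb, hgb⟩ := exists_growth_bounds hF h0 b hbe
  set D := 4 + Ca + Cb with hD
  refine ⟨j.factorial * 24 * D * (Real.exp 1 * (1 + C₀)) + (1 + j.factorial * 6 ^ j * 24 * D),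
    by positivity, ?_⟩
  intro r hr hrB hT hlog hgrow
  set T := characteristic F 1 r with hTdef
  have hlog2 : 2 ≤ Real.log r := (Real.le_log_iff_exp_le ((Real.exp_pos 2).trans_le hr)).2 hr
  have hr1 : 1 ≤ r := by linarith [Real.add_one_le_exp (2 : ℝ)]
  have hr0 : 0 < r := by linarith
  have hT0 : 0 < T := by linarith
  set δ := 1 / T with hδ
  have hδ0 : 0 < δ := by positivity
  have hδ1 : δ ≤ 1 := by rw [hδ, div_le_one hT0]; exact hT
  -- Both R and R' avoid the moduli of zeros. They satisfy R − r ≥ δ/3 and R' − R ≥ δ/6, and they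
  -- stay below r + δ, where the characteristic is at most 2T.
  obtain ⟨R, hR1, hR2, hRB⟩ := exists_notMem_countable hB (show r + δ / 3 < r + δ / 2 by linarith)
  obtain ⟨R', hR'1, hR'2, hR'B⟩ := exists_notMem_countable hB (show r + 2 * δ / 3 < r + δ by linarith)
  have hR0 : 0 < R := by linarith
  have hR'0 : 0 < R' := by linarith
  have hav : ∀ t, t ∉ B → ∀ z, ‖z‖ = t → a (F z) ≠ 0 := fun t ht z hz h => ht (hz ▸ ha z h)
  have hbv : ∀ t, t ∉ B → ∀ z, ‖z‖ = t → b (F z) ≠ 0 := fun t ht z hz h => ht (hz ▸ hb z h)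
  have hTR' : characteristic F 1 R' ≤ 2 * T :=
    (characteristic_mono hF h0 hR'0.le hR'2.le).trans hgrow
  have hTR : characteristic F 1 R ≤ 2 * T :=
    (characteristic_mono hF h0 hR0.le (by linarith)).trans hTR'
  have hua := differentiable_linearForm_comp hF a
  have hub := differentiable_linearForm_comp hF b
  -- the number of zeros
  have hloglow : 1 / (12 * r * T) ≤ Real.log (R' / R) := by
    refine le_trans ?_ (Real.one_sub_inv_le_log_of_pos (div_pos hR'0 hR0))
    rw [inv_div, one_sub_div hR'0.ne', div_le_div_iff₀ (by positivity) hR'0]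
    have h1 : δ / 6 ≤ R' - R := by linarith
    have h2 : R' ≤ 2 * r := by linarith
    have h3 : δ * T = 1 := by rw [hδ]; field_simp
    calc 1 * R' ≤ 2 * r := by linarith
      _ = δ / 6 * (12 * r * T) := by linear_combination -2 * r * h3
      _ ≤ (R' - R) * (12 * r * T) := by gcongr
  have hcard : ∀ (c : Module.Dual ℂ (AffineCone n)) (Cc : ℝ), 0 ≤ Cc → (∃ z, c (F z) ≠ 0) →
      zeroCounting (fun z => c (F z)) R' ≤ characteristic F 1 R' + Cc →
      zeroCard (fun z => c (F z)) R ≤ 12 * (2 + Cc) * r * T ^ 2 := by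
    intro c Cc hCc hce hc
    have h1 := sum_order_mul_log_le_zeroCounting (differentiable_linearForm_comp hF c) hce
      (show 1 ≤ R by linarith) (show R ≤ R' by linarith)
    have h2 : zeroCard (fun z => c (F z)) R * (1 / (12 * r * T)) ≤ (2 + Cc) * T := by
      calc _ ≤ zeroCard (fun z => c (F z)) R * Real.log (R' / R) := by
            refine mul_le_mul_of_nonneg_left hloglow ?_
            exact Finset.sum_nonneg fun _ _ => Nat.cast_nonneg _
        _ ≤ characteristic F 1 R' + Cc := h1.trans hc
        _ ≤ 2 * T + Cc * T := by nlinarith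
        _ = _ := by ring
    rw [mul_one_div, div_le_iff₀ (by positivity)] at h2
    linarith
  have hNa := hcard a Ca hCa hae (hga R' (by linarith) (hav R' hR'B)).1
  have hNb := hcard b Cb hCb hbe (hgb R' (by linarith) (hbv R' hR'B)).1
  -- the proximity term
  have hprox : Real.circleAverage (fun w => |Real.log ‖a (F w)‖ - Real.log ‖b (F w)‖|) 0 R ≤
      D * T := by
    have hsa := (hga R (by linarith) (hav R hRB)).2
    have hsb := (hgb R (by linarith) (hbv R hRB)).2
    have hsph : ∀ z ∈ sphere (0 : ℂ) |R|, ‖z‖ = R := fun z hz => by simpa [abs_of_pos hR0] using hz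
    have cF := continuousOn_log_norm_comp hF h0 (sphere (0 : ℂ) |R|)
    have ca := continuousOn_log_norm hua fun z hz => hav R hRB z (hsph z hz)
    have cb := continuousOn_log_norm hub fun z hz => hbv R hRB z (hsph z hz)
    have e := Real.circleAverage_fun_add (ca.sub cF).abs.circleIntegrable'
      (cb.sub cF).abs.circleIntegrable'
    have h1 : Real.circleAverage (fun w => |Real.log ‖a (F w)‖ - Real.log ‖b (F w)‖|) 0 R ≤
        Real.circleAverage (fun z => |Real.log ‖a (F z)‖ - Real.log ‖F z‖| +
          |Real.log ‖b (F z)‖ - Real.log ‖F z‖|) 0 R := by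
      refine Real.circleAverage_mono (ca.sub cb).abs.circleIntegrable'
        ((ca.sub cF).abs.add (cb.sub cF).abs).circleIntegrable' fun z _ => ?_
      have := abs_sub (Real.log ‖a (F z)‖ - Real.log ‖F z‖) (Real.log ‖b (F z)‖ - Real.log ‖F z‖)
      rwa [sub_sub_sub_cancel_right] at this
    have e' : Real.circleAverage (fun z => |Real.log ‖a (F z)‖ - Real.log ‖F z‖| +
          |Real.log ‖b (F z)‖ - Real.log ‖F z‖|) 0 R = _ := e
    rw [e'] at h1
    have h2 : Ca + Cb ≤ (Ca + Cb) * T := le_mul_of_one_le_right (by positivity) hT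
    calc _ ≤ _ := h1
      _ ≤ (characteristic F 1 R + Ca) + (characteristic F 1 R + Cb) := add_le_add hsa hsb
      _ ≤ D * T := by rw [hD]; linarith
  have hs0 : 0 < 1 - 1 / Real.log r := by
    have : 1 / Real.log r ≤ 1 / 2 := one_div_le_one_div_of_le two_pos hlog2
    linarith
  have hs1 : 1 - 1 / Real.log r < 1 := by
    have : 0 < 1 / Real.log r := by positivity
    linarith
  have key := circleAverage_iteratedDeriv_logDeriv_rpow_le hua hub hr0 (show r < R by linarith)
    hs0 hs1 (hav r hrB) (hbv r hrB) (hav R hRB) (hbv R hRB) j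
  refine key.trans ?_
  -- r^(1/log r) = e, so r^(−s) = e/r, while 1/(1 − s) = log r.
  have hrs : r ^ (-(1 - 1 / Real.log r)) / (1 - (1 - 1 / Real.log r)) =
      Real.exp 1 / r * Real.log r := by
    have h1 : Real.log r * -(1 - 1 / Real.log r) = 1 - Real.log r := by
      have : Real.log r ≠ 0 := by linarith
      field_simp
      ring
    rw [Real.rpow_def_of_pos hr0, h1, Real.exp_sub, Real.exp_log hr0, sub_sub_cancel, div_div_eq_mul_div, div_one]
  rw [hrs]
  have hRr : 1 / (R - r) ≤ 3 * T := by
    rw [div_le_iff₀ (by linarith)]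
    have h3 : δ * T = 1 := by rw [hδ]; field_simp
    nlinarith
  have hP0 : 0 ≤ Real.circleAverage (fun w => |Real.log ‖a (F w)‖ - Real.log ‖b (F w)‖|) 0 R :=
    Real.circleAverage_nonneg_of_nonneg fun z _ => abs_nonneg _
  have hRr0 : 0 < R - r := by linarith
  have t1 : (j.factorial : ℝ) * (2 * (zeroCard (fun z => a (F z)) R + zeroCard (fun z => b (F z)) R)) *
      (Real.exp 1 / r * Real.log r) ≤
      j.factorial * 24 * D * (Real.exp 1 * (1 + C₀)) * T ^ (j + 3) := by
    have hl : Real.log r ≤ (1 + C₀) * T := by nlinarith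
    calc _ ≤ (j.factorial : ℝ) * (2 * (12 * (2 + Ca) * r * T ^ 2 + 12 * (2 + Cb) * r * T ^ 2)) *
          (Real.exp 1 / r * ((1 + C₀) * T)) := by gcongr
      _ = j.factorial * 24 * D * (Real.exp 1 * (1 + C₀)) * T ^ 3 := by
          rw [hD]; field_simp; ring
      _ ≤ _ := mul_le_mul_of_nonneg_left (pow_le_pow_right₀ hT (by omega)) (by positivity)
  have t2 : 1 + (j.factorial : ℝ) * (2 / (R - r)) ^ j * (8 / (R - r)) *
      Real.circleAverage (fun w => |Real.log ‖a (F w)‖ - Real.log ‖b (F w)‖|) 0 R ≤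
      (1 + j.factorial * 6 ^ j * 24 * D) * T ^ (j + 3) := by
    have q1 : 2 / (R - r) ≤ 6 * T := by
      rw [div_eq_mul_one_div]; linarith
    have q2 : 8 / (R - r) ≤ 24 * T := by
      rw [div_eq_mul_one_div]; linarith
    have q3 : (1 : ℝ) ≤ T ^ (j + 3) := one_le_pow₀ hT
    have q4 : T ^ (j + 2) ≤ T ^ (j + 3) := pow_le_pow_right₀ hT (by omega)
    calc _ ≤ 1 + (j.factorial : ℝ) * (6 * T) ^ j * (24 * T) * (D * T) := by gcongr
      _ = 1 + (j.factorial * 6 ^ j * 24 * D) * T ^ (j + 2) := by rw [mul_pow]; ring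
      _ ≤ T ^ (j + 3) + (j.factorial * 6 ^ j * 24 * D) * T ^ (j + 3) := by gcongr
      _ = _ := by ring
  calc _ ≤ _ := add_le_add t1 t2
    _ = _ := by ring

/-- The characteristic of a non-constant curve grows at least logarithmically. -/
theorem exists_log_le_characteristic (hn : n ≠ 0) (hF : Differentiable ℂ F) (h0 : ∀ z, F z ≠ 0)
    (hnd : ∀ b : Module.Dual ℂ (AffineCone n), b ≠ 0 → ∃ z, b (F z) ≠ 0) :
    ∃ C : ℝ, 0 ≤ C ∧ ∃ B : Set ℝ, B.Countable ∧ ∀ r, 1 ≤ r → r ∉ B →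
      Real.log r ≤ characteristic F 1 r + C := by
  -- A non-zero form vanishing at F(0) exists because n ≠ 0. Its zero at the origin alone
  -- contributes at least log r to a counting function bounded by the characteristic.
  obtain ⟨b, hb, hbF⟩ : ∃ b : Module.Dual ℂ (AffineCone n), b ≠ 0 ∧ b (F 0) = 0 := by
    have hlt : (ℂ ∙ F 0) < ⊤ := by
      refine lt_top_iff_ne_top.2 fun h => ?_
      have h1 := finrank_span_le_card (R := ℂ) ({F 0} : Set (AffineCone n))
      rw [h, finrank_top, finrank_euclideanSpace_fin] at h1
      simp at h1
      exact hn h1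
    obtain ⟨b, hb, hle⟩ := Submodule.exists_le_ker_of_lt_top _ hlt
    exact ⟨b, hb, hle (Submodule.mem_span_singleton_self _)⟩
  have hbe := hnd b hb
  have hu := differentiable_linearForm_comp hF b
  obtain ⟨C, hC, hg⟩ := exists_growth_bounds hF h0 b hbe
  refine ⟨C, hC, norm '' {z | b (F z) = 0}, (countable_zeros hu hbe).image _, fun r hr hrB => ?_⟩
  have h1 := (hg r hr fun z hz h => hrB ⟨z, h, hz⟩).1
  have h2 := sum_order_mul_log_le_zeroCounting hu hbe le_rfl hr
  have hmem : (0 : ℂ) ∈ zerosIn (fun z => b (F z)) 1 := (mem_zerosIn hu hbe).2 ⟨hbF, by simp⟩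
  have h3 : (1 : ℝ) ≤ ∑ a ∈ zerosIn (fun z => b (F z)) 1,
      (analyticOrderNatAt (fun z => b (F z)) a : ℝ) := by
    refine le_trans ?_ (Finset.single_le_sum (f := fun a =>
      (analyticOrderNatAt (fun z => b (F z)) a : ℝ)) (fun _ _ => Nat.cast_nonneg _) hmem)
    have h4 : analyticOrderNatAt (fun z => b (F z)) 0 ≠ 0 := fun h => by
      have h5 := Nat.cast_analyticOrderNatAt (analyticOrderAt_ne_top_of_entire hu hbe 0)
      rw [h, Nat.cast_zero] at h5
      exact ((hu.analyticAt 0).analyticOrderAt_eq_zero.1 h5.symm) hbF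
    exact_mod_cast Nat.one_le_iff_ne_zero.2 h4
  rw [div_one] at h2
  nlinarith [Real.log_nonneg hr]

end Growth

end CartanSMT

namespace CartanSMT

/-! ### Hyperplanes in general position -/

theorem exists_linearIndependent_extension {V ι : Type*} [AddCommGroup V] [Module ℂ V]
    [FiniteDimensional ℂ V] {m : ℕ} (hm : Module.finrank ℂ V = m) {v : ι → V}
    (hv : LinearIndependent ℂ v) :
    ∃ b : Fin m → V, LinearIndependent ℂ b ∧ ∃ σ : ι → Fin m, Function.Injective σ ∧
      ∀ i, b (σ i) = v i := by
  classical
  set B := Module.Basis.extend hv.linearIndepOn_id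
  have := FiniteDimensional.fintypeBasisIndex B
  have hcard : Fintype.card (hv.linearIndepOn_id.extend (subset_univ (range v))) = m := by
    rw [← hm, Module.finrank_eq_card_basis B]
  set e := Fintype.equivFinOfCardEq hcard
  refine ⟨fun k => B (e.symm k), B.linearIndependent.comp _ e.symm.injective,
    fun i => e ⟨v i, hv.linearIndepOn_id.subset_extend _ (mem_range_self i)⟩, fun i j h => ?_,
    fun i => ?_⟩
  · exact hv.injective (congrArg Subtype.val (e.injective h))
  · simp [B]

/-- The codimension of the common kernel is the dimension of the span of the forms; if it is at
least |I|, the forms are independent. -/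
theorem linearIndependent_of_finrank_iInf_ker {n q : ℕ}
    (ℓ : Fin q → Module.Dual ℂ (AffineCone n)) (I : Finset (Fin q))
    (h : (Module.finrank ℂ ↥(⨅ i ∈ I, LinearMap.ker (ℓ i)) : ℤ) - 1 ≤ (n : ℤ) - (I.card : ℤ)) :
    LinearIndependent ℂ fun i : I => ℓ i := by
  rw [linearIndependent_iff_card_le_finrank_span, Set.finrank]
  set W := Submodule.span ℂ (range fun i : I => ℓ i) with hW
  have h1 := Subspace.finrank_add_finrank_dualCoannihilator_eq W
  have h2 : W.dualCoannihilator = ⨅ i ∈ I, LinearMap.ker (ℓ i) := by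
    ext x
    rw [Submodule.mem_dualCoannihilator]
    simp only [Submodule.mem_iInf, LinearMap.mem_ker]
    constructor
    · intro hx i hi
      exact hx _ (Submodule.subset_span ⟨⟨i, hi⟩, rfl⟩)
    · intro hx φ hφ
      induction hφ using Submodule.span_induction with
      | mem φ hφ => obtain ⟨i, rfl⟩ := hφ; exact hx i i.2
      | zero => rfl
      | add φ ψ _ _ h1 h2 => rw [LinearMap.add_apply, h1, h2, add_zero]
      | smul c φ _ h1 => rw [LinearMap.smul_apply, h1, smul_zero]
  rw [h2, finrank_euclideanSpace_fin] at h1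
  rw [Fintype.card_coe]
  omega

/-- When the common kernel is zero, x ↦ (ℓ_i x) is injective on a finite-dimensional space and hence
bounded below. The minimum over the finitely many I gives a uniform constant. -/
theorem exists_le_norm_of_iInf_ker_eq_bot {n q : ℕ} (ℓ : Fin q → Module.Dual ℂ (AffineCone n)) :
    ∃ c : ℝ, 0 < c ∧ ∀ I : Finset (Fin q), (⨅ i ∈ I, LinearMap.ker (ℓ i)) = ⊥ →
      ∀ x, x ≠ 0 → ∃ i ∈ I, c * ‖x‖ ≤ ‖ℓ i x‖ := by
  have h1 : ∀ I : Finset (Fin q), ∃ c : ℝ, 0 < c ∧ ((⨅ i ∈ I, LinearMap.ker (ℓ i)) = ⊥ →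
      ∀ x, x ≠ 0 → ∃ i ∈ I, c * ‖x‖ ≤ ‖ℓ i x‖) := by
    intro I
    by_cases hI : (⨅ i ∈ I, LinearMap.ker (ℓ i)) = ⊥
    · set f : AffineCone n →ₗ[ℂ] (I → ℂ) := LinearMap.pi fun i => ℓ i with hf
      have hker : LinearMap.ker f = ⊥ := by
        rw [hf, LinearMap.ker_pi, ← hI, iInf_subtype]
      obtain ⟨K, hK, hanti⟩ := f.exists_antilipschitzWith hker
      refine ⟨1 / (2 * K), by positivity, fun _ x hx => ?_⟩
      by_contra! hcon
      have hxn := norm_pos_iff.2 hx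
      have h2 : ‖f x‖ < 1 / (2 * K) * ‖x‖ := by
        rw [pi_norm_lt_iff (by positivity)]
        exact fun i => hcon i i.2
      have h3 : ‖x‖ ≤ K * ‖f x‖ := by
        have := hanti.le_mul_dist x 0
        simpa using this
      have hK' : (0 : ℝ) < K := hK
      have h4 : (K : ℝ) * ‖f x‖ < K * (1 / (2 * K) * ‖x‖) := by gcongr
      have h5 : (K : ℝ) * (1 / (2 * K) * ‖x‖) = ‖x‖ / 2 := by field_simp
      linarith
    · exact ⟨1, one_pos, fun h => absurd h hI⟩
  choose c hc hcI using h1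
  obtain ⟨I₀, -, hI₀⟩ := Finset.exists_min_image Finset.univ c Finset.univ_nonempty
  refine ⟨c I₀, hc I₀, fun I hI x hx => ?_⟩
  obtain ⟨i, hi, h⟩ := hcI I hI x hx
  exact ⟨i, hi, le_trans (by gcongr; exact hI₀ I (Finset.mem_univ _)) h⟩

/-- For hyperplanes in general position the sum of all proximities is, up to a constant, bounded by
the sum of the proximities to the members of one of finitely many bases of linear forms. -/
theorem InGeneralPosition.exists_bases {n q : ℕ} {ℓ : Fin q → Module.Dual ℂ (AffineCone n)}
    (hgp : InGeneralPosition ℓ) :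
    ∃ b : Finset (Fin q) → Fin (n + 1) → Module.Dual ℂ (AffineCone n),
      (∀ J, LinearIndependent ℂ (b J)) ∧ ∃ C : ℝ, ∀ x, x ≠ 0 → (∀ i, ℓ i x ≠ 0) →
        (∀ J k, b J k x ≠ 0) → ∃ J, ∑ i, -Real.log (‖ℓ i x‖ / ‖x‖) ≤
          ∑ k, -Real.log (‖b J k x‖ / ‖x‖) + C := by
  have hdim : Module.finrank ℂ (Module.Dual ℂ (AffineCone n)) = n + 1 := by
    rw [Subspace.dual_finrank_eq, finrank_euclideanSpace_fin]
  have hex : ∀ J : Finset (Fin q), ∃ b : Fin (n + 1) → Module.Dual ℂ (AffineCone n),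
      LinearIndependent ℂ b ∧ ((LinearIndependent ℂ fun i : J => ℓ i) →
        ∃ σ : J → Fin (n + 1), Function.Injective σ ∧ ∀ i, b (σ i) = ℓ i) := by
    -- A set J of dependent forms receives an arbitrary basis: the J selected at a point x is always
    -- independent.
    intro J
    by_cases hJ : LinearIndependent ℂ fun i : J => ℓ i
    · obtain ⟨b, hb, hσ⟩ := exists_linearIndependent_extension hdim hJ
      exact ⟨b, hb, fun _ => hσ⟩
    · obtain ⟨b, hb, -⟩ := exists_linearIndependent_extension hdim
        (v := fun i : Fin 0 => (0 : Module.Dual ℂ (AffineCone n))) (linearIndependent_empty_type)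
      exact ⟨b, hb, fun h => absurd h hJ⟩
  choose b hb hσ using hex
  obtain ⟨c, hc, hcI⟩ := exists_le_norm_of_iInf_ker_eq_bot ℓ
  set β : ℝ := 1 + ∑ J, ∑ k, ‖LinearMap.toContinuousLinearMap (b J k)‖ with hβ
  have hβ1 : 1 ≤ β := le_add_of_nonneg_right
    (Finset.sum_nonneg fun _ _ => Finset.sum_nonneg fun _ _ => norm_nonneg _)
  have hβle : ∀ J k x, ‖b J k x‖ ≤ β * ‖x‖ := fun J k x => by
    refine ((LinearMap.toContinuousLinearMap (b J k)).le_opNorm x).trans ?_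
    gcongr
    have h1 := Finset.single_le_sum (f := fun k => ‖LinearMap.toContinuousLinearMap (b J k)‖)
      (fun _ _ => norm_nonneg _) (Finset.mem_univ k)
    have h2 := Finset.single_le_sum
      (f := fun J => ∑ k, ‖LinearMap.toContinuousLinearMap (b J k)‖)
      (fun _ _ => Finset.sum_nonneg fun _ _ => norm_nonneg _) (Finset.mem_univ J)
    simp only at h1 h2
    linarith
  refine ⟨b, hb, (n + 1) * Real.log β + q * |Real.log c|, fun x hx hℓ hbx => ?_⟩
  have hxn := norm_pos_iff.2 hx
  classical
  -- J collects the hyperplanes close to x. They have a common point, since otherwise some ℓ_i with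
  -- i ∈ J would satisfy |ℓ_i x| ≥ c‖x‖; general position then gives independence.
  set J : Finset (Fin q) := Finset.univ.filter fun i => ‖ℓ i x‖ < c * ‖x‖ with hJ
  have hJind : LinearIndependent ℂ fun i : J => ℓ i := by
    refine linearIndependent_of_finrank_iInf_ker ℓ J ((hgp J).resolve_left fun h => ?_)
    obtain ⟨i, hi, hle⟩ := hcI J h x hx
    exact absurd (Finset.mem_filter.1 hi).2 (not_lt.2 hle)
  obtain ⟨σ, hσi, hσb⟩ := hσ J hJind
  refine ⟨J, ?_⟩
  have hg0 : ∀ k, 0 ≤ -Real.log (‖b J k x‖ / ‖x‖) + Real.log β := fun k => by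
    have : Real.log (‖b J k x‖ / ‖x‖) ≤ Real.log β :=
      Real.log_le_log (div_pos (norm_pos_iff.2 (hbx J k)) hxn) ((div_le_iff₀ hxn).2 (hβle J k x))
    linarith
  -- Adding log β makes every basis term non-negative, so the sum may be enlarged from the image of
  -- σ to all of the basis.
  have hin : ∑ i ∈ J, -Real.log (‖ℓ i x‖ / ‖x‖) ≤
      ∑ k, (-Real.log (‖b J k x‖ / ‖x‖) + Real.log β) := by
    calc ∑ i ∈ J, -Real.log (‖ℓ i x‖ / ‖x‖) = ∑ i : J, -Real.log (‖ℓ i x‖ / ‖x‖) :=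
          (Finset.sum_coe_sort J fun i => -Real.log (‖ℓ i x‖ / ‖x‖)).symm
      _ ≤ ∑ i : J, (-Real.log (‖b J (σ i) x‖ / ‖x‖) + Real.log β) := by
          refine Finset.sum_le_sum fun i _ => ?_
          rw [hσb i]
          linarith [Real.log_nonneg hβ1]
      _ = ∑ k ∈ Finset.univ.image σ, (-Real.log (‖b J k x‖ / ‖x‖) + Real.log β) :=
          by rw [Finset.sum_image hσi.injOn]
      _ ≤ _ := Finset.sum_le_sum_of_subset_of_nonneg (Finset.subset_univ _) fun k _ _ => hg0 k
  have hout : ∑ i ∈ Jᶜ, -Real.log (‖ℓ i x‖ / ‖x‖) ≤ q * |Real.log c| := by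
    calc ∑ i ∈ Jᶜ, -Real.log (‖ℓ i x‖ / ‖x‖) ≤ ∑ i ∈ Jᶜ, |Real.log c| := by
          refine Finset.sum_le_sum fun i hi => ?_
          have h1 : c ≤ ‖ℓ i x‖ / ‖x‖ := by
            rw [le_div_iff₀ hxn]
            simpa [hJ] using hi
          have := Real.log_le_log hc h1
          linarith [neg_abs_le (Real.log c)]
      _ = (Jᶜ.card : ℝ) * |Real.log c| := by rw [Finset.sum_const, nsmul_eq_mul]
      _ ≤ _ := by
          gcongr
          simpa using Finset.card_le_univ Jᶜ
  rw [← Finset.sum_add_sum_compl J]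
  rw [Finset.sum_add_distrib, Finset.sum_const, Finset.card_univ, Fintype.card_fin,
    nsmul_eq_mul] at hin
  push_cast at hin
  linarith

end CartanSMT

namespace CartanSMT

open Filter Topology Metric

/-! ### Curves, their Wronskians and Weil functions -/

section Curve

variable {n : ℕ} {f : ℂ → ProjSpace n} {F : ℂ → AffineCone n}

theorem IsReducedRepresentation.exists_rep_eq_smul (hF : IsReducedRepresentation F f) (z : ℂ) :
    ∃ a : ℂ, a ≠ 0 ∧ (f z).rep = a • F z := by
  obtain ⟨a, ha⟩ := Projectivization.exists_smul_eq_mk_rep ℂ (F z) (hF.ne_zero z)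
  refine ⟨a, a.ne_zero, ?_⟩
  rw [hF.eq_mk z, ← ha]
  rfl

theorem IsReducedRepresentation.mem_hyperplane_iff (hF : IsReducedRepresentation F f)
    (ℓ : Module.Dual ℂ (AffineCone n)) (z : ℂ) : f z ∈ hyperplane ℓ ↔ ℓ (F z) = 0 := by
  obtain ⟨a, ha, h⟩ := hF.exists_rep_eq_smul z
  change ℓ (f z).rep = 0 ↔ _
  rw [h, map_smul, smul_eq_zero]
  simp [ha]

theorem IsReducedRepresentation.fubiniStudyWeil_eq (hF : IsReducedRepresentation F f)
    (ℓ : Module.Dual ℂ (AffineCone n)) (z : ℂ) :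
    fubiniStudyWeil ℓ (f z) = -Real.log (‖ℓ (F z)‖ / ‖F z‖) := by
  obtain ⟨a, ha, h⟩ := hF.exists_rep_eq_smul z
  rw [fubiniStudyWeil, h, map_smul, norm_smul, norm_smul,
    mul_div_mul_left _ _ (norm_ne_zero_iff.2 ha)]

theorem IsLinearlyNondegenerate.exists_ne_zero (hf : IsLinearlyNondegenerate f)
    (hF : IsReducedRepresentation F f) (b : Module.Dual ℂ (AffineCone n)) (hb : b ≠ 0) :
    ∃ z, b (F z) ≠ 0 := by
  by_contra! h
  refine hf b hb ?_
  rintro _ ⟨z, rfl⟩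
  exact (hF.mem_hyperplane_iff b z).2 (h z)

theorem IsWeilFunction.continuousOn_comp {ℓ : Module.Dual ℂ (AffineCone n)} {lam : ProjSpace n → ℝ}
    (hlam : IsWeilFunction ℓ lam) (hF : IsReducedRepresentation F f) {S : Set ℂ}
    (hS : ∀ z ∈ S, ℓ (F z) ≠ 0) : ContinuousOn (fun z => lam (f z)) S := by
  have h1 : Continuous fun z => (⟨F z, hF.ne_zero z⟩ : {v : AffineCone n // v ≠ 0}) :=
    hF.differentiable.continuous.subtype_mk _
  refine (hlam.continuousOn.comp h1.continuousOn fun z hz => hS z hz).congr fun z _ => ?_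
  simp only [Function.comp_apply]
  rw [hF.eq_mk z]
  rfl

theorem linearForm_apply_eq_sum (b : Module.Dual ℂ (AffineCone n)) (x : AffineCone n) :
    b x = ∑ i, b (EuclideanSpace.single i 1) * x i := by
  conv_lhs => rw [← (EuclideanSpace.basisFun (Fin (n + 1)) ℂ).sum_repr x]
  rw [map_sum]
  refine Finset.sum_congr rfl fun i _ => ?_
  rw [map_smul, smul_eq_mul, mul_comm]
  simp

theorem differentiable_coord (hF : Differentiable ℂ F) (i : Fin (n + 1)) :
    Differentiable ℂ fun z => F z i :=
  (EuclideanSpace.proj (𝕜 := ℂ) i).differentiable.comp hF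

/-- The matrix of a family of linear forms. -/
noncomputable def formMatrix (b : Fin (n + 1) → Module.Dual ℂ (AffineCone n)) :
    Matrix (Fin (n + 1)) (Fin (n + 1)) ℂ :=
  Matrix.of fun i k => b k (EuclideanSpace.single i 1)

theorem det_formMatrix_ne_zero {b : Fin (n + 1) → Module.Dual ℂ (AffineCone n)}
    (hb : LinearIndependent ℂ b) : (formMatrix b).det ≠ 0 := by
  intro h
  obtain ⟨v, hv, hv0⟩ := Matrix.exists_mulVec_eq_zero_iff.2 h
  refine hv ?_
  have h1 : ∑ k, v k • b k = 0 := by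
    ext x
    rw [linearForm_apply_eq_sum, LinearMap.zero_apply]
    refine Finset.sum_eq_zero fun i _ => ?_
    have h2 := congrFun hv0 i
    simp only [Matrix.mulVec, dotProduct, formMatrix, Matrix.of_apply, Pi.zero_apply] at h2
    rw [LinearMap.sum_apply, mul_eq_zero]
    left
    rw [← h2]
    exact Finset.sum_congr rfl fun k _ => by rw [LinearMap.smul_apply, smul_eq_mul, mul_comm]
  exact funext (Fintype.linearIndependent_iff.1 hb v h1)

theorem wron_linearForms (hF : Differentiable ℂ F)
    (b : Fin (n + 1) → Module.Dual ℂ (AffineCone n)) (z : ℂ) :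
    wron (fun k w => b k (F w)) z = wronskian F z * (formMatrix b).det := by
  rw [wronskian_eq_wron, ← wron_linear fun i => (differentiable_coord hF i).analyticAt z]
  congr 1
  funext k w
  rw [linearForm_apply_eq_sum]
  rfl

theorem differentiable_wronskian (hF : Differentiable ℂ F) : Differentiable ℂ (wronskian F) := by
  unfold wronskian
  simp only [Matrix.det_apply]
  refine Differentiable.fun_sum fun σ _ => Differentiable.fun_const_smul ?_ _
  refine Differentiable.fun_finsetProd fun k _ => ?_
  simp only [Matrix.of_apply]
  exact ((differentiable_coord hF _).contDiff (n := ⊤)).differentiable_iteratedDeriv _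
    (by exact_mod_cast WithTop.coe_lt_top _)

/-- A vanishing Wronskian yields a linear relation among the coordinates on some open set; by the
identity theorem it holds everywhere, against non-degeneracy. -/
theorem exists_wronskian_ne_zero (hF : Differentiable ℂ F)
    (hnd : ∀ b : Module.Dual ℂ (AffineCone n), b ≠ 0 → ∃ z, b (F z) ≠ 0) :
    ∃ z, wronskian F z ≠ 0 := by
  by_contra! h
  obtain ⟨V, -, hVo, ⟨z₀, hz₀⟩, c, hc, hrel⟩ := exists_linear_relation_of_wron_eq_zero
    (u := fun i w => F w i) isOpen_univ univ_nonempty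
    (fun i => (differentiable_coord hF i).differentiableOn) (fun z _ => h z)
  set b : Module.Dual ℂ (AffineCone n) :=
    ∑ i, c i • ((EuclideanSpace.proj (𝕜 := ℂ) i : AffineCone n →L[ℂ] ℂ) : AffineCone n →ₗ[ℂ] ℂ) with hb
  have hbx : ∀ x : AffineCone n, b x = ∑ i, c i * x i := fun x => by
    simp [hb, LinearMap.sum_apply]
  have hb0 : b ≠ 0 := by
    intro h0
    refine hc (funext fun i => ?_)
    have := hbx (EuclideanSpace.single i 1)
    rw [h0, LinearMap.zero_apply] at this
    simpa [PiLp.single_apply] using this.symm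
  obtain ⟨z, hz⟩ := hnd b hb0
  have hent := differentiable_linearForm_comp hF b
  refine hz (congrFun (AnalyticOnNhd.eq_of_eventuallyEq (f := fun z => b (F z)) (g := fun _ => 0)
    (z₀ := z₀) (fun w _ => hent.analyticAt w) (fun w _ => analyticAt_const) ?_) z)
  filter_upwards [hVo.mem_nhds hz₀] with w hw
  rw [hbx, hrel w hw]

/-- The sum of the proximity functions is controlled as soon as the Wronskians of the relevant bases
of linear forms are dominated, on a circle, by the products of their members. -/
theorem exists_proximity_le {q : ℕ} {ℓ : Fin q → Module.Dual ℂ (AffineCone n)}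
    {lam : Fin q → ProjSpace n → ℝ} (hlam : ∀ i, IsWeilFunction (ℓ i) (lam i))
    (hF : IsReducedRepresentation F f) {b : Finset (Fin q) → Fin (n + 1) → Module.Dual ℂ (AffineCone n)}
    (hb : ∀ J, LinearIndependent ℂ (b J)) {C₁ : ℝ}
    (hC₁ : ∀ x, x ≠ 0 → (∀ i, ℓ i x ≠ 0) → (∀ J k, b J k x ≠ 0) → ∃ J,
      ∑ i, -Real.log (‖ℓ i x‖ / ‖x‖) ≤ ∑ k, -Real.log (‖b J k x‖ / ‖x‖) + C₁) :
    ∃ C : ℝ, ∀ r, 0 < r → (∀ z, ‖z‖ = r → wronskian F z ≠ 0 ∧ (∀ i, ℓ i (F z) ≠ 0) ∧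
      ∀ J k, b J k (F z) ≠ 0) → ∀ β : ℂ → ℝ, ContinuousOn β (sphere 0 |r|) →
      (∀ z, ‖z‖ = r → ∀ J, ‖wron (fun k w => b J k (F w)) z‖ ≤
        Real.exp (β z) * ∏ k, ‖b J k (F z)‖) →
      (∑ i, proximity f (lam i) r) + zeroCounting (wronskian F) r ≤
        characteristic F (n + 1) r + Real.circleAverage β 0 r + C := by
  choose Cw hCw using fun i => (hlam i).bounded
  obtain ⟨Cd, hCd'⟩ := (finite_range fun J => -Real.log ‖(formMatrix (b J)).det‖).bddAbove
  have hCd : ∀ J, -Real.log ‖(formMatrix (b J)).det‖ ≤ Cd := fun J => hCd' (mem_range_self J)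
  set κ := Real.log ‖meromorphicTrailingCoeffAt (wronskian F) 0‖ with hκ
  refine ⟨∑ i, Cw i + C₁ + Cd + (n + 1) * Real.log ‖F 0‖ - κ, ?_⟩
  intro r hr hne β hβ hwr
  have hsph : ∀ z ∈ sphere (0 : ℂ) |r|, ‖z‖ = r := fun z hz => by simpa [abs_of_pos hr] using hz
  have hW := differentiable_wronskian hF.differentiable
  have cl : ∀ i ∈ Finset.univ, ContinuousOn (fun z => lam i (f z)) (sphere 0 |r|) := fun i _ =>
    (hlam i).continuousOn_comp hF fun z hz => (hne z (hsph z hz)).2.1 i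
  have csl : ContinuousOn (fun z => ∑ i, lam i (f z)) (sphere 0 |r|) := continuousOn_finsetSum _ cl
  have cW := continuousOn_log_norm hW fun z hz => (hne z (hsph z hz)).1
  have cF := continuousOn_log_norm_comp hF.differentiable hF.ne_zero (sphere (0 : ℂ) |r|)
  have cF' : ContinuousOn (fun z => ((n : ℝ) + 1) * Real.log ‖F z‖) (sphere (0 : ℂ) |r|) :=
    continuousOn_const.mul cF
  set K := ∑ i, Cw i + C₁ + Cd with hK
  -- The theorem in pointwise form. Once averaged, log|W(F)| gives the counting function by Jensen's
  -- formula and (n+1) log‖F‖ gives the characteristic.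
  have hpt : ∀ z ∈ sphere (0 : ℂ) |r|, ∑ i, lam i (f z) + Real.log ‖wronskian F z‖ ≤
      (((n : ℝ) + 1) * Real.log ‖F z‖ + β z) + K := by
    intro z hz
    have hzr := hsph z hz
    obtain ⟨h1, h2, h3⟩ := hne z hzr
    have hFz := hF.ne_zero z
    have hFn := norm_pos_iff.2 hFz
    have s1 : ∑ i, lam i (f z) ≤ ∑ i, -Real.log (‖ℓ i (F z)‖ / ‖F z‖) + ∑ i, Cw i := by
      rw [← Finset.sum_add_distrib]
      refine Finset.sum_le_sum fun i _ => ?_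
      have := (abs_le.1 (hCw i (f z) fun h => h2 i ((hF.mem_hyperplane_iff (ℓ i) z).1 h))).2
      rw [hF.fubiniStudyWeil_eq] at this
      linarith
    obtain ⟨J, hJ⟩ := hC₁ (F z) hFz h2 h3
    have s2 : ∑ k, -Real.log (‖b J k (F z)‖ / ‖F z‖) =
        ((n : ℝ) + 1) * Real.log ‖F z‖ - ∑ k, Real.log ‖b J k (F z)‖ := by
      have : ∀ k, -Real.log (‖b J k (F z)‖ / ‖F z‖) =
          Real.log ‖F z‖ - Real.log ‖b J k (F z)‖ := fun k => by
        rw [Real.log_div (norm_ne_zero_iff.2 (h3 J k)) hFn.ne']; ring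
      simp only [this]
      rw [Finset.sum_sub_distrib, Finset.sum_const, Finset.card_univ, Fintype.card_fin, nsmul_eq_mul]
      push_cast; ring
    have hdet := det_formMatrix_ne_zero (hb J)
    have s3 : Real.log ‖wronskian F z‖ + Real.log ‖(formMatrix (b J)).det‖ ≤
        β z + ∑ k, Real.log ‖b J k (F z)‖ := by
      have hw := hwr z hzr J
      rw [wron_linearForms hF.differentiable, norm_mul] at hw
      have hpos : 0 < ‖wronskian F z‖ * ‖(formMatrix (b J)).det‖ :=
        mul_pos (norm_pos_iff.2 h1) (norm_pos_iff.2 hdet)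
      have := Real.log_le_log hpos hw
      rwa [Real.log_mul (norm_ne_zero_iff.2 h1) (norm_ne_zero_iff.2 hdet),
        Real.log_mul (Real.exp_pos _).ne' (Finset.prod_ne_zero_iff.2 fun k _ =>
          norm_ne_zero_iff.2 (h3 J k)), Real.log_exp,
        Real.log_prod fun k _ => norm_ne_zero_iff.2 (h3 J k)] at this
    have := hCd J
    linarith
  have hmono := Real.circleAverage_mono (csl.add cW).circleIntegrable'
    ((cF'.add hβ).add continuousOn_const).circleIntegrable' hpt
  have a1 := Real.circleAverage_add csl.circleIntegrable' cW.circleIntegrable'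
  have a2 := Real.circleAverage_add (cF'.add hβ).circleIntegrable'
    (continuousOn_const (c := K) (s := sphere (0 : ℂ) |r|)).circleIntegrable'
  have a3 := Real.circleAverage_add cF'.circleIntegrable' hβ.circleIntegrable'
  have a4 : Real.circleAverage (fun z => ((n : ℝ) + 1) * Real.log ‖F z‖) 0 r =
      ((n : ℝ) + 1) * Real.circleAverage (fun z => Real.log ‖F z‖) 0 r := by
    simp only [← smul_eq_mul ((n : ℝ) + 1)]
    exact Real.circleAverage_fun_smul
  have a5 : Real.circleAverage (fun z => ∑ i, lam i (f z)) 0 r = ∑ i, proximity f (lam i) r :=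
    Real.circleAverage_fun_sum fun i hi => (cl i hi).circleIntegrable'
  rw [a1, a2, a3, a4, a5, Real.circleAverage_const] at hmono
  have hz := zeroCounting_eq_circleAverage hW hr.ne'
  have hT := characteristic_eq_circleAverage hF.differentiable hF.ne_zero (n + 1) hr.le
  push_cast at hT
  rw [hz, hT]
  linarith

end Curve

/-! ### Algebraic curves -/

/-- The property is stable under products and clear for constants and for X − a, and every complex
polynomial splits into such factors. -/
theorem exists_norm_eval_derivative_le (Q : ℂ[X]) :
    ∃ X r₀ : ℝ, 0 ≤ X ∧ ∀ z : ℂ, r₀ ≤ ‖z‖ → ‖Q.derivative.eval z‖ ≤ X * ‖Q.eval z‖ := by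
  have hmul : ∀ A B : ℂ[X],
      (∃ X r₀ : ℝ, 0 ≤ X ∧ ∀ z : ℂ, r₀ ≤ ‖z‖ → ‖A.derivative.eval z‖ ≤ X * ‖A.eval z‖) →
      (∃ X r₀ : ℝ, 0 ≤ X ∧ ∀ z : ℂ, r₀ ≤ ‖z‖ → ‖B.derivative.eval z‖ ≤ X * ‖B.eval z‖) →
      ∃ X r₀ : ℝ, 0 ≤ X ∧ ∀ z : ℂ, r₀ ≤ ‖z‖ → ‖(A * B).derivative.eval z‖ ≤ X * ‖(A * B).eval z‖ := by
    rintro A B ⟨X, r, hX, h⟩ ⟨Y, t, hY, h'⟩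
    refine ⟨X + Y, max r t, by positivity, fun z hz => ?_⟩
    have h1 := h z ((le_max_left _ _).trans hz)
    have h2 := h' z ((le_max_right _ _).trans hz)
    rw [Polynomial.derivative_mul, Polynomial.eval_add, Polynomial.eval_mul, Polynomial.eval_mul,
      Polynomial.eval_mul]
    refine (norm_add_le _ _).trans ?_
    rw [norm_mul, norm_mul, norm_mul]
    calc _ ≤ X * ‖A.eval z‖ * ‖B.eval z‖ + ‖A.eval z‖ * (Y * ‖B.eval z‖) := by gcongr
      _ = _ := by ring
  rw [(IsAlgClosed.splits Q).eq_prod_roots]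
  refine hmul _ _ ⟨0, 0, le_rfl, fun z _ => by simp⟩ ?_
  induction Q.roots using Multiset.induction_on with
  | empty => exact ⟨0, 0, le_rfl, fun z _ => by simp⟩
  | cons a s ih =>
    rw [Multiset.map_cons, Multiset.prod_cons]
    refine hmul _ _ ⟨1, ‖a‖ + 1, zero_le_one, fun z hz => ?_⟩ ih
    have := norm_sub_norm_le z a
    simp only [Polynomial.derivative_sub, Polynomial.derivative_X, Polynomial.derivative_C, sub_zero,
      Polynomial.eval_one, norm_one, Polynomial.eval_sub, Polynomial.eval_X, Polynomial.eval_C]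
    linarith

theorem exists_norm_iteratedDeriv_eval_le (Q : ℂ[X]) (k : ℕ) :
    ∃ X r₀ : ℝ, 0 ≤ X ∧ ∀ z : ℂ, r₀ ≤ ‖z‖ →
      ‖iteratedDeriv k (fun w => Q.eval w) z‖ ≤ X * ‖Q.eval z‖ := by
  induction k generalizing Q with
  | zero => exact ⟨1, 0, zero_le_one, fun z _ => by simp⟩
  | succ k ih =>
    obtain ⟨X, r, hX, h⟩ := ih Q.derivative
    obtain ⟨Y, t, hY, h'⟩ := exists_norm_eval_derivative_le Q
    refine ⟨X * Y, max r t, by positivity, fun z hz => ?_⟩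
    have h1 := h z ((le_max_left _ _).trans hz)
    have h2 := h' z ((le_max_right _ _).trans hz)
    have h3 : deriv (fun w => Q.eval w) = fun w => Q.derivative.eval w :=
      funext fun w => Q.deriv
    rw [iteratedDeriv_succ', h3]
    calc _ ≤ X * ‖Q.derivative.eval z‖ := h1
      _ ≤ X * (Y * ‖Q.eval z‖) := by gcongr
      _ = _ := by ring

theorem exists_eval_ne_zero_of_large {Q : ℂ[X]} (hQ : Q ≠ 0) :
    ∃ r₀ : ℝ, ∀ z : ℂ, r₀ ≤ ‖z‖ → Q.eval z ≠ 0 := by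
  obtain ⟨C, hC⟩ := (Q.roots.toFinset.finite_toSet.image fun z => ‖z‖).bddAbove
  refine ⟨C + 1, fun z hz h => ?_⟩
  have : ‖z‖ ≤ C := hC ⟨z, by simpa [hQ] using h, rfl⟩
  linarith

section Curve

variable {n : ℕ} {f : ℂ → ProjSpace n} {F G : ℂ → AffineCone n}

/-- Two reduced representations differ by a holomorphic factor without zeros. -/
theorem IsReducedRepresentation.exists_eventuallyEq_smul (hF : IsReducedRepresentation F f)
    (hG : IsReducedRepresentation G f) (z : ℂ) :
    ∃ a : ℂ → ℂ, AnalyticAt ℂ a z ∧ a z ≠ 0 ∧ ∀ᶠ w in 𝓝 z, F w = a w • G w := by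
  have hprop : ∀ w, ∃ c : ℂ, c ≠ 0 ∧ F w = c • G w := fun w => by
    have h := (hF.eq_mk w).symm.trans (hG.eq_mk w)
    obtain ⟨c, hc⟩ := (Projectivization.mk_eq_mk_iff ℂ _ _ (hF.ne_zero w) (hG.ne_zero w)).1 h
    exact ⟨c, c.ne_zero, hc.symm⟩
  choose c hc hcF using hprop
  obtain ⟨i, hi⟩ : ∃ i, G z i ≠ 0 := by
    by_contra! h
    exact hG.ne_zero z (by ext i; simpa using h i)
  have hev : ∀ᶠ w in 𝓝 z, c w = F w i / G w i := by
    filter_upwards [(differentiable_coord hG.differentiable i).continuous.continuousAt.eventually_ne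
      hi] with w hw
    rw [eq_div_iff hw, hcF w]
    simp
  refine ⟨c, ?_, hc z, Eventually.of_forall hcF⟩
  refine AnalyticAt.congr ?_ (hev.mono fun w hw => hw.symm)
  exact ((differentiable_coord hF.differentiable i).analyticAt z).div
    ((differentiable_coord hG.differentiable i).analyticAt z) hi

/-- Both sides scale by |a|^(n+1) under F = a·G. A bound proved for a polynomial representation thus
passes to an arbitrary one, which may differ from it by a transcendental factor. -/
theorem IsReducedRepresentation.wron_linearForms_le_of_le (hF : IsReducedRepresentation F f)
    (hG : IsReducedRepresentation G f) (b : Fin (n + 1) → Module.Dual ℂ (AffineCone n)) {z : ℂ}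
    {X : ℝ} (h : ‖wron (fun k w => b k (G w)) z‖ ≤ X * ∏ k, ‖b k (G z)‖) :
    ‖wron (fun k w => b k (F w)) z‖ ≤ X * ∏ k, ‖b k (F z)‖ := by
  obtain ⟨a, ha, -, hev⟩ := hF.exists_eventuallyEq_smul hG z
  have h1 : wron (fun k w => b k (F w)) z = wron (fun k w => a w * b k (G w)) z :=
    wron_congr fun k => hev.mono fun w hw => by simp only [hw, map_smul, smul_eq_mul]
  rw [h1, wron_mul (fun k => (differentiable_linearForm_comp hG.differentiable (b k)).analyticAt z) ha]
  have h2 : ∀ k, ‖b k (F z)‖ = ‖a z‖ * ‖b k (G z)‖ := fun k => by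
    rw [hev.self_of_nhds, map_smul, smul_eq_mul, norm_mul]
  simp only [h2]
  rw [Finset.prod_mul_distrib, Finset.prod_const, Finset.card_univ, Fintype.card_fin, norm_mul,
    norm_pow]
  calc ‖a z‖ ^ (n + 1) * ‖wron (fun k w => b k (G w)) z‖ ≤
        ‖a z‖ ^ (n + 1) * (X * ∏ k, ‖b k (G z)‖) := by gcongr
    _ = _ := by ring

theorem IsReducedRepresentation.linearForm_eq_zero_iff (hF : IsReducedRepresentation F f)
    (hG : IsReducedRepresentation G f) (b : Module.Dual ℂ (AffineCone n)) (z : ℂ) :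
    b (F z) = 0 ↔ b (G z) = 0 := by
  rw [← hF.mem_hyperplane_iff, hG.mem_hyperplane_iff]

theorem IsReducedRepresentation.wronskian_eq_zero_iff (hF : IsReducedRepresentation F f)
    (hG : IsReducedRepresentation G f) (z : ℂ) : wronskian F z = 0 ↔ wronskian G z = 0 := by
  obtain ⟨a, ha, ha0, hev⟩ := hF.exists_eventuallyEq_smul hG z
  have h1 : wronskian F z = wron (fun i w => a w * G w i) z := by
    rw [wronskian_eq_wron]
    exact wron_congr fun k => hev.mono fun w hw => by simp [hw]
  rw [h1, wron_mul (fun i => (differentiable_coord hG.differentiable i).analyticAt z) ha,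
    ← wronskian_eq_wron, mul_eq_zero]
  simp [ha0]

/-- In the polynomial representation every form and every Wronskian is a non-zero polynomial, hence
non-zero near infinity, and derivatives are dominated by the polynomials themselves. This gives a
bounded error at all large radii, with no exceptional set. -/
theorem IsAlgebraicCurve.exists_wron_le {ι κ : Type*} [Finite ι] [Finite κ]
    (halg : IsAlgebraicCurve f) (hf : IsLinearlyNondegenerate f) (hF : IsReducedRepresentation F f)
    (ℓ : ι → Module.Dual ℂ (AffineCone n)) (hℓ : ∀ i, ℓ i ≠ 0)
    (b : κ → Fin (n + 1) → Module.Dual ℂ (AffineCone n)) (hb : ∀ J k, b J k ≠ 0) :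
    ∃ X r₀ : ℝ, ∀ z, r₀ ≤ ‖z‖ → wronskian F z ≠ 0 ∧ (∀ i, ℓ i (F z) ≠ 0) ∧
      (∀ J k, b J k (F z) ≠ 0) ∧
      ∀ J, ‖wron (fun k w => b J k (F w)) z‖ ≤ Real.exp X * ∏ k, ‖b J k (F z)‖ := by
  obtain ⟨P, hG⟩ := halg
  set G : ℂ → AffineCone n := fun z => WithLp.toLp 2 fun i => (P i).eval z with hGdef
  have hpoly : ∀ c : Module.Dual ℂ (AffineCone n), ∃ Q : ℂ[X], ∀ z, c (G z) = Q.eval z := fun c => by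
    refine ⟨∑ i, Polynomial.C (c (EuclideanSpace.single i 1)) * P i, fun z => ?_⟩
    rw [linearForm_apply_eq_sum, Polynomial.eval_finsetSum]
    simp [hGdef]
  -- The filter |z| → ∞ lets finitely many thresholds be merged into one.
  set L : Filter ℂ := comap norm atTop with hL
  have hev : ∀ {p : ℂ → Prop} {r₀ : ℝ}, (∀ z, r₀ ≤ ‖z‖ → p z) → ∀ᶠ z in L, p z := fun {p r₀} h =>
    ((eventually_ge_atTop r₀).comap norm).mono h
  have hlarge : ∀ c : Module.Dual ℂ (AffineCone n), c ≠ 0 → ∀ᶠ z in L, c (F z) ≠ 0 := fun c hc => by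
    obtain ⟨Q, hQ⟩ := hpoly c
    obtain ⟨z, hz⟩ := hf.exists_ne_zero hG c hc
    obtain ⟨r₀, hr₀⟩ := exists_eval_ne_zero_of_large (Q := Q) (fun h => hz (by rw [hQ, h]; simp))
    refine hev (r₀ := r₀) fun w hw h => hr₀ w hw ?_
    rw [← hQ]
    exact (hF.linearForm_eq_zero_iff hG c w).1 h
  have hiter : ∀ (Q : ℂ[X]) (k : ℕ),
      iteratedDeriv k (fun w => Q.eval w) = fun w => (Polynomial.derivative^[k] Q).eval w := by
    intro Q k
    induction k generalizing Q with
    | zero => simp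
    | succ k ih =>
      have h3 : deriv (fun w => Q.eval w) = fun w => Q.derivative.eval w := funext fun w => Q.deriv
      rw [iteratedDeriv_succ', h3, ih, Function.iterate_succ_apply]
  have hWev : ∀ᶠ z in L, wronskian F z ≠ 0 := by
    set Q : ℂ[X] := Matrix.det (Matrix.of fun k i : Fin (n + 1) =>
      Polynomial.derivative^[(k : ℕ)] (P i)) with hQdef
    have hQ : ∀ z, wronskian G z = Q.eval z := fun z => by
      rw [← Polynomial.coe_evalRingHom, hQdef, RingHom.map_det, wronskian]
      congr 1
      ext k i
      simp only [Matrix.of_apply, RingHom.mapMatrix_apply, Matrix.map_apply,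
        Polynomial.coe_evalRingHom]
      exact congrFun (hiter (P i) k) z
    obtain ⟨z, hz⟩ := exists_wronskian_ne_zero hG.differentiable
      fun c hc => hf.exists_ne_zero hG c hc
    obtain ⟨r₀, hr₀⟩ := exists_eval_ne_zero_of_large (Q := Q) (fun h => hz (by rw [hQ, h]; simp))
    refine hev (r₀ := r₀) fun w hw h => hr₀ w hw ?_
    rw [← hQ]
    exact (hF.wronskian_eq_zero_iff hG w).1 h
  have hder : ∀ c : Module.Dual ℂ (AffineCone n), ∀ k : ℕ, ∃ X : ℝ, 0 ≤ X ∧ ∀ᶠ z in L,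
      ‖iteratedDeriv k (fun w => c (G w)) z‖ ≤ X * ‖c (G z)‖ := fun c k => by
    obtain ⟨Q, hQ⟩ := hpoly c
    obtain ⟨X, r₀, hX, h⟩ := exists_norm_iteratedDeriv_eval_le Q k
    simp only [hQ]
    exact ⟨X, hX, hev h⟩
  choose X hX hXev using hder
  have := Fintype.ofFinite κ
  set Y : ℝ := ∑ J, ∑ i, ∑ k : Fin (n + 1), X (b J i) k with hY
  have hXY : ∀ J i (k : Fin (n + 1)), X (b J i) k ≤ Y := fun J i k => by
    have h1 := Finset.single_le_sum (f := fun k : Fin (n + 1) => X (b J i) k)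
      (fun k _ => hX _ _) (Finset.mem_univ k)
    have h2 := Finset.single_le_sum (f := fun i => ∑ k : Fin (n + 1), X (b J i) k)
      (fun i _ => Finset.sum_nonneg fun k _ => hX _ _) (Finset.mem_univ i)
    have h3 := Finset.single_le_sum (f := fun J => ∑ i, ∑ k : Fin (n + 1), X (b J i) k)
      (fun J _ => Finset.sum_nonneg fun i _ => Finset.sum_nonneg fun k _ => hX _ _)
      (Finset.mem_univ J)
    exact h1.trans (h2.trans h3)
  have hall : ∀ᶠ z in L, wronskian F z ≠ 0 ∧ (∀ i, ℓ i (F z) ≠ 0) ∧ (∀ J k, b J k (F z) ≠ 0) ∧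
      ∀ J i (k : Fin (n + 1)), ‖iteratedDeriv k (fun w => b J i (G w)) z‖ ≤
        X (b J i) k * ‖b J i (G z)‖ := by
    refine hWev.and ((eventually_all.2 fun i => hlarge _ (hℓ i)).and
      ((eventually_all.2 fun J => eventually_all.2 fun k => hlarge _ (hb J k)).and ?_))
    exact eventually_all.2 fun J => eventually_all.2 fun i => eventually_all.2 fun k => hXev _ _
  rw [hL, eventually_comap, eventually_atTop] at hall
  obtain ⟨r₀, hr₀⟩ := hall
  -- The bound x itself serves as the exponent, because x ≤ e^x.
  refine ⟨(n + 1).factorial * Y ^ (n + 1), r₀, fun z hz => ?_⟩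
  obtain ⟨h1, h2, h3, h4⟩ := hr₀ ‖z‖ hz z rfl
  refine ⟨h1, h2, h3, fun J => hF.wron_linearForms_le_of_le hG (b J) ?_⟩
  have h5 := norm_wron_le (u := fun k w => b J k (G w)) (z := z) (X := Y)
    (fun k h => h3 J k ((hF.linearForm_eq_zero_iff hG _ z).2 h))
    (fun i k => (h4 J i k).trans (by gcongr; exact hXY J i k))
  refine h5.trans ?_
  gcongr
  linarith [Real.add_one_le_exp ((n + 1).factorial * Y ^ (n + 1) : ℝ)]

end Curve

/-! ### The logarithmic derivative estimate -/

/-- Jensen's inequality for log, through the tangent line log y ≤ log A + y/A − 1. With M the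
argument of the logarithm and Y the sum of the s-powers, M^s ≤ Y by subadditivity, and s ≥ 1/2 with
log M ≥ 0 gives the factor 2. -/
theorem circleAverage_log_one_add_sum_rpow_le {ι : Type*} [Fintype ι] {x : ι → ℂ → ℝ} (j : ι → ℕ)
    {r s A : ℝ} (hs : 1 / 2 ≤ s) (hs1 : s ≤ 1) (hx : ∀ i z, 0 ≤ x i z)
    (hc : ∀ i, ContinuousOn (x i) (sphere 0 |r|))
    (hA : 1 + ∑ i, Real.circleAverage (fun z => x i z ^ (s / (j i + 1 : ℝ))) 0 r ≤ A) :
    Real.circleAverage (fun z => Real.log (1 + ∑ i, x i z ^ (1 / (j i + 1 : ℝ)))) 0 r ≤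
      2 * Real.log A := by
  have hs0 : 0 < s := by linarith
  have hj : ∀ i, (0 : ℝ) < j i + 1 := fun i => by positivity
  set Y : ℂ → ℝ := fun z => 1 + ∑ i, x i z ^ (s / (j i + 1 : ℝ)) with hY
  have ct : ∀ i ∈ Finset.univ, ContinuousOn (fun z => x i z ^ (s / (j i + 1 : ℝ))) (sphere 0 |r|) :=
    fun i _ => (hc i).rpow_const fun z _ => Or.inr (div_pos hs0 (hj i)).le
  have ct' : ∀ i ∈ Finset.univ, ContinuousOn (fun z => x i z ^ (1 / (j i + 1 : ℝ))) (sphere 0 |r|) :=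
    fun i _ => (hc i).rpow_const fun z _ => Or.inr (div_pos one_pos (hj i)).le
  have cs := continuousOn_finsetSum _ ct
  have cY : ContinuousOn Y (sphere 0 |r|) := continuousOn_const.add cs
  have hM1 : ∀ z, 1 ≤ 1 + ∑ i, x i z ^ (1 / (j i + 1 : ℝ)) := fun z =>
    le_add_of_nonneg_right (Finset.sum_nonneg fun i _ => Real.rpow_nonneg (hx i z) _)
  have hY1 : ∀ z, 1 ≤ Y z := fun z =>
    le_add_of_nonneg_right (Finset.sum_nonneg fun i _ => Real.rpow_nonneg (hx i z) _)
  have cM : ContinuousOn (fun z => Real.log (1 + ∑ i, x i z ^ (1 / (j i + 1 : ℝ)))) (sphere 0 |r|) :=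
    ContinuousOn.log (continuousOn_const.add (continuousOn_finsetSum _ ct'))
      fun z _ => (zero_lt_one.trans_le (hM1 z)).ne'
  have havY : Real.circleAverage Y 0 r =
      1 + ∑ i, Real.circleAverage (fun z => x i z ^ (s / (j i + 1 : ℝ))) 0 r := by
    rw [← Real.circleAverage_fun_sum fun i hi => (ct i hi).circleIntegrable',
      hY, Real.circleAverage_fun_add (f₁ := fun _ : ℂ => (1 : ℝ))
      (continuousOn_const (s := sphere (0 : ℂ) |r|)).circleIntegrable' cs.circleIntegrable',
      Real.circleAverage_const]
  have hA1 : 1 ≤ A := by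
    refine le_trans (le_add_of_nonneg_right (Finset.sum_nonneg fun i _ => ?_)) hA
    exact Real.circleAverage_nonneg_of_nonneg fun z _ => Real.rpow_nonneg (hx i z) _
  have hA0 : 0 < A := by linarith
  have hpt : ∀ z ∈ sphere (0 : ℂ) |r|, Real.log (1 + ∑ i, x i z ^ (1 / (j i + 1 : ℝ))) ≤
      2 * (Real.log A - 1) + (2 / A) * Y z := by
    intro z _
    set M := 1 + ∑ i, x i z ^ (1 / (j i + 1 : ℝ)) with hM
    have hMpos : 0 < M := zero_lt_one.trans_le (hM1 z)
    have hYpos : 0 < Y z := zero_lt_one.trans_le (hY1 z)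
    have h1 : M ^ s ≤ Y z := by
      have hnn : ∀ i ∈ Finset.univ, 0 ≤ x i z ^ (1 / (j i + 1 : ℝ)) := fun i _ =>
        Real.rpow_nonneg (hx i z) _
      calc M ^ s ≤ 1 ^ s + (∑ i, x i z ^ (1 / (j i + 1 : ℝ))) ^ s :=
            Real.rpow_add_le_add_rpow zero_le_one (Finset.sum_nonneg hnn) hs0.le hs1
        _ ≤ 1 + ∑ i, (x i z ^ (1 / (j i + 1 : ℝ))) ^ s := by
            rw [Real.one_rpow]
            gcongr
            exact rpow_sum_le_sum_rpow _ _ hnn hs0 hs1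
        _ = Y z := by
            simp only [hY]
            congr 1
            refine Finset.sum_congr rfl fun i _ => ?_
            rw [← Real.rpow_mul (hx i z)]
            congr 1
            ring
    have h2 : s * Real.log M ≤ Real.log (Y z) := by
      rw [← Real.log_rpow hMpos]
      exact Real.log_le_log (Real.rpow_pos_of_pos hMpos _) h1
    have h3 : 0 ≤ Real.log M := Real.log_nonneg (hM1 z)
    have h4 := Real.log_le_sub_one_of_pos (div_pos hYpos hA0)
    rw [Real.log_div hYpos.ne' hA0.ne'] at h4
    have h5 : (2 / A) * Y z = 2 * (Y z / A) := by ring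
    rw [h5]
    nlinarith
  have cR : ContinuousOn (fun z => (2 / A) * Y z) (sphere 0 |r|) := continuousOn_const.mul cY
  refine (Real.circleAverage_mono cM.circleIntegrable'
    (continuousOn_const.add cR).circleIntegrable' hpt).trans ?_
  have a1 := Real.circleAverage_add (continuousOn_const (c := 2 * (Real.log A - 1))
    (s := sphere (0 : ℂ) |r|)).circleIntegrable' cR.circleIntegrable'
  have a2 : Real.circleAverage (fun z => (2 / A) * Y z) 0 r = (2 / A) * Real.circleAverage Y 0 r := by
    simp only [← smul_eq_mul (2 / A)]
    exact Real.circleAverage_fun_smul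
  rw [a1, a2, Real.circleAverage_const, havY]
  have h6 : 2 / A * (1 + ∑ i, Real.circleAverage (fun z => x i z ^ (s / (j i + 1 : ℝ))) 0 r) ≤
      2 / A * A := by gcongr
  rw [div_mul_cancel₀ _ hA0.ne'] at h6
  linarith

variable {n : ℕ} {F : ℂ → AffineCone n}

/-- The lemma on logarithmic derivatives, for the Wronskians of finitely many families of linear
forms along a curve. -/
theorem exists_wron_bound {κ : Type*} [Fintype κ] (hF : Differentiable ℂ F) (h0 : ∀ z, F z ≠ 0)
    (b : κ → Fin (n + 1) → Module.Dual ℂ (AffineCone n)) {B : Set ℝ} (hB : B.Countable)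
    (hb : ∀ J k z, b J k (F z) = 0 → ‖z‖ ∈ B) {C₀ : ℝ} (hC₀ : 0 ≤ C₀) :
    ∃ c C : ℝ, 0 ≤ c ∧ ∀ r, Real.exp 2 ≤ r → r ∉ B → 1 ≤ characteristic F 1 r →
      Real.log r ≤ characteristic F 1 r + C₀ →
      characteristic F 1 (r + 1 / characteristic F 1 r) ≤ 2 * characteristic F 1 r →
      ∃ β : ℂ → ℝ, ContinuousOn β (sphere 0 |r|) ∧
        (∀ z, ‖z‖ = r → ∀ J, ‖wron (fun k w => b J k (F w)) z‖ ≤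
          Real.exp (β z) * ∏ k, ‖b J k (F z)‖) ∧
        Real.circleAverage β 0 r ≤ c * Real.log (characteristic F 1 r) + C := by
  set x : κ × Fin n × Fin n → ℂ → ℝ := fun p z => ‖iteratedDeriv p.2.2
    (logDeriv fun w => b p.1 p.2.1.succ (F w) / b p.1 0 (F w)) z‖ with hx
  have hex := fun p : κ × Fin n × Fin n => exists_circleAverage_iteratedDeriv_logDeriv_le hF h0
    (b p.1 p.2.1.succ) (b p.1 0) hB (hb p.1 p.2.1.succ) (hb p.1 0) hC₀ p.2.2
  choose Cp hCp0 hCp using hex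
  set D : ℝ := 1 + ∑ p, Cp p with hD
  have hD1 : 1 ≤ D := le_add_of_nonneg_right (Finset.sum_nonneg fun p _ => hCp0 p)
  set K₁ : ℝ := Real.log ((n + 1).factorial * (n.factorial : ℝ) ^ (n + 1)) with hK₁
  -- n(n+1) is the power of M in the Wronskian bound; 2·log(D·T^(n+3)) bounds the average of log M.
  refine ⟨(n * (n + 1) : ℕ) * (2 * (n + 3)), K₁ + (n * (n + 1) : ℕ) * (2 * Real.log D),
    by positivity, ?_⟩
  intro r hr hrB hT hlog hgrow
  set T := characteristic F 1 r with hTdef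
  have hlog2 : 2 ≤ Real.log r := (Real.le_log_iff_exp_le ((Real.exp_pos 2).trans_le hr)).2 hr
  have hr0 : 0 < r := (Real.exp_pos 2).trans_le hr
  have hsph : ∀ z ∈ sphere (0 : ℂ) |r|, ‖z‖ = r := fun z hz => by simpa [abs_of_pos hr0] using hz
  have hne : ∀ J k z, ‖z‖ = r → b J k (F z) ≠ 0 := fun J k z hz h => hrB (hz ▸ hb J k z h)
  -- The root of order j + 1 matches the weight of the j-th derivative, so that M^(j+1) dominates it
  -- as `norm_wron_le_of_logDeriv` requires.
  set M : ℂ → ℝ := fun z => 1 + ∑ p, x p z ^ (1 / ((p.2.2 : ℕ) + 1 : ℝ)) with hM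
  have hx0 : ∀ p z, 0 ≤ x p z := fun p z => norm_nonneg _
  have hM1 : ∀ z, 1 ≤ M z := fun z =>
    le_add_of_nonneg_right (Finset.sum_nonneg fun p _ => Real.rpow_nonneg (hx0 p z) _)
  have cx : ∀ p, ContinuousOn (x p) (sphere 0 |r|) := fun p =>
    (continuousOn_iteratedDeriv_logDeriv (differentiable_linearForm_comp hF _)
      (differentiable_linearForm_comp hF _) (fun z hz => hne _ _ z (hsph z hz))
      (fun z hz => hne _ _ z (hsph z hz)) _).norm
  have clM : ContinuousOn (fun z => Real.log (M z)) (sphere 0 |r|) :=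
    ContinuousOn.log (continuousOn_const.add (continuousOn_finsetSum _ fun p _ =>
      (cx p).rpow_const fun z _ => Or.inr (by positivity)))
      fun z _ => (zero_lt_one.trans_le (hM1 z)).ne'
  have cβ : ContinuousOn (fun z => (n * (n + 1) : ℕ) * Real.log (M z)) (sphere 0 |r|) :=
    continuousOn_const.mul clM
  refine ⟨fun z => K₁ + (n * (n + 1) : ℕ) * Real.log (M z), continuousOn_const.add cβ, ?_, ?_⟩
  · intro z hz J
    have hMpos : 0 < M z := zero_lt_one.trans_le (hM1 z)
    have h1 := norm_wron_le_of_logDeriv (u := fun k w => b J k (F w)) (z := z) (M := M z)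
      (fun k => (differentiable_linearForm_comp hF _).analyticAt z) (fun k => hne J k z hz) (hM1 z)
      (fun i j hj => by
        set p : κ × Fin n × Fin n := (J, i, ⟨j, hj⟩) with hp
        have h2 : x p z ^ (1 / ((j : ℕ) + 1 : ℝ)) ≤ M z := by
          have := Finset.single_le_sum (f := fun p => x p z ^ (1 / ((p.2.2 : ℕ) + 1 : ℝ)))
            (fun p _ => Real.rpow_nonneg (hx0 p z) _) (Finset.mem_univ p)
          exact this.trans (le_add_of_nonneg_left zero_le_one)
        have h3 : (x p z ^ (1 / ((j : ℕ) + 1 : ℝ))) ^ (j + 1) = x p z := by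
          rw [← Real.rpow_natCast, ← Real.rpow_mul (hx0 p z)]
          have : 1 / ((j : ℕ) + 1 : ℝ) * ((j + 1 : ℕ) : ℝ) = 1 := by push_cast; field_simp
          rw [this, Real.rpow_one]
        change x p z ≤ _
        rw [← h3]
        exact pow_le_pow_left₀ (Real.rpow_nonneg (hx0 p z) _) h2 _)
    refine h1.trans (le_of_eq ?_)
    congr 1
    have h4 : (0 : ℝ) < (n + 1).factorial * (n.factorial : ℝ) ^ (n + 1) := by positivity
    rw [Real.exp_add, hK₁, Real.exp_log h4, mul_comm ((n * (n + 1) : ℕ) : ℝ), Real.exp_mul,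
      Real.exp_log hMpos, Real.rpow_natCast, mul_pow, ← pow_mul]
    ring
  · have hs : 1 / 2 ≤ 1 - 1 / Real.log r := by
      have : 1 / Real.log r ≤ 1 / 2 := one_div_le_one_div_of_le two_pos hlog2
      linarith
    have hs1 : 1 - 1 / Real.log r ≤ 1 := by
      have : 0 < 1 / Real.log r := by positivity
      linarith
    have hT0 : 0 < T := by linarith
    have hA : 1 + ∑ p, Real.circleAverage (fun z => x p z ^ ((1 - 1 / Real.log r) /
        ((p.2.2 : ℕ) + 1 : ℝ))) 0 r ≤ D * T ^ (n + 3) := by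
      have hTn : ∀ k : ℕ, k ≤ n + 3 → T ^ k ≤ T ^ (n + 3) := fun k hk => pow_le_pow_right₀ hT hk
      rw [hD, add_mul, one_mul, Finset.sum_mul]
      refine add_le_add (one_le_pow₀ hT) (Finset.sum_le_sum fun p _ => ?_)
      refine (hCp p r hr hrB hT hlog hgrow).trans ?_
      exact mul_le_mul_of_nonneg_left (hTn _ (by omega)) (hCp0 p)
    have h1 := circleAverage_log_one_add_sum_rpow_le (fun p : κ × Fin n × Fin n => (p.2.2 : ℕ))
      hs hs1 hx0 cx hA
    rw [Real.log_mul (by positivity) (by positivity), Real.log_pow] at h1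
    have a1 := Real.circleAverage_add (continuousOn_const (c := K₁)
      (s := sphere (0 : ℂ) |r|)).circleIntegrable' cβ.circleIntegrable'
    have a2 : Real.circleAverage (fun z => ((n * (n + 1) : ℕ) : ℝ) * Real.log (M z)) 0 r =
        ((n * (n + 1) : ℕ) : ℝ) * Real.circleAverage (fun z => Real.log (M z)) 0 r := by
      simp only [← smul_eq_mul ((n * (n + 1) : ℕ) : ℝ)]
      exact Real.circleAverage_fun_smul
    refine (le_of_eq a1).trans ?_
    rw [a2, Real.circleAverage_const]
    have h2 : ((n * (n + 1) : ℕ) : ℝ) * Real.circleAverage (fun z => Real.log (M z)) 0 r ≤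
        ((n * (n + 1) : ℕ) : ℝ) * (2 * (Real.log D + ((n + 3 : ℕ) : ℝ) * Real.log T)) := by
      gcongr
    refine (add_le_add_right h2 K₁).trans (le_of_eq ?_)
    push_cast
    ring

/-! ### The second main theorem -/

section SecondMainTheorem

variable {n q : ℕ} {f : ℂ → ProjSpace n} {F : ℂ → AffineCone n}

/-- Borel's lemma applies because the characteristic vanishes at 0, is monotone, and is unbounded by
its logarithmic lower bound. The exceptional set also absorbs [0, e²], so that log r ≥ 2 and hence s
≥ 1/2 outside it. -/
theorem exists_borel_growth_characteristic (hn : n ≠ 0) (hF : Differentiable ℂ F)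
    (h0 : ∀ z, F z ≠ 0) (hnd : ∀ b : Module.Dual ℂ (AffineCone n), b ≠ 0 → ∃ z, b (F z) ≠ 0) :
    ∃ C : ℝ, 0 ≤ C ∧ ∃ E : Set ℝ, MeasurableSet E ∧ volume E < ⊤ ∧ ∀ r, 0 ≤ r → r ∉ E →
      Real.exp 2 ≤ r ∧ 1 < characteristic F 1 r ∧ Real.log r ≤ characteristic F 1 r + C ∧
      characteristic F 1 (r + 1 / characteristic F 1 r) ≤ 2 * characteristic F 1 r := by
  obtain ⟨C, hC, B, hB, hlog⟩ := exists_log_le_characteristic hn hF h0 hnd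
  have hunb : ∀ M, ∃ t, 0 ≤ t ∧ M < characteristic F 1 t := fun M => by
    obtain ⟨t, ht, -, htB⟩ := exists_notMem_countable hB
      (show Real.exp (|M| + C + 1) < Real.exp (|M| + C + 1) + 1 by linarith)
    have h1 : 1 ≤ Real.exp (|M| + C + 1) := Real.one_le_exp (by positivity)
    refine ⟨t, by linarith, ?_⟩
    have h2 := hlog t (by linarith) htB
    have h3 := (Real.lt_log_iff_exp_lt (by linarith)).2 ht
    linarith [le_abs_self M]
  obtain ⟨E, hE, hEv, hEg⟩ := exists_borel_growth (T := characteristic F 1)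
    (fun r hr R _ hrR => characteristic_mono hF h0 hr hrR) (by simp [characteristic]) hunb
  refine ⟨C, hC, E ∪ (Icc 0 (Real.exp 2) ∪ B),
    hE.union (measurableSet_Icc.union hB.measurableSet), ?_, fun r hr hrE => ?_⟩
  · refine (measure_union_le _ _).trans_lt (ENNReal.add_lt_top.2 ⟨hEv, ?_⟩)
    refine (measure_union_le _ _).trans_lt (ENNReal.add_lt_top.2 ⟨?_, ?_⟩)
    · simp
    · rw [hB.measure_zero]; simp
  · simp only [mem_union, not_or] at hrE
    obtain ⟨h1, h2, h3⟩ := hrE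
    have h4 : Real.exp 2 ≤ r := by
      by_contra h
      exact h2 ⟨hr, (not_le.1 h).le⟩
    obtain ⟨h5, h6⟩ := hEg r hr h1
    exact ⟨h4, h5, hlog r ((Real.one_le_exp zero_le_two).trans h4) h3, h6⟩

/-- Taking ψ = max(0, ρ − C) makes the inequality hold at every radius, exceptional ones included.
The condition 0 ≤ c·log T off E is needed because ψ is never negative. -/
theorem exists_smallError_of_bounds {ρ : ℝ → ℝ} {c C : ℝ} {E : Set ℝ}
    (hE : MeasurableSet E) (hEv : volume E < ⊤)
    (hρ : ∀ r, 0 ≤ r → r ∉ E →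
      0 ≤ c * Real.log (characteristic F 1 r) ∧ ρ r ≤ c * Real.log (characteristic F 1 r) + C)
    (halg : IsAlgebraicCurve f → ∃ X r₀ : ℝ, ∀ r, r₀ ≤ r → ρ r ≤ X) :
    ∃ ψ : ℝ → ℝ, IsSmallError f F ψ ∧ ∃ C : ℝ, ∀ r : ℝ, 0 < r → ρ r ≤ ψ r + C := by
  refine ⟨fun r => max 0 (ρ r - C), ⟨fun r _ => le_max_left _ _, ⟨c, E, hE, hEv, fun r hr hrE => ?_⟩,
    fun h => ?_⟩, C, fun r _ => ?_⟩
  · obtain ⟨h1, h2⟩ := hρ r hr hrE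
    exact max_le h1 (by linarith)
  · obtain ⟨X, r₀, hX⟩ := halg h
    refine ⟨max 0 (X - C), r₀, fun r hr => max_le_max le_rfl ?_⟩
    linarith [hX r hr]
  · linarith [le_max_right 0 (ρ r - C)]

theorem exists_smallError {ℓ : Fin q → Module.Dual ℂ (AffineCone n)} (hℓ : ∀ i, ℓ i ≠ 0)
    (hgp : InGeneralPosition ℓ) {lam : Fin q → ProjSpace n → ℝ}
    (hlam : ∀ i, IsWeilFunction (ℓ i) (lam i)) (hF : IsReducedRepresentation F f)
    (hf : IsLinearlyNondegenerate f) :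
    ∃ ψ : ℝ → ℝ, IsSmallError f F ψ ∧ ∃ C : ℝ, ∀ r : ℝ, 0 < r →
      (∑ i, proximity f (lam i) r) + zeroCounting (wronskian F) r - characteristic F (n + 1) r ≤
        ψ r + C := by
  have hd := hF.differentiable
  have hnd : ∀ b : Module.Dual ℂ (AffineCone n), b ≠ 0 → ∃ z, b (F z) ≠ 0 := fun b hb =>
    hf.exists_ne_zero hF b hb
  obtain ⟨b, hb, C₁, hC₁⟩ := hgp.exists_bases
  have hb0 : ∀ J k, b J k ≠ 0 := fun J k => (hb J).ne_zero k
  obtain ⟨CA, hCA⟩ := exists_proximity_le hlam hF hb hC₁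
  -- the moduli of the relevant zeros
  set B : Set ℝ := (fun z => ‖z‖) '' ({z | wronskian F z = 0} ∪ ((⋃ i, {z | ℓ i (F z) = 0}) ∪
    ⋃ J, ⋃ k, {z | b J k (F z) = 0})) with hB
  have hBc : B.Countable := by
    refine Countable.image (Countable.union ?_ (Countable.union ?_ ?_)) _
    · exact countable_zeros (differentiable_wronskian hd) (exists_wronskian_ne_zero hd hnd)
    · exact countable_iUnion fun i =>
        countable_zeros (differentiable_linearForm_comp hd (ℓ i)) (hnd _ (hℓ i))
    · exact countable_iUnion fun J => countable_iUnion fun k =>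
        countable_zeros (differentiable_linearForm_comp hd (b J k)) (hnd _ (hb0 J k))
  have hBW : ∀ z, wronskian F z = 0 → ‖z‖ ∈ B := fun z hz => ⟨z, Or.inl hz, rfl⟩
  have hBℓ : ∀ i z, ℓ i (F z) = 0 → ‖z‖ ∈ B := fun i z hz =>
    ⟨z, Or.inr (Or.inl (mem_iUnion.2 ⟨i, hz⟩)), rfl⟩
  have hBb : ∀ J k z, b J k (F z) = 0 → ‖z‖ ∈ B := fun J k z hz =>
    ⟨z, Or.inr (Or.inr (mem_iUnion.2 ⟨J, mem_iUnion.2 ⟨k, hz⟩⟩)), rfl⟩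
  have hgen : ∀ r, r ∉ B → ∀ z, ‖z‖ = r → wronskian F z ≠ 0 ∧ (∀ i, ℓ i (F z) ≠ 0) ∧
      ∀ J k, b J k (F z) ≠ 0 := fun r hr z hz =>
    ⟨fun h => hr (hz ▸ hBW z h), fun i h => hr (hz ▸ hBℓ i z h), fun J k h => hr (hz ▸ hBb J k z h)⟩
  have halg : IsAlgebraicCurve f → ∃ X r₀ : ℝ, ∀ r, r₀ ≤ r →
      (∑ i, proximity f (lam i) r) + zeroCounting (wronskian F) r - characteristic F (n + 1) r ≤
        X := by
    intro h
    obtain ⟨X, r₀, hX⟩ := h.exists_wron_le hf hF ℓ hℓ b hb0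
    refine ⟨X + CA, max 1 r₀, fun r hr => ?_⟩
    have hr0 : r₀ ≤ r := (le_max_right _ _).trans hr
    have hr1 : 0 < r := zero_lt_one.trans_le ((le_max_left _ _).trans hr)
    have := hCA r hr1 (fun z hz => by
      obtain ⟨h1, h2, h3, -⟩ := hX z (by rwa [hz])
      exact ⟨h1, h2, h3⟩) (fun _ => X) continuousOn_const fun z hz J => (hX z (by rwa [hz])).2.2.2 J
    rw [Real.circleAverage_const] at this
    linarith
  rcases Nat.eq_zero_or_pos n with hn | hn
  -- For n = 0 the curve is constant, so Borel's lemma is not available. The Wronskian of a single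
  -- function is that function, so β = 0 and c = 0 work; 0 is put in the exceptional set because the
  -- circle estimate needs r > 0.
  · subst hn
    refine exists_smallError_of_bounds (c := 0) (C := CA) (E := B ∪ {0})
      (hBc.union (countable_singleton 0)).measurableSet
      (by rw [(hBc.union (countable_singleton 0)).measure_zero]; simp) (fun r hr hrE => ?_) halg
    simp only [mem_union, not_or, mem_singleton_iff] at hrE
    have hr0 : 0 < r := lt_of_le_of_ne hr (Ne.symm hrE.2)
    have := hCA r hr0 (hgen r hrE.1) (fun _ => 0) continuousOn_const fun z hz J => by
      have h1 := norm_wron_le (u := fun k w => b J k (F w)) (z := z) (X := 1)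
        (fun k => (hgen r hrE.1 z hz).2.2 J k) (fun i k => by
          have : (k : ℕ) = 0 := by omega
          rw [this, iteratedDeriv_zero, one_mul])
      simpa using h1
    rw [Real.circleAverage_const] at this
    simp only [zero_mul, le_refl, true_and]
    linarith
  · obtain ⟨C₀, hC₀, E, hE, hEv, hEg⟩ := exists_borel_growth_characteristic hn.ne' hd hF.ne_zero hnd
    obtain ⟨c, C₂, hc, hw⟩ := exists_wron_bound hd hF.ne_zero b hBc hBb hC₀
    refine exists_smallError_of_bounds (c := c) (C := C₂ + CA) (E := E ∪ B)
      (hE.union hBc.measurableSet) ?_ (fun r hr hrE => ?_) halg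
    · refine (measure_union_le _ _).trans_lt (ENNReal.add_lt_top.2 ⟨hEv, ?_⟩)
      rw [hBc.measure_zero]; simp
    · simp only [mem_union, not_or] at hrE
      obtain ⟨h1, h2, h3, h4⟩ := hEg r hr hrE.1
      refine ⟨mul_nonneg hc (Real.log_nonneg h2.le), ?_⟩
      obtain ⟨β, hβ, hβw, hβa⟩ := hw r h1 hrE.2 h2.le h3 h4
      have := hCA r ((Real.exp_pos 2).trans_le h1) (hgen r hrE.2) β hβ hβw
      linarith

end SecondMainTheorem

end CartanSMT

theorem mainTheorem10 {n q : ℕ} (ℓ : Fin q → Module.Dual ℂ (CartanSMT.AffineCone n))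
    (hℓ : ∀ i, ℓ i ≠ 0) (hgp : CartanSMT.InGeneralPosition ℓ)
    (lam : Fin q → CartanSMT.ProjSpace n → ℝ) (hlam : ∀ i, CartanSMT.IsWeilFunction (ℓ i) (lam i))
    (f : ℂ → CartanSMT.ProjSpace n) (F : ℂ → CartanSMT.AffineCone n)
    (hF : CartanSMT.IsReducedRepresentation F f) (hf : CartanSMT.IsLinearlyNondegenerate f) :
    ∃ ψ : ℝ → ℝ, CartanSMT.IsSmallError f F ψ ∧ ∃ C : ℝ, ∀ r : ℝ, 0 < r →
      (∑ i, CartanSMT.proximity f (lam i) r) + CartanSMT.zeroCounting (CartanSMT.wronskian F) r ≤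
        CartanSMT.characteristic F (n + 1) r + ψ r + C := by
  obtain ⟨ψ, hψ, C, hC⟩ := CartanSMT.exists_smallError hℓ hgp hlam hF hf
  exact ⟨ψ, hψ, C, fun r hr => by linarith [hC r hr]⟩
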